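/- A \emph{planar lattice graph} is a connected, locally finite graph $\mathcal G$ (loops and parallel edges allowed) embedded in the oriented plane and invariant under a lattice $\Lambda\cong\mathbb Z^2$ of translations, such that the quotient $G=\mathcal G/\Lambda$ is a finite graph on the torus $T^2=\mathbb R^2/\Lambda$ all of whose faces are topological disks; embedded graphs are considered up to orientation-preserving homeomorphism, i.e. through their rotation systems. Let $G^*$ be the dual of $G$ on $T^2$, let $VG$, $FG$ be the sets of vertices and faces of $G$, and for a face $f$ let $|f|$ be the number of edges on its boundary, counted with multiplicity. Put $$L(\theta)=-\int_0^\theta\log|2\sin t|\,dt,\qquad \mathrm{vol}(B_n)=2n\,L(\pi/n),$$ the latter being the volume of the regular ideal hyperbolic $n$-bipyramid, and define $$\mathrm{vol}^{\lozenge}(G)=\sum_{f\in FG}\mathrm{vol}(B_{|f|}),\qquad \nu^{\lozenge}(\mathcal G)=\frac{\mathrm{vol}^{\lozenge}(G)+\mathrm{vol}^{\lozenge}(G^*)}{|VG|}.$$ Given a basis $(b_0,b_1)$ of $\Lambda$ and a set $F$ of vertices containing exactly one vertex of each $\Lambda$-orbit, let $\Gamma_n$ be the subgraph of $\mathcal G$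 induced on $\bigcup_{0\le i,j<n}(ib_0+jb_1+F)$. Call $(b_0,b_1,F)$ admissible if $\Gamma_n$ is connected for all $n\ge1$. Let $\tau(\Gamma)$ be the number of spanning trees of $\Gamma$. The \emph{spanning tree entropy} of $\mathcal G$ is $$z_{\mathcal G}=\lim_{n\to\infty}\frac{\log\tau(\Gamma_n)}{|V\Gamma_n|}$$ for any admissible choice; to say that it is well defined means that admissible choices exist and that the limit exists and is the same real number for all of them. The \emph{medial graph} $\mathcal G'$ of $\mathcal G$ has the edges of $\mathcal G$ as its vertices (placed at the midpoints) and one edge, drawn in the corner, for each pair of consecutive edges around a vertex of $\mathcal G$. \textbf{Theorem.} Let $\mathcal G$ be a $3$-regular planar lattice graph and let $\mathcal G'$ be its medial graph. Then $\mathcal G'$ is a $4$-regular planar lattice graph, the spanning tree entropies $z_{\mathcal G}$ and $z_{\mathcal G'}$ are well defined, and $$\nu^{\lozenge}(\mathcal G)\le 2\pi z_{\mathcal G}\quad\Longrightarrow\quad \nu^{\lozenge}(\mathcal G')<2\pi z_{\mathcal G'}.$$ -/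

import Mathlib

universe u

noncomputable section

open Filter Topology

namespace PlanarLattice

/-! ### Spanning trees of multigraphs (loops and parallel edges allowed) -/

/-- `x` and `y` are joined by a walk in `G`. -/
def Reachable {α β : Type*} (G : Graph α β) (x y : α) : Prop :=
  Relation.ReflTransGen G.Adj x y

/-- `G` is connected (in particular it has a vertex). -/
def IsConnected {α β : Type*} (G : Graph α β) : Prop :=
  G.vertexSet.Nonempty ∧ ∀ x ∈ G.vertexSet, ∀ y ∈ G.vertexSet, Reachable G x y

/-- The edge set `T` is the edge set of a spanning tree of `G`: the subgraph with all the vertices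
of `G` and the edges `T` is connected and has no cycle. An edge lies on a cycle if and only if its
ends are still joined by a walk after the edge has been deleted (this includes loops). -/
structure IsSpanningTree {α β : Type*} (G : Graph α β) (T : Set β) : Prop where
  subset : T ⊆ G.edgeSet
  connected : IsConnected (G.restrict T)
  acyclic : ∀ e ∈ T, ∀ x y, G.IsLink e x y → ¬ Reachable (G.restrict (T \ {e})) x y

/-- `τ(G)`, the number of spanning trees. -/
def numSpanningTrees {α β : Type*} (G : Graph α β) : ℕ :=
  {T : Set β | IsSpanningTree G T}.ncard

/-! ### Graphs cellularly embedded in oriented surfaces -/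

/-- A graph embedded in an oriented surface so that its faces are disks, given by its rotation
system. A dart is an edge together with a direction and emanates from its initial vertex;
`rev d` is `d` with the other direction, and `next d` is the dart that follows `d` in the
counterclockwise order around the initial vertex of `d`. Loops and parallel edges are allowed. -/
structure EmbeddedGraph where
  Dart : Type u
  next : Equiv.Perm Dart
  rev : Equiv.Perm Dart
  rev_rev : ∀ d, rev (rev d) = d
  rev_ne : ∀ d, rev d ≠ d

namespace EmbeddedGraph

variable (G : EmbeddedGraph.{u})

/-- The dart that follows `d` on the boundary of the face to the left of `d`: at the end of `d`
turn to the clockwise neighbour of the reversed dart. -/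
def faceNext : Equiv.Perm G.Dart := G.rev.trans G.next.symm

/-- Vertices are the cycles of `next`. -/
def Vertex : Type u := Quotient (Equiv.Perm.SameCycle.setoid G.next)

/-- Edges are the cycles of `rev`, i.e. the pairs `{d, rev d}`. -/
def Edge : Type u := Quotient (Equiv.Perm.SameCycle.setoid G.rev)

/-- Faces are the cycles of `faceNext`, each face being to the left of its darts. -/
def Face : Type u := Quotient (Equiv.Perm.SameCycle.setoid G.faceNext)

/-- The initial vertex of a dart. -/
def vertexOf (d : G.Dart) : G.Vertex := Quotient.mk (Equiv.Perm.SameCycle.setoid G.next) d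

/-- The edge of a dart. -/
def edgeOf (d : G.Dart) : G.Edge := Quotient.mk (Equiv.Perm.SameCycle.setoid G.rev) d

/-- The face to the left of a dart. -/
def faceOf (d : G.Dart) : G.Face := Quotient.mk (Equiv.Perm.SameCycle.setoid G.faceNext) d

/-- `|v|`: the number of edges incident to `v`, loops counted twice. -/
def vertexDegree (v : G.Vertex) : ℕ := Nat.card {d : G.Dart // G.vertexOf d = v}

/-- `|f|`: the number of edges on the boundary of `f`, with multiplicity. -/
def faceDegree (f : G.Face) : ℕ := Nat.card {d : G.Dart // G.faceOf d = f}

def IsRegular (k : ℕ) : Prop := ∀ v : G.Vertex, G.vertexDegree v = k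

/-- The underlying multigraph. -/
def toGraph : Graph G.Vertex G.Edge where
  vertexSet := Set.univ
  IsLink e x y := ∃ d, G.edgeOf d = e ∧ G.vertexOf d = x ∧ G.vertexOf (G.rev d) = y
  isLink_symm := by
    intro e _
    refine ⟨?_⟩
    rintro x y ⟨d, rfl, rfl, rfl⟩
    refine ⟨G.rev d, ?_, rfl, by rw [G.rev_rev]⟩
    exact Quotient.sound (s := Equiv.Perm.SameCycle.setoid G.rev)
      (Equiv.Perm.sameCycle_apply_left.2 (Equiv.Perm.SameCycle.refl _ _))
  eq_or_eq_of_isLink_of_isLink := by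
    rintro e x y v w ⟨d, hd, rfl, rfl⟩ ⟨d', hd', rfl, rfl⟩
    have h : G.rev.SameCycle d d' :=
      Quotient.exact (s := Equiv.Perm.SameCycle.setoid G.rev) (hd.trans hd'.symm)
    obtain ⟨n, hn⟩ := h
    have h2 : G.rev ^ (2 : ℤ) = 1 := by
      ext a
      exact G.rev_rev a
    rcases Int.even_or_odd' n with ⟨k, rfl | rfl⟩
    · left
      rw [zpow_mul, h2, one_zpow] at hn
      rw [← hn]
      rfl
    · right
      rw [zpow_add, zpow_mul, h2, one_zpow, one_mul, zpow_one] at hn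
      rw [← hn, G.rev_rev]
  left_mem_of_isLink := fun _ _ _ _ => Set.mem_univ _

/-- The dual graph in the same surface: its vertices are the faces of `G`, and its dart `d` crosses
the dart `d` of `G` from left to right. -/
def dual : EmbeddedGraph.{u} where
  Dart := G.Dart
  next := G.faceNext
  rev := G.rev
  rev_rev := G.rev_rev
  rev_ne := G.rev_ne

/-- `|V| - |E| + |F|`, for a finite graph. -/
def eulerChar : ℤ := (Nat.card G.Vertex : ℤ) - Nat.card G.Edge + Nat.card G.Face

end EmbeddedGraph

/-! ### Bipyramid volumes -/

/-- The Lobachevsky function `L(θ) = -∫₀^θ log |2 sin t| dt`. -/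
def lobachevsky (θ : ℝ) : ℝ := -∫ t in (0 : ℝ)..θ, Real.log |2 * Real.sin t|

/-- The volume `2 n L(π / n)` of the hyperbolic regular ideal `n`-bipyramid. -/
def bipyramidVol (n : ℕ) : ℝ := 2 * n * lobachevsky (Real.pi / n)

/-- The bipyramid volume of a finite embedded graph: the sum over its faces `f` of the volume of
the regular ideal `|f|`-bipyramid. -/
def EmbeddedGraph.bipyramidVolume (G : EmbeddedGraph.{u}) : ℝ :=
  ∑ᶠ f : G.Face, bipyramidVol (G.faceDegree f)

/-! ### Planar lattice graphs -/

/-- An embedded graph with a free action of the lattice `Λ = ℤ²` by orientation-preserving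
automorphisms of the embedded graph. -/
structure PeriodicGraph extends EmbeddedGraph.{u} where
  shift : ℤ × ℤ → Dart → Dart
  shift_zero : ∀ d, shift 0 d = d
  shift_add : ∀ a b d, shift (a + b) d = shift a (shift b d)
  shift_next : ∀ a d, shift a (next d) = next (shift a d)
  shift_rev : ∀ a d, shift a (rev d) = rev (shift a d)
  shift_free : ∀ a d, shift a d = d → a = 0

namespace PeriodicGraph

variable (𝒢 : PeriodicGraph.{u})

/-- Being translates of each other under `Λ`. -/
def orbitSetoid : Setoid 𝒢.Dart where
  r d d' := ∃ a, 𝒢.shift a d = d'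
  iseqv :=
    { refl := fun d => ⟨0, 𝒢.shift_zero d⟩
      symm := by
        rintro d d' ⟨a, rfl⟩
        exact ⟨-a, by rw [← 𝒢.shift_add, neg_add_cancel, 𝒢.shift_zero]⟩
      trans := by
        rintro d d' d'' ⟨a, rfl⟩ ⟨b, rfl⟩
        exact ⟨b + a, 𝒢.shift_add b a d⟩ }

/-- A permutation of the darts that commutes with `Λ` acts on the darts modulo `Λ`. -/
def quotientPerm (f : Equiv.Perm 𝒢.Dart) (hf : ∀ a d, 𝒢.shift a (f d) = f (𝒢.shift a d)) :
    Equiv.Perm (Quotient 𝒢.orbitSetoid) :=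
  Quotient.congr f (by
    intro d d'
    constructor
    · rintro ⟨a, rfl⟩
      exact ⟨a, hf a d⟩
    · rintro ⟨a, h⟩
      exact ⟨a, f.injective ((hf a d).symm.trans h)⟩)

/-- The quotient `G = 𝒢 / Λ`, embedded in the quotient surface. -/
def quotient : EmbeddedGraph.{u} where
  Dart := Quotient 𝒢.orbitSetoid
  next := 𝒢.quotientPerm 𝒢.next 𝒢.shift_next
  rev := 𝒢.quotientPerm 𝒢.rev 𝒢.shift_rev
  rev_rev := by
    rintro ⟨d⟩
    exact congrArg (Quotient.mk 𝒢.orbitSetoid) (𝒢.rev_rev d)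
  rev_ne := by
    rintro ⟨d⟩ h
    obtain ⟨a, ha⟩ : ∃ a, 𝒢.shift a (𝒢.rev d) = d := Quotient.exact (s := 𝒢.orbitSetoid) h
    have h2 : 𝒢.shift (a + a) d = d := by
      rw [𝒢.shift_add]
      have h1 : 𝒢.shift a d = 𝒢.rev d := by
        rw [← 𝒢.rev_rev (𝒢.shift a d), ← 𝒢.shift_rev, ha]
      rw [h1, ha]
    have h0 := 𝒢.shift_free _ _ h2
    have ha0 : a = 0 := by
      have h1 := congrArg Prod.fst h0
      have h2 := congrArg Prod.snd h0
      simp only [Prod.fst_add, Prod.snd_add, Prod.fst_zero, Prod.snd_zero] at h1 h2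
      ext
      · simp only [Prod.fst_zero]; omega
      · simp only [Prod.snd_zero]; omega
    rw [ha0, 𝒢.shift_zero] at ha
    exact 𝒢.rev_ne d ha

/-- `𝒢` is a planar lattice graph: it is connected and locally finite, its faces are finite
polygons, and `𝒢 / Λ` is a finite graph on the torus. As `Λ` acts freely, the surface that carries
`𝒢` is a connected covering of the closed oriented surface that carries `𝒢 / Λ`, with deck group
`Λ = ℤ²`. The latter has Euler characteristic `0` if and only if it is a torus, and then the former
is its universal covering, i.e. the plane with `Λ` acting as a lattice of translations. -/
structure IsPlanarLatticeGraph : Prop where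
  connected : IsConnected 𝒢.toGraph
  locallyFinite : ∀ v : 𝒢.Vertex, {d : 𝒢.Dart | 𝒢.vertexOf d = v}.Finite
  faceFinite : ∀ f : 𝒢.Face, {d : 𝒢.Dart | 𝒢.faceOf d = f}.Finite
  quotientFinite : Finite 𝒢.quotient.Dart
  torus : 𝒢.quotient.eulerChar = 0

/-- The bipyramid volume of `𝒢`: with `G = 𝒢 / Λ` and `G*` its dual on the torus, the sum of the
bipyramid volumes of `G` and `G*`, divided by the number of vertices of `G`. -/
def bipyramidVolumePerVertex : ℝ :=
  (𝒢.quotient.bipyramidVolume + 𝒢.quotient.dual.bipyramidVolume) / Nat.card 𝒢.quotient.Vertex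

/-! ### Spanning tree entropy -/

/-- The action of `Λ` on the vertices. -/
def shiftVertex (a : ℤ × ℤ) : 𝒢.Vertex → 𝒢.Vertex :=
  Quotient.map' (s₁ := Equiv.Perm.SameCycle.setoid 𝒢.next)
    (s₂ := Equiv.Perm.SameCycle.setoid 𝒢.next) (𝒢.shift a) (by
    rintro d d' ⟨n, rfl⟩
    have hc : Function.Commute (𝒢.shift a) 𝒢.next := fun d => 𝒢.shift_next a d
    have hn : ∀ (k : ℕ) (d : 𝒢.Dart), 𝒢.shift a ((𝒢.next ^ k) d) = (𝒢.next ^ k) (𝒢.shift a d) := by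
      intro k d
      rw [Equiv.Perm.coe_pow]
      exact hc.iterate_right k d
    refine ⟨n, ?_⟩
    obtain ⟨k, rfl | rfl⟩ := n.eq_nat_or_neg
    · rw [zpow_natCast]
      exact (hn k d).symm
    · rw [zpow_neg, zpow_natCast, Equiv.Perm.inv_eq_iff_eq, ← hn]
      simp)

/-- The vertices in the `n × n` copies of `F` given by the basis `b` of `Λ`. -/
def boxVertices (b : Module.Basis (Fin 2) ℤ (ℤ × ℤ)) (F : Set 𝒢.Vertex) (n : ℕ) :
    Set 𝒢.Vertex :=
  {v | ∃ i < n, ∃ j < n, ∃ w ∈ F, 𝒢.shiftVertex ((i : ℤ) • b 0 + (j : ℤ) • b 1) w = v}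

/-- `Γ_n`: the subgraph of `𝒢` induced on the `n × n` copies of `F`. -/
def box (b : Module.Basis (Fin 2) ℤ (ℤ × ℤ)) (F : Set 𝒢.Vertex) (n : ℕ) :
    Graph 𝒢.Vertex 𝒢.Edge :=
  𝒢.toGraph.induce (𝒢.boxVertices b F n)

/-- A basis `b` of `Λ` and a fundamental domain `F` for the action of `Λ` on the vertices
(a set that contains exactly one vertex of each orbit) such that all the graphs `Γ_n`, `n ≥ 1`,
are connected. -/
structure IsExhaustion (b : Module.Basis (Fin 2) ℤ (ℤ × ℤ)) (F : Set 𝒢.Vertex) : Prop where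
  fundamental : ∀ v, ∃! a, 𝒢.shiftVertex a v ∈ F
  connected : ∀ n, 1 ≤ n → IsConnected (𝒢.box b F n)

/-- `z` is the spanning tree entropy of `𝒢`: the limit of `log τ(Γ_n) / |V Γ_n|` exists and
equals `z` for every choice of the basis and the fundamental domain, and there is such a choice. -/
def HasSpanningTreeEntropy (z : ℝ) : Prop :=
  (∃ b F, 𝒢.IsExhaustion b F) ∧
    ∀ b F, 𝒢.IsExhaustion b F →
      Tendsto (fun n : ℕ => Real.log (numSpanningTrees (𝒢.box b F n)) /
        ((𝒢.box b F n).vertexSet.ncard : ℝ)) atTop (𝓝 z)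

/-! ### The medial graph -/

/-- The medial graph. Its vertices are the edges of `𝒢`, and it has one edge for each corner of
`𝒢`, i.e. for each pair of consecutive edges around a vertex of `𝒢`, drawn in that corner. The
medial edge of the corner between `d` and `next d` consists of the medial darts `(d, true)`, which
starts at the midpoint of `d` on the left of `d`, and `(next d, false)`, which starts at the
midpoint of `next d` on the right of `next d`. The counterclockwise order around the midpoint of
`d` is `(d, true)`, `(d, false)`, `(rev d, true)`, `(rev d, false)`. -/
def medial : PeriodicGraph.{u} where
  Dart := 𝒢.Dart × Bool
  next :=
    { toFun := fun p => match p with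
        | (d, true) => (d, false)
        | (d, false) => (𝒢.rev d, true)
      invFun := fun p => match p with
        | (d, false) => (d, true)
        | (d, true) => (𝒢.rev d, false)
      left_inv := by rintro ⟨d, _ | _⟩ <;> simp [𝒢.rev_rev]
      right_inv := by rintro ⟨d, _ | _⟩ <;> simp [𝒢.rev_rev] }
  rev :=
    { toFun := fun p => match p with
        | (d, true) => (𝒢.next d, false)
        | (d, false) => (𝒢.next.symm d, true)
      invFun := fun p => match p with
        | (d, true) => (𝒢.next d, false)
        | (d, false) => (𝒢.next.symm d, true)
      left_inv := by rintro ⟨d, _ | _⟩ <;> simp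
      right_inv := by rintro ⟨d, _ | _⟩ <;> simp }
  rev_rev := by rintro ⟨d, _ | _⟩ <;> simp
  rev_ne := by rintro ⟨d, _ | _⟩ <;> simp
  shift a p := (𝒢.shift a p.1, p.2)
  shift_zero := by simp [𝒢.shift_zero]
  shift_add := by simp [𝒢.shift_add]
  shift_next := by rintro a ⟨d, _ | _⟩ <;> simp [𝒢.shift_rev]
  shift_rev := by
    rintro a ⟨d, _ | _⟩
    · simp [Equiv.eq_symm_apply, ← 𝒢.shift_next]
    · simp [𝒢.shift_next]
  shift_free := by
    rintro a ⟨d, s⟩ h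
    exact 𝒢.shift_free a d (congrArg Prod.fst h)

end PeriodicGraph

end PlanarLattice

end

/-! The theorem combines one identity with two inequalities. Let `D` be the number of darts of `𝒢 /
Λ`, which then has `D/3` vertices and `D/2` edges, while the medial quotient has `D/2` vertices, all
of degree 4. The medial faces correspond to the vertices and the faces of `𝒢`, so `ν(𝒢') = (2/3)
ν(𝒢) + vol(B_4)` (`bipyramidVolumePerVertex_medial`). With `2 z + log 6 ≤ 3 z'`
(`exists_hasSpanningTreeEntropy_medial`) and `vol(B_4) < (2π/3) log 6` (`bipyramidVol_four_lt`) this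
gives `2π z' ≥ (2/3) 2π z + (2π/3) log 6 > ν(𝒢')` as soon as `ν(𝒢) ≤ 2π z`.

The entropy inequality is a star-triangle argument on a finite induced subgraph with `V` vertices
and `E` edges. Subdivide every edge at its midpoint. A spanning tree `T` extends to `2^(E-V+1)`
spanning trees `L` of the subdivision: both halves of each edge in `T` and one half of each other
edge. At a vertex with 1, 2 or 3 half-edges in `L`, replace the star by a tree of corners on the
same midpoints, in 1, 1 or 3 ways; the result is a spanning tree `U` of the medial graph.
Conversely, `U` determines `L` except at the vertices where it has no corner, with at most 3 choices
at each. The number of vertices with three half-edges minus the number of those with one is always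
`E - V - 1`, so weighted double counting yields `(2/3) 6^(E-V) τ ≤ τ'`
(`pow_mul_numSpanningTrees_le_medial`). Per fundamental cell, `E - V` tends to `D/6`.

The entropies exist by packing: spanning trees of disjoint subgraphs extend jointly to a spanning
tree of the whole, so `log τ(Γ_n) / n^2` converges to its supremum, and the boxes of two exhaustions
can be packed into each other (`exists_hasSpanningTreeEntropy`). Admissible exhaustions come from a
tree-cotree decomposition of the torus: the two leftover edges have voltages that form a basis of
`Λ` (`exists_span_voltage`). -/

noncomputable section

open Filter Topology

namespace PlanarLattice

/-! ### Spanning trees of finite multigraphs. -/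

section Trees

variable {α β : Type*} {G H : Graph α β} {S T : Set β} {x y z : α}

lemma Reachable.symm (h : Reachable G x y) : Reachable G y x :=
  have : Std.Symm G.Adj := ⟨fun _ _ h => h.symm⟩
  Relation.ReflTransGen.stdSymm.symm _ _ h

lemma Reachable.trans (h : Reachable G x y) (h' : Reachable G y z) : Reachable G x z :=
  Relation.ReflTransGen.trans h h'

lemma Reachable.of_isLink {e : β} (h : G.IsLink e x y) : Reachable G x y :=
  Relation.ReflTransGen.single h.adj

lemma Reachable.map {α' β' : Type*} {G' : Graph α' β'} (f : α → α')
    (hf : ∀ e u v, G.IsLink e u v → Reachable G' (f u) (f v)) (h : Reachable G x y) :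
    Reachable G' (f x) (f y) := by
  induction h with
  | refl => exact Relation.ReflTransGen.refl
  | tail _ h ih =>
    obtain ⟨e, he⟩ := h
    exact ih.trans (hf e _ _ he)

lemma Reachable.mono (h : G ≤ H) (hxy : Reachable G x y) : Reachable H x y :=
  hxy.map id fun _ _ _ he => .of_isLink (he.mono h)

lemma Reachable.of_invariant {p : α → Prop} (hp : ∀ e u v, G.IsLink e u v → p u → p v)
    (h : Reachable G x y) (hx : p x) : p y := by
  induction h with
  | refl => exact hx
  | tail _ h ih =>
    obtain ⟨e, he⟩ := h
    exact hp e _ _ he ih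

/-- A walk that uses `f` several times can be shortened to use it at most once, in one of its two
directions. -/
lemma reachable_restrict_insert {f : β} {a b : α} (hf : G.IsLink f a b)
    (h : Reachable (G.restrict (insert f T)) x y) :
    Reachable (G.restrict T) x y ∨
      (Reachable (G.restrict T) x a ∧ Reachable (G.restrict T) b y) ∨
      (Reachable (G.restrict T) x b ∧ Reachable (G.restrict T) a y) := by
  induction h with
  | refl => exact Or.inl Relation.ReflTransGen.refl
  | @tail u v _ h ih =>
    obtain ⟨e, he⟩ := h
    rw [Graph.restrict_isLink] at he
    obtain ⟨he, hl⟩ : (e = f ∨ e ∈ T) ∧ G.IsLink e u v := by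
      simpa [and_comm] using he
    rcases he with rfl | he
    · rcases hl.eq_and_eq_or_eq_and_eq hf with ⟨rfl, rfl⟩ | ⟨rfl, rfl⟩
      · rcases ih with h | ⟨h, h'⟩ | ⟨h, h'⟩
        · exact Or.inr (Or.inl ⟨h, .refl⟩)
        · exact Or.inr (Or.inl ⟨h, .refl⟩)
        · exact Or.inl h
      · rcases ih with h | ⟨h, h'⟩ | ⟨h, h'⟩
        · exact Or.inr (Or.inr ⟨h, .refl⟩)
        · exact Or.inl h
        · exact Or.inr (Or.inr ⟨h, .refl⟩)
    · have hs : Reachable (G.restrict T) u v := .of_isLink (e := e) (by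
        rw [Graph.restrict_isLink]; exact ⟨he, hl⟩)
      rcases ih with h | ⟨h, h'⟩ | ⟨h, h'⟩
      · exact Or.inl (h.trans hs)
      · exact Or.inr (Or.inl ⟨h, h'.trans hs⟩)
      · exact Or.inr (Or.inr ⟨h, h'.trans hs⟩)

/-- No edge of `T` lies on a cycle of edges in `T`. -/
def IsAcyclicSet (G : Graph α β) (T : Set β) : Prop :=
  ∀ e ∈ T, ∀ x y, G.IsLink e x y → ¬ Reachable (G.restrict (T \ {e})) x y

/-- If an old edge `e` were on a new cycle, this cycle would pass through `f`, and its remainder,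
which runs through `e`, would join the ends of `f` within `T`. -/
lemma IsAcyclicSet.insert {f : β} {a b : α} (hT : IsAcyclicSet G T) (hf : G.IsLink f a b)
    (hab : ¬ Reachable (G.restrict T) a b) : IsAcyclicSet G (insert f T) := by
  have hfT : f ∉ T := fun h => hab (.of_isLink (e := f) (by
    rw [Graph.restrict_isLink]; exact ⟨h, hf⟩))
  intro e he x y hl h
  by_cases hef : e = f
  · subst hef
    rw [Set.insert_sdiff_of_mem _ (Set.mem_singleton e), Set.sdiff_singleton_eq_self hfT] at h
    rcases hl.eq_and_eq_or_eq_and_eq hf with ⟨rfl, rfl⟩ | ⟨rfl, rfl⟩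
    · exact hab h
    · exact hab h.symm
  · have heT : e ∈ T := he.resolve_left hef
    rw [Set.insert_sdiff_of_notMem _ (by simpa using Ne.symm hef)] at h
    have hm : G.restrict (T \ {e}) ≤ G.restrict T := G.restrict_mono_right Set.sdiff_subset
    have hxy : Reachable (G.restrict T) x y := .of_isLink (e := e) (by
      rw [Graph.restrict_isLink]; exact ⟨heT, hl⟩)
    rcases reachable_restrict_insert hf h with h | ⟨h, h'⟩ | ⟨h, h'⟩
    · exact hT e heT x y hl h
    · exact hab ((h.mono hm).symm.trans (hxy.trans (h'.mono hm).symm))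
    · exact hab ((h'.mono hm).trans (hxy.symm.trans (h.mono hm)))

/-- A tree grows from a root `r`: each step adds an edge of `T` that leaves the set `W` of vertices
reached so far. Keeping the ends of `A` inside `W` guarantees that this edge is new. -/
lemma exists_connected_subset_ncard (hV : G.vertexSet.Finite)
    (hc : IsConnected (G.restrict T)) :
    ∃ A ⊆ T, A.Finite ∧ IsConnected (G.restrict A) ∧ A.ncard + 1 = G.vertexSet.ncard := by
  obtain ⟨⟨r, hr⟩, hc⟩ := hc
  rw [Graph.vertexSet_restrict] at hr hc
  have hpos : 0 < G.vertexSet.ncard := (Set.ncard_pos hV).2 ⟨r, hr⟩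
  have key : ∀ k, k + 1 ≤ G.vertexSet.ncard → ∃ (W : Set α) (A : Set β), W ⊆ G.vertexSet ∧ r ∈ W ∧
      W.ncard = k + 1 ∧ A.Finite ∧ A ⊆ T ∧ A.ncard = k ∧
      (∀ w ∈ W, Reachable (G.restrict A) r w) ∧
      (∀ e ∈ A, ∀ x y, G.IsLink e x y → x ∈ W) := by
    intro k
    induction k with
    | zero =>
      intro _
      refine ⟨{r}, ∅, by simpa using hr, rfl, by simp, Set.finite_empty, Set.empty_subset _,
        by simp, ?_, by simp⟩
      rintro w rfl
      exact .refl
    | succ k ih =>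
      intro hk
      obtain ⟨W, A, hWV, hrW, hW, hAf, hAT, hA, hreach, hends⟩ := ih (by omega)
      have hWf : W.Finite := hV.subset hWV
      obtain ⟨e, u, w, he, hl, hu, hw⟩ : ∃ e u w, e ∈ T ∧ G.IsLink e u w ∧ u ∈ W ∧ w ∉ W := by
        by_contra! hcon
        have : G.vertexSet ⊆ W := fun v hv =>
          (hc r hr v hv).of_invariant (p := (· ∈ W)) (fun e u v he hu => by
            rw [Graph.restrict_isLink] at he
            exact hcon e u v he.1 he.2 hu) hrW
        have := Set.ncard_le_ncard this hWf
        omega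
      have heA : e ∉ A := fun h => hw (hends e h w u hl.symm)
      refine ⟨insert w W, insert e A, Set.insert_subset hl.right_mem hWV, Or.inr hrW, ?_,
        hAf.insert e, Set.insert_subset he hAT, ?_, ?_, ?_⟩
      · rw [Set.ncard_insert_of_notMem hw hWf, hW]
      · rw [Set.ncard_insert_of_notMem heA hAf, hA]
      · have hm : G.restrict A ≤ G.restrict (insert e A) :=
          G.restrict_mono_right (Set.subset_insert e A)
        have hlast : Reachable (G.restrict (insert e A)) u w := .of_isLink (e := e) (by
          rw [Graph.restrict_isLink]; exact ⟨Or.inl rfl, hl⟩)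
        rintro v (rfl | hv)
        · exact ((hreach u hu).mono hm).trans hlast
        · exact (hreach v hv).mono hm
      · rintro f (rfl | hf) x y hxy
        · rcases hxy.eq_and_eq_or_eq_and_eq hl with ⟨rfl, rfl⟩ | ⟨rfl, rfl⟩
          · exact Or.inr hu
          · exact Or.inl rfl
        · exact Or.inr (hends f hf x y hxy)
  obtain ⟨W, A, hWV, hrW, hW, hAf, hAT, hA, hreach, -⟩ :=
    key (G.vertexSet.ncard - 1) (by omega)
  have hWV' : W = G.vertexSet := Set.eq_of_subset_of_ncard_le hWV (by omega) hV
  subst hWV'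
  exact ⟨A, hAT, hAf, ⟨⟨r, hr⟩, fun x hx y hy => (hreach x hx).symm.trans (hreach y hy)⟩, by omega⟩

lemma IsConnected.of_reachable (hne : G.vertexSet.Nonempty) (hc : IsConnected H)
    (hV : G.vertexSet = H.vertexSet) (h : ∀ e x y, H.IsLink e x y → Reachable G x y) :
    IsConnected G :=
  ⟨hne, fun x hx y hy => (hc.2 x (hV ▸ hx) y (hV ▸ hy)).map id h⟩

/-- A connected edge set contains a connected subset with one edge less than there are vertices.
Acyclicity forbids this subset to be proper; conversely, an edge on a cycle could be deleted,
leaving a connected set with too few edges. -/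
lemma isSpanningTree_iff (hV : G.vertexSet.Finite) (hT : T.Finite) :
    IsSpanningTree G T ↔
      T ⊆ G.edgeSet ∧ IsConnected (G.restrict T) ∧ T.ncard + 1 = G.vertexSet.ncard := by
  constructor
  · intro h
    refine ⟨h.subset, h.connected, ?_⟩
    obtain ⟨A, hAT, hAf, hAc, hA⟩ := exists_connected_subset_ncard hV h.connected
    suffices hTA : T ⊆ A by rw [hTA.antisymm hAT, hA]
    intro e he
    by_contra heA
    obtain ⟨x, y, hxy⟩ := Graph.exists_isLink_of_mem_edgeSet (h.subset he)
    exact h.acyclic e he x y hxy ((hAc.2 x hxy.left_mem y hxy.right_mem).mono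
      (G.restrict_mono_right fun f hf => ⟨hAT hf, by rintro rfl; exact heA hf⟩))
  · rintro ⟨hTE, hTc, hcard⟩
    refine ⟨hTE, hTc, fun e he x y hxy hr => ?_⟩
    have hc : IsConnected (G.restrict (T \ {e})) := by
      refine IsConnected.of_reachable hTc.1 hTc rfl fun f u v hf => ?_
      rw [Graph.restrict_isLink] at hf
      by_cases hfe : f = e
      · subst hfe
        rcases hf.2.eq_and_eq_or_eq_and_eq hxy with ⟨rfl, rfl⟩ | ⟨rfl, rfl⟩
        · exact hr
        · exact hr.symm
      · exact .of_isLink (e := f) (by rw [Graph.restrict_isLink]; exact ⟨⟨hf.1, hfe⟩, hf.2⟩)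
    obtain ⟨A, hAT, hAf, hAc, hA⟩ := exists_connected_subset_ncard hV hc
    have h1 := Set.ncard_le_ncard hAT (hT.subset Set.sdiff_subset)
    have h2 := Set.ncard_sdiff_singleton_lt_of_mem he hT
    omega

/-- A maximal acyclic set that contains `T` already joins the ends of every edge. -/
lemma IsAcyclicSet.exists_isSpanningTree (hE : G.edgeSet.Finite) (hc : IsConnected G)
    (hTE : T ⊆ G.edgeSet) (hT : IsAcyclicSet G T) : ∃ T', T ⊆ T' ∧ IsSpanningTree G T' := by
  have hfin : {S | S ⊆ G.edgeSet ∧ IsAcyclicSet G S}.Finite :=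
    hE.finite_subsets.subset fun S hS => hS.1
  obtain ⟨T', hTT', hmax⟩ := hfin.exists_le_maximal ⟨hTE, hT⟩
  refine ⟨T', hTT', hmax.1.1, ?_, hmax.1.2⟩
  refine IsConnected.of_reachable hc.1 hc rfl fun f u v hf => ?_
  by_contra hcon
  have h1 := hmax.2 (y := Insert.insert f T') ⟨Set.insert_subset hf.edge_mem hmax.1.1,
    hmax.1.2.insert hf hcon⟩ (Set.subset_insert f T')
  exact hcon (.of_isLink (e := f) (by
    rw [Graph.restrict_isLink]; exact ⟨h1 (Set.mem_insert f T'), hf⟩))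

lemma IsConnected.exists_isSpanningTree (hE : G.edgeSet.Finite) (hc : IsConnected G) :
    ∃ T, IsSpanningTree G T := by
  obtain ⟨T, -, hT⟩ := IsAcyclicSet.exists_isSpanningTree (T := ∅) hE hc (Set.empty_subset _)
    (by rintro e ⟨⟩)
  exact ⟨T, hT⟩

lemma finite_setOf_isSpanningTree (hE : G.edgeSet.Finite) : {T | IsSpanningTree G T}.Finite :=
  hE.finite_subsets.subset fun _ hT => hT.subset

lemma IsConnected.numSpanningTrees_pos (hE : G.edgeSet.Finite) (hc : IsConnected G) :
    0 < numSpanningTrees G :=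
  (Set.ncard_pos (finite_setOf_isSpanningTree hE)).2 (hc.exists_isSpanningTree hE)

lemma numSpanningTrees_le_two_pow (hE : G.edgeSet.Finite) :
    numSpanningTrees G ≤ 2 ^ G.edgeSet.ncard := by
  rw [← Set.ncard_powerset _ hE]
  exact Set.ncard_le_ncard (fun T hT => IsSpanningTree.subset hT) hE.finite_subsets

/-- The spanning trees of pairwise disjoint subgraphs of a connected graph extend to spanning trees
of the whole graph. -/
lemma prod_numSpanningTrees_le {ι : Type*} [Fintype ι] (H : ι → Graph α β)
    (hE : G.edgeSet.Finite) (hc : IsConnected G) (hle : ∀ i, H i ≤ G)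
    (hdisj : ∀ i j, i ≠ j → Disjoint (H i).vertexSet (H j).vertexSet) :
    ∏ i, numSpanningTrees (H i) ≤ numSpanningTrees G := by
  have hEi : ∀ i, (H i).edgeSet.Finite := fun i => hE.subset (hle i).edgeSet_mono
  -- The subgraphs share no vertices, so a walk along the union of the trees that starts in `H i`
  -- never leaves `H i`.
  have hac : ∀ T : ∀ i, {T // IsSpanningTree (H i) T},
      IsAcyclicSet G (⋃ i, (T i : Set β)) := by
    intro T e he x y hxy hr
    obtain ⟨i, hi⟩ := Set.mem_iUnion.1 he
    have hxy' : (H i).IsLink e x y := ((hle i).isLink_iff ((T i).2.subset hi)).2 hxy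
    refine (T i).2.acyclic e hi x y hxy' ?_
    refine (hr.of_invariant (p := fun v => v ∈ (H i).vertexSet ∧
      Reachable ((H i).restrict ((T i : Set β) \ {e})) x v) ?_ ⟨hxy'.left_mem, .refl⟩).2
    rintro f u v hf ⟨hu, hur⟩
    rw [Graph.restrict_isLink] at hf
    obtain ⟨⟨hfT, hfe⟩, hf⟩ := hf
    obtain ⟨j, hj⟩ := Set.mem_iUnion.1 hfT
    have hf' : (H j).IsLink f u v := ((hle j).isLink_iff ((T j).2.subset hj)).2 hf
    obtain rfl : i = j := by
      by_contra hij
      exact Set.disjoint_left.1 (hdisj i j hij) hu hf'.left_mem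
    exact ⟨hf'.right_mem, hur.trans (.of_isLink (e := f) (by
      rw [Graph.restrict_isLink]; exact ⟨⟨hj, hfe⟩, hf'⟩))⟩
  have hext : ∀ T : ∀ i, {T // IsSpanningTree (H i) T},
      ∃ T' : {T // IsSpanningTree G T}, ∀ i, (T i : Set β) ⊆ T' := by
    intro T
    obtain ⟨T', h1, h2⟩ := (hac T).exists_isSpanningTree hE hc
      (Set.iUnion_subset fun i => (T i).2.subset.trans (hle i).edgeSet_mono)
    exact ⟨⟨T', h2⟩, fun i => (Set.subset_iUnion _ i).trans h1⟩
  choose F hF using hext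
  -- An edge of `H i` outside `T i` would close a cycle with `T i`. Hence the extension gives back
  -- each `T i`, and extending is injective.
  have hFi : ∀ T i, (T i : Set β) = (F T : Set β) ∩ (H i).edgeSet := by
    intro T i
    refine Set.Subset.antisymm (Set.subset_inter (hF T i) (T i).2.subset) ?_
    rintro e ⟨he, hei⟩
    by_contra hne
    obtain ⟨x, y, hxy⟩ := Graph.exists_isLink_of_mem_edgeSet hei
    refine (F T).2.acyclic e he x y (hxy.mono (hle i)) ?_
    refine ((T i).2.connected.2 x hxy.left_mem y hxy.right_mem).mono
      ((Graph.restrict_mono_left (hle i) _).trans (G.restrict_mono_right fun f hf => ?_))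
    exact ⟨hF T i hf, by rintro rfl; exact hne hf⟩
  have hinj : Function.Injective F := by
    intro T T' h
    funext i
    exact Subtype.ext (by rw [hFi T i, hFi T' i, h])
  have : Finite {T // IsSpanningTree G T} := finite_setOf_isSpanningTree hE
  have h := Nat.card_le_card_of_injective F hinj
  rw [Nat.card_pi] at h
  exact h

lemma IsSpanningTree.image {α' β' : Type*} {G' : Graph α' β'} (f : α ≃ α') (g : β ≃ β')
    (hV : ∀ x, x ∈ G.vertexSet ↔ f x ∈ G'.vertexSet)
    (hL : ∀ e x y, G.IsLink e x y ↔ G'.IsLink (g e) (f x) (f y)) (hT : IsSpanningTree G T) :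
    IsSpanningTree G' (g '' T) := by
  have hr : ∀ (S : Set β) x y, Reachable (G.restrict S) x y →
      Reachable (G'.restrict (g '' S)) (f x) (f y) := fun S x y h => h.map f fun e u v he => by
    rw [Graph.restrict_isLink, hL] at he
    exact .of_isLink (e := g e) (by
      rw [Graph.restrict_isLink]; exact ⟨Set.mem_image_of_mem g he.1, he.2⟩)
  have hr' : ∀ (S : Set β) x y, Reachable (G'.restrict (g '' S)) x y →
      Reachable (G.restrict S) (f.symm x) (f.symm y) := fun S x y h => h.map f.symm fun e u v he => by
    rw [Graph.restrict_isLink] at he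
    obtain ⟨⟨e, heS, rfl⟩, he⟩ := he
    exact .of_isLink (e := e) (by
      rw [Graph.restrict_isLink, hL]; exact ⟨heS, by simpa using he⟩)
  refine ⟨?_, ⟨?_, ?_⟩, ?_⟩
  · rintro _ ⟨e, he, rfl⟩
    obtain ⟨x, y, hxy⟩ := Graph.exists_isLink_of_mem_edgeSet (hT.subset he)
    exact ((hL e x y).1 hxy).edge_mem
  · obtain ⟨x, hx⟩ := hT.connected.1
    exact ⟨f x, (hV x).1 hx⟩
  · intro x hx y hy
    have := hr T _ _ (hT.connected.2 (f.symm x) ((hV _).2 (by simpa using hx)) (f.symm y)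
      ((hV _).2 (by simpa using hy)))
    simpa using this
  · rintro _ ⟨e, he, rfl⟩ x y hxy h
    refine hT.acyclic e he (f.symm x) (f.symm y) ((hL _ _ _).2 (by simpa using hxy)) (hr' _ _ _ ?_)
    rwa [Set.image_sdiff g.injective, Set.image_singleton]

lemma numSpanningTrees_congr {α' β' : Type*} {G' : Graph α' β'} (f : α ≃ α') (g : β ≃ β')
    (hV : ∀ x, x ∈ G.vertexSet ↔ f x ∈ G'.vertexSet)
    (hL : ∀ e x y, G.IsLink e x y ↔ G'.IsLink (g e) (f x) (f y)) :
    numSpanningTrees G = numSpanningTrees G' := by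
  unfold numSpanningTrees
  rw [← Set.ncard_image_of_injective {T | IsSpanningTree G T} g.injective.image_injective]
  congr 1
  ext T
  constructor
  · rintro ⟨T, hT, rfl⟩
    exact hT.image f g hV hL
  · intro hT
    exact ⟨g.symm '' T, hT.image f.symm g.symm (fun x => by simp [hV]) (fun e x y => by simp [hL]),
      by simp [Set.image_image]⟩

end Trees

/-! ### Cycle lengths of permutations. -/

section Cycles

open Function

variable {A B : Type*} {σ : Equiv.Perm A} {τ : Equiv.Perm B}

lemma mk_eq_mk_iff_sameCycle {x y : A} :
    Quotient.mk (Equiv.Perm.SameCycle.setoid σ) x = Quotient.mk (Equiv.Perm.SameCycle.setoid σ) y ↔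
      σ.SameCycle x y :=
  ⟨fun h => Quotient.exact (s := Equiv.Perm.SameCycle.setoid σ) h,
    fun h => Quotient.sound (s := Equiv.Perm.SameCycle.setoid σ) h⟩

/-- Invariance under the inverse is a separate hypothesis because cycles may be infinite. -/
lemma _root_.Equiv.Perm.SameCycle.of_invariant {p : A → Prop} (h : ∀ x, p x → p (σ x))
    (h' : ∀ x, p x → p (σ.symm x)) {x y : A} (hxy : σ.SameCycle x y) (hx : p x) : p y := by
  obtain ⟨n, rfl⟩ := hxy
  induction n with
  | zero => exact hx
  | succ i ih =>
    rw [add_comm, zpow_add, zpow_one]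
    exact h _ ih
  | pred i ih =>
    rw [sub_eq_add_neg, add_comm, zpow_add, zpow_neg_one]
    exact h' _ ih

/-- For an infinite cycle the conventions agree: both sides are `0`. -/
lemma card_sameCycle (σ : Equiv.Perm A) (x : A) :
    Nat.card {y // σ.SameCycle x y} = minimalPeriod σ x := by
  have h := Nat.card_congr (MulAction.orbitZPowersEquiv σ x)
  rw [Nat.card_zmod] at h
  refine Eq.trans (Nat.card_congr (Equiv.subtypeEquivRight fun y => ?_)) h
  rw [MulAction.mem_orbit_iff]
  constructor
  · rintro ⟨n, rfl⟩
    exact ⟨⟨σ ^ n, n, rfl⟩, rfl⟩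
  · rintro ⟨⟨_, n, rfl⟩, rfl⟩
    exact ⟨n, rfl⟩

lemma card_mk_eq (σ : Equiv.Perm A) (x : A) :
    Nat.card {y // Quotient.mk (Equiv.Perm.SameCycle.setoid σ) y =
      Quotient.mk (Equiv.Perm.SameCycle.setoid σ) x} = minimalPeriod σ x := by
  rw [← card_sameCycle]
  exact Nat.card_congr (Equiv.subtypeEquivRight fun y => by
    rw [mk_eq_mk_iff_sameCycle, Equiv.Perm.sameCycle_comm])

lemma finite_mk_eq_iff (σ : Equiv.Perm A) (x : A) :
    {y | Quotient.mk (Equiv.Perm.SameCycle.setoid σ) y =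
      Quotient.mk (Equiv.Perm.SameCycle.setoid σ) x}.Finite ↔ 0 < minimalPeriod σ x := by
  rw [← card_mk_eq]
  have : Nonempty {y // Quotient.mk (Equiv.Perm.SameCycle.setoid σ) y =
      Quotient.mk (Equiv.Perm.SameCycle.setoid σ) x} := ⟨⟨x, rfl⟩⟩
  rw [Nat.card_pos_iff]
  exact ⟨fun h => ⟨this, h⟩, fun h => h.2⟩

lemma minimalPeriod_of_semiconj {φ : A → B} (hφ : Injective φ) {f : A → A} {g : B → B}
    (h : Semiconj φ f g) (x : A) : minimalPeriod g (φ x) = minimalPeriod f x := by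
  rw [minimalPeriod_eq_minimalPeriod_iff]
  intro n
  rw [IsPeriodicPt, IsFixedPt, ← (h.iterate_right n).eq, hφ.eq_iff]
  rfl

/-- A sum over the cycles of a permutation of a function of their lengths. -/
lemma finsum_cycles [Fintype A] (σ : Equiv.Perm A) (g : ℕ → ℝ) :
    ∑ᶠ c : Quotient (Equiv.Perm.SameCycle.setoid σ),
      g (Nat.card {x // Quotient.mk (Equiv.Perm.SameCycle.setoid σ) x = c}) =
    ∑ x, g (minimalPeriod σ x) / minimalPeriod σ x := by
  classical
  have : Fintype (Quotient (Equiv.Perm.SameCycle.setoid σ)) := Fintype.ofFinite _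
  rw [finsum_eq_sum_of_fintype,
    ← Finset.sum_fiberwise (s := Finset.univ) (g := Quotient.mk (Equiv.Perm.SameCycle.setoid σ))]
  refine Finset.sum_congr rfl fun c _ => ?_
  induction c using Quotient.inductionOn with
  | h a =>
    rw [Finset.sum_congr rfl (g := fun _ => g (minimalPeriod σ a) / minimalPeriod σ a),
      Finset.sum_const, card_mk_eq, nsmul_eq_mul]
    · have h1 := card_mk_eq σ a
      rw [Nat.card_eq_fintype_card, Fintype.card_subtype] at h1
      have h2 : 0 < minimalPeriod σ a := by
        rw [← finite_mk_eq_iff]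
        exact Set.toFinite _
      rw [h1]
      field_simp
    · intro x hx
      have h1 : Quotient.mk (Equiv.Perm.SameCycle.setoid σ) x =
        Quotient.mk (Equiv.Perm.SameCycle.setoid σ) a := (Finset.mem_filter.1 hx).2
      rw [← card_mk_eq σ x, h1, card_mk_eq]

/-- Spreading weight 1 evenly over each cycle turns the cycle counts of several permutations into
sums over one set. -/
lemma card_cycles [Fintype A] (σ : Equiv.Perm A) :
    (Nat.card (Quotient (Equiv.Perm.SameCycle.setoid σ)) : ℝ) =
      ∑ x, 1 / (minimalPeriod σ x : ℝ) := by
  have : Fintype (Quotient (Equiv.Perm.SameCycle.setoid σ)) := Fintype.ofFinite _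
  rw [← finsum_cycles σ fun _ => 1, finsum_eq_sum_of_fintype]
  simp

end Cycles

/-! ### Vertices, edges and faces counted by darts. -/

namespace EmbeddedGraph

open Function

variable (G : EmbeddedGraph.{u})

lemma faceNext_apply (d : G.Dart) : G.faceNext d = G.next.symm (G.rev d) := rfl

lemma rev_symm : G.rev.symm = G.rev := by
  ext d
  rw [Equiv.symm_apply_eq, G.rev_rev]

lemma vertexDegree_vertexOf (d : G.Dart) : G.vertexDegree (G.vertexOf d) = minimalPeriod G.next d :=
  card_mk_eq G.next d

lemma vertexOf_eq_iff {d d' : G.Dart} : G.vertexOf d = G.vertexOf d' ↔ G.next.SameCycle d d' :=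
  mk_eq_mk_iff_sameCycle

lemma vertexOf_next (d : G.Dart) : G.vertexOf (G.next d) = G.vertexOf d :=
  G.vertexOf_eq_iff.2 (Equiv.Perm.sameCycle_apply_left.2 (Equiv.Perm.SameCycle.refl _ _))

lemma vertexOf_next_symm (d : G.Dart) : G.vertexOf (G.next.symm d) = G.vertexOf d := by
  rw [← G.vertexOf_next, Equiv.apply_symm_apply]

lemma exists_vertexOf (v : G.Vertex) : ∃ d, G.vertexOf d = v := Quotient.exists_rep v

lemma exists_edgeOf (e : G.Edge) : ∃ d, G.edgeOf d = e := Quotient.exists_rep e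

lemma exists_faceOf (f : G.Face) : ∃ d, G.faceOf d = f := Quotient.exists_rep f

lemma edgeOf_eq_iff {d d' : G.Dart} : G.edgeOf d = G.edgeOf d' ↔ d' = d ∨ d' = G.rev d := by
  refine Iff.trans (mk_eq_mk_iff_sameCycle (σ := G.rev)) ?_
  constructor
  · intro h
    refine h.of_invariant (p := fun x => x = d ∨ x = G.rev d) ?_ ?_ (Or.inl rfl)
    · rintro _ (rfl | rfl)
      · exact Or.inr rfl
      · exact Or.inl (G.rev_rev _)
    · rw [G.rev_symm]
      rintro _ (rfl | rfl)
      · exact Or.inr rfl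
      · exact Or.inl (G.rev_rev _)
  · rintro (rfl | rfl)
    · exact Equiv.Perm.SameCycle.refl _ _
    · exact Equiv.Perm.sameCycle_apply_right.2 (Equiv.Perm.SameCycle.refl _ _)

lemma edgeOf_rev (d : G.Dart) : G.edgeOf (G.rev d) = G.edgeOf d :=
  (G.edgeOf_eq_iff.2 (Or.inr rfl)).symm

lemma toGraph_isLink (d : G.Dart) :
    G.toGraph.IsLink (G.edgeOf d) (G.vertexOf d) (G.vertexOf (G.rev d)) := ⟨d, rfl, rfl, rfl⟩

lemma minimalPeriod_rev (d : G.Dart) : minimalPeriod G.rev d = 2 := by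
  have h : IsPeriodicPt G.rev 2 d := G.rev_rev d
  have h1 : minimalPeriod G.rev d ≠ 1 := fun h => G.rev_ne d (minimalPeriod_eq_one_iff_isFixedPt.1 h)
  exact ((Nat.dvd_prime Nat.prime_two).1 h.minimalPeriod_dvd).resolve_left h1

/-- The face permutation of the dual is `next` conjugated by `rev`: the faces of the dual are the
vertices of `G`. -/
lemma minimalPeriod_dual_faceNext (d : G.Dart) :
    minimalPeriod G.dual.faceNext (G.rev d) = minimalPeriod G.next d := by
  refine minimalPeriod_of_semiconj (φ := G.rev) G.rev.injective (fun x => ?_) d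
  change _ = (G.rev.trans G.next.symm).symm (G.rev (G.rev x))
  rw [G.rev_rev, Equiv.symm_trans_apply, Equiv.symm_symm, G.rev_symm]

lemma bipyramidVolume_eq_sum [Fintype G.Dart] : G.bipyramidVolume =
    ∑ d, bipyramidVol (minimalPeriod G.faceNext d) / minimalPeriod G.faceNext d :=
  finsum_cycles G.faceNext bipyramidVol

lemma bipyramidVolume_dual_eq_sum [Fintype G.Dart] : G.dual.bipyramidVolume =
    ∑ d, bipyramidVol (minimalPeriod G.next d) / minimalPeriod G.next d := by
  let _ : Fintype G.dual.Dart := ‹Fintype G.Dart›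
  rw [bipyramidVolume_eq_sum]
  refine (Fintype.sum_equiv G.rev _ _ fun d => ?_).symm
  exact (congrArg (fun n : ℕ => bipyramidVol n / n) (G.minimalPeriod_dual_faceNext d)).symm

lemma card_vertex_eq_sum [Fintype G.Dart] :
    (Nat.card G.Vertex : ℝ) = ∑ d, 1 / (minimalPeriod G.next d : ℝ) := card_cycles G.next

lemma card_face_eq_sum [Fintype G.Dart] :
    (Nat.card G.Face : ℝ) = ∑ d, 1 / (minimalPeriod G.faceNext d : ℝ) := card_cycles G.faceNext

lemma card_edge_eq [Fintype G.Dart] : (Nat.card G.Edge : ℝ) = Fintype.card G.Dart / 2 := by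
  refine (card_cycles G.rev).trans ?_
  simp [minimalPeriod_rev, div_eq_mul_inv]

/-- Connectedness as transitivity of `next` and `rev` on darts, a form that passes easily to the
quotient, the dual and the medial graph. -/
lemma isConnected_toGraph_iff : IsConnected G.toGraph ↔ Nonempty G.Dart ∧
    ∀ p : G.Dart → Prop, (∀ d, p d → p (G.next d)) → (∀ d, p d → p (G.next.symm d)) →
      (∀ d, p d → p (G.rev d)) → ∀ d d', p d → p d' := by
  constructor
  · rintro ⟨⟨v, -⟩, hc⟩
    refine ⟨⟨(G.exists_vertexOf v).choose⟩, fun p h1 h2 h3 d d' hd => ?_⟩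
    have hp : ∀ {x y}, G.vertexOf x = G.vertexOf y → p x → p y := fun h =>
      (G.vertexOf_eq_iff.1 h).of_invariant h1 h2
    obtain ⟨x, hx, hpx⟩ := (hc (G.vertexOf d) trivial (G.vertexOf d') trivial).of_invariant
      (p := fun v => ∃ x, G.vertexOf x = v ∧ p x) (by
        rintro e _ _ ⟨y, rfl, rfl, rfl⟩ ⟨x, hx, hpx⟩
        exact ⟨G.rev y, rfl, h3 _ (hp hx hpx)⟩) ⟨d, rfl, hd⟩
    exact hp hx hpx
  · rintro ⟨⟨d⟩, h⟩
    refine ⟨⟨G.vertexOf d, trivial⟩, fun x _ y _ => ?_⟩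
    obtain ⟨x, rfl⟩ := G.exists_vertexOf x
    obtain ⟨y, rfl⟩ := G.exists_vertexOf y
    refine h (fun z => Reachable G.toGraph (G.vertexOf x) (G.vertexOf z)) ?_ ?_ ?_ x y .refl
    · intro z hz
      rwa [G.vertexOf_next]
    · intro z hz
      rwa [G.vertexOf_next_symm]
    · exact fun z hz => hz.trans (.of_isLink (G.toGraph_isLink z))

end EmbeddedGraph

/-! ### The quotient by the lattice, and the medial graph. -/

namespace PeriodicGraph

open Function

variable (𝒢 : PeriodicGraph.{u})

lemma shift_neg_shift (a : ℤ × ℤ) (d : 𝒢.Dart) : 𝒢.shift (-a) (𝒢.shift a d) = d := by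
  rw [← 𝒢.shift_add, neg_add_cancel, 𝒢.shift_zero]

lemma shift_shift_neg (a : ℤ × ℤ) (d : 𝒢.Dart) : 𝒢.shift a (𝒢.shift (-a) d) = d := by
  rw [← 𝒢.shift_add, add_neg_cancel, 𝒢.shift_zero]

lemma shift_injective (a : ℤ × ℤ) : Injective (𝒢.shift a) := fun d d' h => by
  rw [← 𝒢.shift_neg_shift a d, h, 𝒢.shift_neg_shift]

lemma shift_next_symm (a : ℤ × ℤ) (d : 𝒢.Dart) :
    𝒢.shift a (𝒢.next.symm d) = 𝒢.next.symm (𝒢.shift a d) := by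
  rw [Equiv.eq_symm_apply, ← 𝒢.shift_next, Equiv.apply_symm_apply]

lemma shift_faceNext (a : ℤ × ℤ) (d : 𝒢.Dart) :
    𝒢.shift a (𝒢.faceNext d) = 𝒢.faceNext (𝒢.shift a d) := by
  rw [𝒢.faceNext_apply, 𝒢.faceNext_apply, shift_next_symm, 𝒢.shift_rev]

/-- The image of a dart in the quotient by the lattice. -/
def proj (d : 𝒢.Dart) : 𝒢.quotient.Dart := Quotient.mk 𝒢.orbitSetoid d

lemma proj_eq_iff {d d' : 𝒢.Dart} : 𝒢.proj d = 𝒢.proj d' ↔ ∃ a, 𝒢.shift a d = d' :=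
  ⟨fun h => Quotient.exact (s := 𝒢.orbitSetoid) h, fun h => Quotient.sound (s := 𝒢.orbitSetoid) h⟩

lemma proj_shift (a : ℤ × ℤ) (d : 𝒢.Dart) : 𝒢.proj (𝒢.shift a d) = 𝒢.proj d :=
  (𝒢.proj_eq_iff.2 ⟨a, rfl⟩).symm

lemma exists_proj (x : 𝒢.quotient.Dart) : ∃ d, 𝒢.proj d = x := Quotient.exists_rep x

lemma proj_next (d : 𝒢.Dart) : 𝒢.proj (𝒢.next d) = 𝒢.quotient.next (𝒢.proj d) := rfl

lemma proj_rev (d : 𝒢.Dart) : 𝒢.proj (𝒢.rev d) = 𝒢.quotient.rev (𝒢.proj d) := rfl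

lemma proj_next_symm (d : 𝒢.Dart) : 𝒢.proj (𝒢.next.symm d) = 𝒢.quotient.next.symm (𝒢.proj d) := by
  rw [Equiv.eq_symm_apply, ← proj_next, Equiv.apply_symm_apply]

lemma proj_faceNext (d : 𝒢.Dart) : 𝒢.proj (𝒢.faceNext d) = 𝒢.quotient.faceNext (𝒢.proj d) := by
  rw [EmbeddedGraph.faceNext_apply, EmbeddedGraph.faceNext_apply, proj_next_symm, proj_rev]

/-- If `n` steps close up in the quotient, then upstairs they amount to a translation by some `a`.
Repeating them as often as the finite period upstairs shows that a positive multiple of `a` fixes a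
dart, so `a = 0`. -/
lemma minimalPeriod_proj {f : 𝒢.Dart → 𝒢.Dart} {g : 𝒢.quotient.Dart → 𝒢.quotient.Dart}
    (hf : ∀ a d, 𝒢.shift a (f d) = f (𝒢.shift a d)) (hfg : Semiconj 𝒢.proj f g) {d : 𝒢.Dart}
    (hd : 0 < minimalPeriod f d) : minimalPeriod g (𝒢.proj d) = minimalPeriod f d := by
  rw [minimalPeriod_eq_minimalPeriod_iff]
  intro n
  refine ⟨fun h => ?_, fun h => h.map hfg⟩
  rw [IsPeriodicPt, IsFixedPt, ← (hfg.iterate_right n).eq, eq_comm, 𝒢.proj_eq_iff] at h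
  obtain ⟨a, ha⟩ := h
  have hk : ∀ k : ℕ, 𝒢.shift (k • a) d = f^[n * k] d := by
    intro k
    induction k with
    | zero => simp [𝒢.shift_zero]
    | succ k ih =>
      have hc : Semiconj (𝒢.shift a) f f := hf a
      rw [succ_nsmul', 𝒢.shift_add, ih, (hc.iterate_right _).eq, ha, ← iterate_add_apply]
      congr 1
  have h0 := 𝒢.shift_free _ d ((hk (minimalPeriod f d)).trans
    ((isPeriodicPt_minimalPeriod f d).const_mul n))
  have ha0 : a = 0 := (smul_eq_zero.1 h0).resolve_left hd.ne'
  rw [ha0, 𝒢.shift_zero] at ha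
  exact ha.symm

lemma minimalPeriod_quotient_next {d : 𝒢.Dart} (hd : 0 < minimalPeriod 𝒢.next d) :
    minimalPeriod 𝒢.quotient.next (𝒢.proj d) = minimalPeriod 𝒢.next d :=
  𝒢.minimalPeriod_proj 𝒢.shift_next 𝒢.proj_next hd

variable {𝒢}

lemma IsPlanarLatticeGraph.minimalPeriod_next_pos (h : 𝒢.IsPlanarLatticeGraph) (d : 𝒢.Dart) :
    0 < minimalPeriod 𝒢.next d :=
  (finite_mk_eq_iff 𝒢.next d).1 (h.locallyFinite (𝒢.vertexOf d))

lemma IsPlanarLatticeGraph.minimalPeriod_faceNext_pos (h : 𝒢.IsPlanarLatticeGraph) (d : 𝒢.Dart) :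
    0 < minimalPeriod 𝒢.faceNext d :=
  (finite_mk_eq_iff 𝒢.faceNext d).1 (h.faceFinite (𝒢.faceOf d))

variable (𝒢)

/-- The dart of the medial graph which starts at the midpoint of `d`, on the left of `d` if `b` and
on the right of `d` otherwise. -/
def mdart (d : 𝒢.Dart) (b : Bool) : 𝒢.medial.Dart := (d, b)

variable {𝒢} in
lemma mdart_inj {d d' : 𝒢.Dart} {b b' : Bool} : 𝒢.mdart d b = 𝒢.mdart d' b' ↔ d = d' ∧ b = b' :=
  Prod.mk_inj

lemma mdart_left_injective (b : Bool) : Injective fun d => 𝒢.mdart d b := fun _ _ h =>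
  (mdart_inj.1 h).1

lemma exists_mdart (x : 𝒢.medial.Dart) : ∃ d b, x = 𝒢.mdart d b := ⟨x.1, x.2, rfl⟩

@[simp] lemma medial_next_true (d : 𝒢.Dart) :
    𝒢.medial.next (𝒢.mdart d true) = 𝒢.mdart d false := rfl
@[simp] lemma medial_next_false (d : 𝒢.Dart) :
    𝒢.medial.next (𝒢.mdart d false) = 𝒢.mdart (𝒢.rev d) true := rfl
@[simp] lemma medial_next_symm_false (d : 𝒢.Dart) :
    𝒢.medial.next.symm (𝒢.mdart d false) = 𝒢.mdart d true := rfl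
@[simp] lemma medial_next_symm_true (d : 𝒢.Dart) :
    𝒢.medial.next.symm (𝒢.mdart d true) = 𝒢.mdart (𝒢.rev d) false := rfl
@[simp] lemma medial_rev_true (d : 𝒢.Dart) :
    𝒢.medial.rev (𝒢.mdart d true) = 𝒢.mdart (𝒢.next d) false := rfl
@[simp] lemma medial_shift (a : ℤ × ℤ) (d : 𝒢.Dart) (b : Bool) :
    𝒢.medial.shift a (𝒢.mdart d b) = 𝒢.mdart (𝒢.shift a d) b := rfl

lemma medial_next_next (d : 𝒢.Dart) (b : Bool) :
    𝒢.medial.next (𝒢.medial.next (𝒢.mdart d b)) = 𝒢.mdart (𝒢.rev d) b := by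
  cases b <;> rfl

lemma medial_faceNext_true (d : 𝒢.Dart) :
    𝒢.medial.faceNext (𝒢.mdart d true) = 𝒢.mdart (𝒢.next d) true := rfl

lemma medial_faceNext_false (d : 𝒢.Dart) :
    𝒢.medial.faceNext (𝒢.mdart (𝒢.rev d) false) = 𝒢.mdart (𝒢.rev (𝒢.faceNext d)) false := rfl

/-- Two steps reverse the underlying dart, so the period divides 4 but not 2. -/
lemma minimalPeriod_medial_next (x : 𝒢.medial.Dart) : minimalPeriod 𝒢.medial.next x = 4 := by
  obtain ⟨d, b, rfl⟩ := 𝒢.exists_mdart x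
  have h4 : IsPeriodicPt 𝒢.medial.next (2 ^ (1 + 1)) (𝒢.mdart d b) := by
    change 𝒢.medial.next (𝒢.medial.next (𝒢.medial.next (𝒢.medial.next (𝒢.mdart d b)))) = 𝒢.mdart d b
    rw [medial_next_next, medial_next_next, 𝒢.rev_rev]
  have h2 : ¬ IsPeriodicPt 𝒢.medial.next (2 ^ 1) (𝒢.mdart d b) := by
    change ¬ 𝒢.medial.next (𝒢.medial.next (𝒢.mdart d b)) = 𝒢.mdart d b
    rw [medial_next_next]
    exact fun h => 𝒢.rev_ne d (mdart_inj.1 h).1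
  exact minimalPeriod_eq_prime_pow h2 h4

/-- The darts of the quotient of the medial graph are the images of the `𝒢.mdart d b`. -/
def medialDart (b : Bool) : 𝒢.quotient.Dart → 𝒢.medial.quotient.Dart :=
  Quotient.map' (s₁ := 𝒢.orbitSetoid) (s₂ := 𝒢.medial.orbitSetoid) (fun d => 𝒢.mdart d b) (by
    rintro d _ ⟨a, rfl⟩
    exact ⟨a, rfl⟩)

lemma medialDart_proj (b : Bool) (d : 𝒢.Dart) :
    𝒢.medialDart b (𝒢.proj d) = 𝒢.medial.proj (𝒢.mdart d b) := rfl

lemma bijective_medialDart :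
    Bijective fun x : 𝒢.quotient.Dart × Bool => 𝒢.medialDart x.2 x.1 := by
  constructor
  · rintro ⟨x, b⟩ ⟨y, c⟩ h
    obtain ⟨d, rfl⟩ := 𝒢.exists_proj x
    obtain ⟨d', rfl⟩ := 𝒢.exists_proj y
    change 𝒢.medialDart b (𝒢.proj d) = 𝒢.medialDart c (𝒢.proj d') at h
    rw [medialDart_proj, medialDart_proj, proj_eq_iff] at h
    obtain ⟨a, ha⟩ := h
    rw [medial_shift, mdart_inj] at ha
    rw [← ha.1, ← ha.2, proj_shift]
  · intro y
    obtain ⟨x, rfl⟩ := 𝒢.medial.exists_proj y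
    obtain ⟨d, b, rfl⟩ := 𝒢.exists_mdart x
    exact ⟨(𝒢.proj d, b), rfl⟩

lemma injective_medialDart (b : Bool) : Injective (𝒢.medialDart b) := fun x y h =>
  congrArg Prod.fst (𝒢.bijective_medialDart.1 (a₁ := (x, b)) (a₂ := (y, b)) h)

/-- The `false` darts are reindexed by `rev` because the right side of `rev x` is the left side of
`x`, where the face of `x` lies. -/
lemma sum_medialDart [Fintype 𝒢.quotient.Dart] [Fintype 𝒢.medial.quotient.Dart]
    (f : 𝒢.medial.quotient.Dart → ℝ) :
    ∑ x, f x = ∑ x, (f (𝒢.medialDart true x) + f (𝒢.medialDart false (𝒢.quotient.rev x))) := by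
  rw [← Equiv.sum_comp (Equiv.ofBijective _ 𝒢.bijective_medialDart), Fintype.sum_prod_type,
    Finset.sum_congr rfl (fun x _ => Fintype.sum_bool _), Finset.sum_add_distrib,
    Finset.sum_add_distrib, Equiv.sum_comp 𝒢.quotient.rev fun x => f (𝒢.medialDart false x)]
  rfl

/-- These medial faces surround the vertices of `𝒢`. -/
lemma minimalPeriod_medial_faceNext_true (x : 𝒢.quotient.Dart) :
    minimalPeriod 𝒢.medial.quotient.faceNext (𝒢.medialDart true x) =
      minimalPeriod 𝒢.quotient.next x := by
  refine minimalPeriod_of_semiconj (𝒢.injective_medialDart true) (fun x => ?_) x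
  obtain ⟨d, rfl⟩ := 𝒢.exists_proj x
  rw [medialDart_proj, ← proj_faceNext, medial_faceNext_true, ← medialDart_proj, proj_next]

/-- These medial faces lie inside the faces of `𝒢`. -/
lemma minimalPeriod_medial_faceNext_false (x : 𝒢.quotient.Dart) :
    minimalPeriod 𝒢.medial.quotient.faceNext (𝒢.medialDart false (𝒢.quotient.rev x)) =
      minimalPeriod 𝒢.quotient.faceNext x := by
  refine minimalPeriod_of_semiconj (φ := fun x => 𝒢.medialDart false (𝒢.quotient.rev x))
    ((𝒢.injective_medialDart false).comp 𝒢.quotient.rev.injective) (fun x => ?_) x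
  obtain ⟨d, rfl⟩ := 𝒢.exists_proj x
  change 𝒢.medialDart false (𝒢.quotient.rev (𝒢.quotient.faceNext (𝒢.proj d))) =
    𝒢.medial.quotient.faceNext (𝒢.medialDart false (𝒢.quotient.rev (𝒢.proj d)))
  rw [← proj_faceNext, ← proj_rev, ← proj_rev, medialDart_proj, medialDart_proj, ← proj_faceNext,
    medial_faceNext_false]

lemma minimalPeriod_medial_quotient_next (x : 𝒢.medial.quotient.Dart) :
    minimalPeriod 𝒢.medial.quotient.next x = 4 := by
  obtain ⟨d, rfl⟩ := 𝒢.medial.exists_proj x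
  rw [minimalPeriod_quotient_next _ (by rw [minimalPeriod_medial_next]; norm_num),
    minimalPeriod_medial_next]

lemma isRegular_medial : 𝒢.medial.IsRegular 4 := by
  intro v
  obtain ⟨d, rfl⟩ := 𝒢.medial.exists_vertexOf v
  rw [EmbeddedGraph.vertexDegree_vertexOf, minimalPeriod_medial_next]

lemma finite_medial_quotient (h : Finite 𝒢.quotient.Dart) : Finite 𝒢.medial.quotient.Dart :=
  Finite.of_surjective _ 𝒢.bijective_medialDart.2

lemma card_medial_quotient [Fintype 𝒢.quotient.Dart] [Fintype 𝒢.medial.quotient.Dart] :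
    Fintype.card 𝒢.medial.quotient.Dart = 2 * Fintype.card 𝒢.quotient.Dart := by
  rw [← Fintype.card_congr (Equiv.ofBijective _ 𝒢.bijective_medialDart), Fintype.card_prod,
    Fintype.card_bool, mul_comm]

lemma isPlanarLatticeGraph_medial (h : 𝒢.IsPlanarLatticeGraph) :
    𝒢.medial.IsPlanarLatticeGraph where
  connected := by
    obtain ⟨⟨d⟩, hc⟩ := 𝒢.isConnected_toGraph_iff.1 h.connected
    refine 𝒢.medial.isConnected_toGraph_iff.2 ⟨⟨𝒢.mdart d true⟩, fun p h1 h2 h3 => ?_⟩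
    have key : ∀ d b, p (𝒢.mdart d b) ↔ p (𝒢.mdart d true) := by
      rintro d (_ | _)
      · exact ⟨h2 _, h1 _⟩
      · rfl
    intro x y hd
    obtain ⟨d, b, rfl⟩ := 𝒢.exists_mdart x
    obtain ⟨d', b', rfl⟩ := 𝒢.exists_mdart y
    rw [key] at hd ⊢
    exact hc (fun d => p (𝒢.mdart d true)) (fun d hd => (key _ false).1 (h3 _ hd))
      (fun d hd => h3 _ (h1 _ hd)) (fun d hd => h1 _ (h1 _ hd)) d d' hd
  locallyFinite := by
    intro v
    obtain ⟨d, rfl⟩ := 𝒢.medial.exists_vertexOf v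
    exact (finite_mk_eq_iff _ _).2 (by rw [minimalPeriod_medial_next]; norm_num)
  faceFinite := by
    intro f
    obtain ⟨x, rfl⟩ := 𝒢.medial.exists_faceOf f
    obtain ⟨d, b, rfl⟩ := 𝒢.exists_mdart x
    refine (finite_mk_eq_iff _ _).2 ?_
    cases b with
    | true =>
      rw [minimalPeriod_of_semiconj (φ := fun d => 𝒢.mdart d true) (f := 𝒢.next)
        (𝒢.mdart_left_injective true) fun d => (𝒢.medial_faceNext_true d).symm]
      exact h.minimalPeriod_next_pos d
    | false =>
      rw [← 𝒢.rev_rev d, minimalPeriod_of_semiconj (φ := fun d => 𝒢.mdart (𝒢.rev d) false)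
        (f := 𝒢.faceNext) ((𝒢.mdart_left_injective false).comp 𝒢.rev.injective)
        fun d => (𝒢.medial_faceNext_false d).symm]
      exact h.minimalPeriod_faceNext_pos _
  quotientFinite := 𝒢.finite_medial_quotient h.quotientFinite
  torus := by
    have := h.quotientFinite
    have := 𝒢.finite_medial_quotient h.quotientFinite
    have : Fintype 𝒢.quotient.Dart := Fintype.ofFinite _
    have : Fintype 𝒢.medial.quotient.Dart := Fintype.ofFinite _
    -- With `D` darts below, the medial quotient has `D/2` vertices, `D` edges and `V + F` faces, so
    -- its Euler characteristic is `D/2 - D + V + F = V - E + F`.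
    have ht := h.torus
    unfold EmbeddedGraph.eulerChar at ht ⊢
    rify at ht ⊢
    rw [EmbeddedGraph.card_edge_eq, EmbeddedGraph.card_vertex_eq_sum,
      EmbeddedGraph.card_face_eq_sum] at ht ⊢
    rw [𝒢.sum_medialDart, 𝒢.sum_medialDart, card_medial_quotient, Finset.sum_add_distrib,
      Finset.sum_add_distrib]
    simp only [minimalPeriod_medial_faceNext_true, minimalPeriod_medial_faceNext_false,
      minimalPeriod_medial_quotient_next, Finset.sum_const, Finset.card_univ, nsmul_eq_mul]
    push_cast
    linarith

lemma minimalPeriod_quotient_next_of_isRegular (h : 𝒢.IsPlanarLatticeGraph) {k : ℕ}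
    (hk : 𝒢.IsRegular k) (x : 𝒢.quotient.Dart) : minimalPeriod 𝒢.quotient.next x = k := by
  obtain ⟨d, rfl⟩ := 𝒢.exists_proj x
  rw [𝒢.minimalPeriod_quotient_next (h.minimalPeriod_next_pos d), ← 𝒢.vertexDegree_vertexOf, hk]

/-- The medial faces carry the volumes of both `G` and its dual, now divided by `D/2` vertices
instead of `D/3`; each medial vertex, of degree 4, adds one `bipyramidVol 4` through the medial
dual. -/
lemma bipyramidVolumePerVertex_medial (h : 𝒢.IsPlanarLatticeGraph) (h3 : 𝒢.IsRegular 3) :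
    𝒢.medial.bipyramidVolumePerVertex =
      2 / 3 * 𝒢.bipyramidVolumePerVertex + bipyramidVol 4 := by
  have := h.quotientFinite
  have := 𝒢.finite_medial_quotient h.quotientFinite
  have : Fintype 𝒢.quotient.Dart := Fintype.ofFinite _
  have : Fintype 𝒢.medial.quotient.Dart := Fintype.ofFinite _
  have hne : Nonempty 𝒢.quotient.Dart :=
    ⟨𝒢.proj (𝒢.isConnected_toGraph_iff.1 h.connected).1.some⟩
  have hpos : (0 : ℝ) < Fintype.card 𝒢.quotient.Dart := by
    exact_mod_cast Fintype.card_pos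
  have hm := minimalPeriod_quotient_next_of_isRegular 𝒢 h h3
  unfold bipyramidVolumePerVertex
  simp only [EmbeddedGraph.card_vertex_eq_sum, EmbeddedGraph.bipyramidVolume_dual_eq_sum,
    EmbeddedGraph.bipyramidVolume_eq_sum]
  simp only [𝒢.sum_medialDart, minimalPeriod_medial_faceNext_true, Finset.sum_add_distrib,
    minimalPeriod_medial_faceNext_false, minimalPeriod_medial_quotient_next, hm, Finset.sum_const,
    Finset.card_univ, nsmul_eq_mul]
  push_cast
  field_simp
  ring

end PeriodicGraph

/-! ### The lattice action on boxes, and the entropy as a limit by packing. -/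

namespace PeriodicGraph

open Function

variable (𝒢 : PeriodicGraph.{u})

lemma shiftVertex_vertexOf (a : ℤ × ℤ) (d : 𝒢.Dart) :
    𝒢.shiftVertex a (𝒢.vertexOf d) = 𝒢.vertexOf (𝒢.shift a d) := rfl

lemma shiftVertex_zero (v : 𝒢.Vertex) : 𝒢.shiftVertex 0 v = v := by
  obtain ⟨d, rfl⟩ := 𝒢.exists_vertexOf v
  rw [shiftVertex_vertexOf, 𝒢.shift_zero]

lemma shiftVertex_add (a b : ℤ × ℤ) (v : 𝒢.Vertex) :
    𝒢.shiftVertex (a + b) v = 𝒢.shiftVertex a (𝒢.shiftVertex b v) := by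
  obtain ⟨d, rfl⟩ := 𝒢.exists_vertexOf v
  rw [shiftVertex_vertexOf, shiftVertex_vertexOf, shiftVertex_vertexOf, 𝒢.shift_add]

/-- The action of `Λ` on the edges. -/
def shiftEdge (a : ℤ × ℤ) (e : 𝒢.Edge) : 𝒢.Edge :=
  Quotient.liftOn e (fun d => 𝒢.edgeOf (𝒢.shift a d)) fun d d' h => by
    rcases 𝒢.edgeOf_eq_iff.1 (Quotient.sound (s := Equiv.Perm.SameCycle.setoid 𝒢.rev) h) with
      rfl | rfl
    · rfl
    · rw [𝒢.shift_rev, 𝒢.edgeOf_rev]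

lemma shiftEdge_edgeOf (a : ℤ × ℤ) (d : 𝒢.Dart) :
    𝒢.shiftEdge a (𝒢.edgeOf d) = 𝒢.edgeOf (𝒢.shift a d) := rfl

def shiftVertexEquiv (a : ℤ × ℤ) : 𝒢.Vertex ≃ 𝒢.Vertex where
  toFun := 𝒢.shiftVertex a
  invFun := 𝒢.shiftVertex (-a)
  left_inv v := by rw [← shiftVertex_add, neg_add_cancel, shiftVertex_zero]
  right_inv v := by rw [← shiftVertex_add, add_neg_cancel, shiftVertex_zero]

def shiftEdgeEquiv (a : ℤ × ℤ) : 𝒢.Edge ≃ 𝒢.Edge where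
  toFun := 𝒢.shiftEdge a
  invFun := 𝒢.shiftEdge (-a)
  left_inv e := by
    obtain ⟨d, rfl⟩ := 𝒢.exists_edgeOf e
    rw [shiftEdge_edgeOf, shiftEdge_edgeOf, shift_neg_shift]
  right_inv e := by
    obtain ⟨d, rfl⟩ := 𝒢.exists_edgeOf e
    rw [shiftEdge_edgeOf, shiftEdge_edgeOf, shift_shift_neg]

variable {𝒢} in
lemma isLink_shift {e : 𝒢.Edge} {x y : 𝒢.Vertex} (a : ℤ × ℤ) (h : 𝒢.toGraph.IsLink e x y) :
    𝒢.toGraph.IsLink (𝒢.shiftEdge a e) (𝒢.shiftVertex a x) (𝒢.shiftVertex a y) := by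
  obtain ⟨d, rfl, rfl, rfl⟩ := h
  exact ⟨𝒢.shift a d, rfl, rfl, by rw [shiftVertex_vertexOf, 𝒢.shift_rev]⟩

lemma isLink_shift_iff {e : 𝒢.Edge} {x y : 𝒢.Vertex} (a : ℤ × ℤ) :
    𝒢.toGraph.IsLink e x y ↔
      𝒢.toGraph.IsLink (𝒢.shiftEdge a e) (𝒢.shiftVertex a x) (𝒢.shiftVertex a y) := by
  refine ⟨isLink_shift a, fun h => ?_⟩
  have h' := isLink_shift (-a) h
  rwa [← shiftVertex_add, ← shiftVertex_add, neg_add_cancel, shiftVertex_zero, shiftVertex_zero,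
    show 𝒢.shiftEdge (-a) (𝒢.shiftEdge a e) = e from (𝒢.shiftEdgeEquiv a).left_inv e] at h'

lemma numSpanningTrees_induce_shift (a : ℤ × ℤ) (S : Set 𝒢.Vertex) :
    numSpanningTrees (𝒢.toGraph.induce (𝒢.shiftVertex a '' S)) =
      numSpanningTrees (𝒢.toGraph.induce S) := by
  have hm : ∀ x, x ∈ S ↔ 𝒢.shiftVertex a x ∈ 𝒢.shiftVertex a '' S := fun x =>
    ((𝒢.shiftVertexEquiv a).injective.mem_set_image (s := S)).symm
  refine (numSpanningTrees_congr (𝒢.shiftVertexEquiv a) (𝒢.shiftEdgeEquiv a) hm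
    fun e x y => ?_).symm
  rw [Graph.induce_isLink, Graph.induce_isLink, 𝒢.isLink_shift_iff a, hm x, hm y]
  rfl

lemma finite_setOf_vertexOf_mem (h : 𝒢.IsPlanarLatticeGraph) {S : Set 𝒢.Vertex} (hS : S.Finite) :
    {d | 𝒢.vertexOf d ∈ S}.Finite := by
  refine (hS.biUnion fun v _ => h.locallyFinite v).subset fun d hd => ?_
  exact Set.mem_biUnion hd rfl

lemma edgeSet_induce_subset (S : Set 𝒢.Vertex) :
    (𝒢.toGraph.induce S).edgeSet ⊆ 𝒢.edgeOf '' {d | 𝒢.vertexOf d ∈ S} := by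
  rintro _ ⟨_, _, ⟨d, rfl, rfl, rfl⟩, hx, -⟩
  exact ⟨d, hx, rfl⟩

lemma finite_edgeSet_induce (h : 𝒢.IsPlanarLatticeGraph) {S : Set 𝒢.Vertex} (hS : S.Finite) :
    (𝒢.toGraph.induce S).edgeSet.Finite :=
  ((𝒢.finite_setOf_vertexOf_mem h hS).image _).subset (𝒢.edgeSet_induce_subset S)

/-- The image of a vertex in the quotient by the lattice. -/
def projVertex : 𝒢.Vertex → 𝒢.quotient.Vertex := fun v =>
  Quotient.liftOn v (fun d => 𝒢.quotient.vertexOf (𝒢.proj d)) fun d d' h =>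
    Equiv.Perm.SameCycle.of_invariant (σ := 𝒢.next)
      (p := fun x => 𝒢.quotient.vertexOf (𝒢.proj d) = 𝒢.quotient.vertexOf (𝒢.proj x))
      (fun x hx => by rw [hx, proj_next, EmbeddedGraph.vertexOf_next])
      (fun x hx => by rw [hx, proj_next_symm, EmbeddedGraph.vertexOf_next_symm]) h rfl

lemma projVertex_vertexOf (d : 𝒢.Dart) :
    𝒢.projVertex (𝒢.vertexOf d) = 𝒢.quotient.vertexOf (𝒢.proj d) := rfl

lemma exists_projVertex (x : 𝒢.quotient.Vertex) : ∃ v, 𝒢.projVertex v = x := by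
  obtain ⟨y, rfl⟩ := 𝒢.quotient.exists_vertexOf x
  obtain ⟨d, rfl⟩ := 𝒢.exists_proj y
  exact ⟨𝒢.vertexOf d, rfl⟩

lemma projVertex_shiftVertex (a : ℤ × ℤ) (v : 𝒢.Vertex) :
    𝒢.projVertex (𝒢.shiftVertex a v) = 𝒢.projVertex v := by
  obtain ⟨d, rfl⟩ := 𝒢.exists_vertexOf v
  rw [shiftVertex_vertexOf, projVertex_vertexOf, projVertex_vertexOf, proj_shift]

lemma projVertex_eq_iff {v w : 𝒢.Vertex} :
    𝒢.projVertex v = 𝒢.projVertex w ↔ ∃ a, 𝒢.shiftVertex a v = w := by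
  constructor
  · intro h
    obtain ⟨d, rfl⟩ := 𝒢.exists_vertexOf v
    obtain ⟨d', rfl⟩ := 𝒢.exists_vertexOf w
    rw [projVertex_vertexOf, projVertex_vertexOf, EmbeddedGraph.vertexOf_eq_iff] at h
    obtain ⟨x, a, hx, ha⟩ := h.of_invariant
      (p := fun y => ∃ x a, 𝒢.proj x = y ∧ 𝒢.shiftVertex a (𝒢.vertexOf d) = 𝒢.vertexOf x) (by
        rintro _ ⟨x, a, rfl, ha⟩
        exact ⟨𝒢.next x, a, 𝒢.proj_next x, by rw [ha, 𝒢.vertexOf_next]⟩) (by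
        rintro _ ⟨x, a, rfl, ha⟩
        exact ⟨𝒢.next.symm x, a, 𝒢.proj_next_symm x, by rw [ha, 𝒢.vertexOf_next_symm]⟩)
      ⟨d, 0, rfl, 𝒢.shiftVertex_zero _⟩
    obtain ⟨c, rfl⟩ := 𝒢.proj_eq_iff.1 hx
    exact ⟨c + a, by rw [shiftVertex_add, ha, shiftVertex_vertexOf]⟩
  · rintro ⟨a, rfl⟩
    rw [projVertex_shiftVertex]

variable {𝒢}

lemma repr_lattice (b : Module.Basis (Fin 2) ℤ (ℤ × ℤ)) (i j : ℤ) :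
    b.repr (i • b 0 + j • b 1) 0 = i ∧ b.repr (i • b 0 + j • b 1) 1 = j := by
  rw [map_add, map_smul, map_smul, b.repr_self, b.repr_self]
  constructor <;> simp

/-- A set of vertices that contains exactly one vertex of each orbit. -/
def IsFundamental (F : Set 𝒢.Vertex) : Prop := ∀ v, ∃! a, 𝒢.shiftVertex a v ∈ F

/-- The translation that carries the fundamental domain to the copy that contains `v`. -/
def IsFundamental.coord {F : Set 𝒢.Vertex} (hF : IsFundamental F) (v : 𝒢.Vertex) : ℤ × ℤ :=
  -(hF v).choose

namespace IsFundamental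

variable {F : Set 𝒢.Vertex} (hF : IsFundamental F)

include hF in
lemma eq_zero {a : ℤ × ℤ} {v : 𝒢.Vertex} (hv : v ∈ F) (ha : 𝒢.shiftVertex a v ∈ F) : a = 0 :=
  (hF v).unique ha (by rwa [shiftVertex_zero])

lemma shiftVertex_neg_coord_mem (v : 𝒢.Vertex) : 𝒢.shiftVertex (-hF.coord v) v ∈ F := by
  rw [coord, neg_neg]
  exact (hF v).choose_spec.1

lemma coord_eq {v : 𝒢.Vertex} {a : ℤ × ℤ} (h : 𝒢.shiftVertex (-a) v ∈ F) : hF.coord v = a :=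
  neg_injective ((hF v).unique (hF.shiftVertex_neg_coord_mem v) h)

lemma coord_shiftVertex (a : ℤ × ℤ) (v : 𝒢.Vertex) :
    hF.coord (𝒢.shiftVertex a v) = a + hF.coord v := by
  refine hF.coord_eq ?_
  rw [← shiftVertex_add, show -(a + hF.coord v) + a = -hF.coord v by abel]
  exact hF.shiftVertex_neg_coord_mem v

lemma coord_eq_zero {v : 𝒢.Vertex} (hv : v ∈ F) : hF.coord v = 0 :=
  hF.coord_eq (by rwa [neg_zero, shiftVertex_zero])

lemma eq_shiftVertex_coord (v : 𝒢.Vertex) :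
    v = 𝒢.shiftVertex (hF.coord v) (𝒢.shiftVertex (-hF.coord v) v) := by
  rw [← shiftVertex_add, add_neg_cancel, shiftVertex_zero]

include hF in
lemma bijOn_projVertex : Set.BijOn 𝒢.projVertex F Set.univ := by
  refine ⟨fun _ _ => trivial, fun v hv w hw h => ?_, fun x _ => ?_⟩
  · obtain ⟨a, rfl⟩ := 𝒢.projVertex_eq_iff.1 h
    rw [hF.eq_zero hv hw, shiftVertex_zero]
  · obtain ⟨v, rfl⟩ := 𝒢.exists_projVertex x
    exact ⟨_, hF.shiftVertex_neg_coord_mem v, 𝒢.projVertex_shiftVertex _ v⟩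

include hF in
lemma ncard_eq : F.ncard = Nat.card 𝒢.quotient.Vertex := by
  rw [← Set.ncard_univ, ← hF.bijOn_projVertex.image_eq,
    hF.bijOn_projVertex.injOn.ncard_image]

include hF in
lemma finite (h : 𝒢.IsPlanarLatticeGraph) : F.Finite := by
  have := h.quotientFinite
  have : Finite 𝒢.quotient.Vertex := Quotient.finite _
  exact Set.Finite.of_finite_image (Set.toFinite (𝒢.projVertex '' F)) hF.bijOn_projVertex.injOn

include hF in
lemma ncard_darts : {d | 𝒢.vertexOf d ∈ F}.ncard = Nat.card 𝒢.quotient.Dart := by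
  have hb : Set.BijOn 𝒢.proj {d | 𝒢.vertexOf d ∈ F} Set.univ := by
    refine ⟨fun _ _ => trivial, fun v hv w hw h => ?_, fun x _ => ?_⟩
    · obtain ⟨a, rfl⟩ := 𝒢.proj_eq_iff.1 h
      rw [hF.eq_zero hv hw, 𝒢.shift_zero]
    · obtain ⟨d, rfl⟩ := 𝒢.exists_proj x
      exact ⟨_, hF.shiftVertex_neg_coord_mem (𝒢.vertexOf d), 𝒢.proj_shift _ d⟩
  rw [← Set.ncard_univ, ← hb.image_eq, hb.injOn.ncard_image]

variable (b : Module.Basis (Fin 2) ℤ (ℤ × ℤ))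

lemma mem_boxVertices_iff {v : 𝒢.Vertex} {n : ℕ} : v ∈ 𝒢.boxVertices b F n ↔
    ∀ i, 0 ≤ b.repr (hF.coord v) i ∧ b.repr (hF.coord v) i < n := by
  constructor
  · rintro ⟨i, hi, j, hj, w, hw, rfl⟩ k
    rw [hF.coord_shiftVertex, hF.coord_eq_zero hw]
    rw [add_zero]
    have h1 := repr_lattice b i j
    fin_cases k
    · change 0 ≤ b.repr ((i : ℤ) • b 0 + (j : ℤ) • b 1) 0 ∧
        b.repr ((i : ℤ) • b 0 + (j : ℤ) • b 1) 0 < n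
      rw [h1.1]
      omega
    · change 0 ≤ b.repr ((i : ℤ) • b 0 + (j : ℤ) • b 1) 1 ∧
        b.repr ((i : ℤ) • b 0 + (j : ℤ) • b 1) 1 < n
      rw [h1.2]
      omega
  · intro h
    obtain ⟨i, hi⟩ := Int.eq_ofNat_of_zero_le (h 0).1
    obtain ⟨j, hj⟩ := Int.eq_ofNat_of_zero_le (h 1).1
    refine ⟨i, ?_, j, ?_, _, hF.shiftVertex_neg_coord_mem v, ?_⟩
    · have := (h 0).2
      omega
    · have := (h 1).2
      omega
    · rw [← hi, ← hj]
      have h1 := b.sum_repr (hF.coord v)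
      rw [Fin.sum_univ_two] at h1
      rw [h1, ← eq_shiftVertex_coord]

end IsFundamental

/-- Stated for arbitrary maps so as to count both the vertices and the darts of a box. -/
lemma ncard_translates {X : Type*} (act : ℤ × ℤ → X → X) (F : Set X)
    (h : ∀ a a' w w', w ∈ F → w' ∈ F → act a w = act a' w' → a = a' ∧ w = w')
    (b : Module.Basis (Fin 2) ℤ (ℤ × ℤ)) (n : ℕ) :
    {v | ∃ i < n, ∃ j < n, ∃ w ∈ F, act ((i : ℤ) • b 0 + (j : ℤ) • b 1) w = v}.ncard =
      n ^ 2 * F.ncard := by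
  have : {v | ∃ i < n, ∃ j < n, ∃ w ∈ F, act ((i : ℤ) • b 0 + (j : ℤ) • b 1) w = v} =
      (fun p : (ℕ × ℕ) × X => act ((p.1.1 : ℤ) • b 0 + (p.1.2 : ℤ) • b 1) p.2) ''
        ((Set.Iio n ×ˢ Set.Iio n) ×ˢ F) := by
    ext v
    constructor
    · rintro ⟨i, hi, j, hj, w, hw, rfl⟩
      exact ⟨((i, j), w), ⟨⟨hi, hj⟩, hw⟩, rfl⟩
    · rintro ⟨⟨⟨i, j⟩, w⟩, ⟨⟨hi, hj⟩, hw⟩, rfl⟩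
      exact ⟨i, hi, j, hj, w, hw, rfl⟩
  rw [this, Set.InjOn.ncard_image, Set.ncard_prod, Set.ncard_prod, sq]
  · congr 2 <;> simp [Set.ncard_eq_toFinset_card']
  · rintro ⟨⟨i, j⟩, w⟩ ⟨-, hw⟩ ⟨⟨i', j'⟩, w'⟩ ⟨-, hw'⟩ heq
    obtain ⟨h1, h2⟩ := h _ _ w w' hw hw' heq
    have hi := (repr_lattice b i j).1
    have hj := (repr_lattice b i j).2
    rw [h1] at hi hj
    rw [(repr_lattice b i' j').1] at hi
    rw [(repr_lattice b i' j').2] at hj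
    simp only [Prod.mk.injEq]
    exact ⟨⟨by omega, by omega⟩, h2⟩

variable {F : Set 𝒢.Vertex} {b : Module.Basis (Fin 2) ℤ (ℤ × ℤ)}

lemma IsFundamental.ncard_boxVertices (hF : IsFundamental F)
    (b : Module.Basis (Fin 2) ℤ (ℤ × ℤ)) (n : ℕ) :
    (𝒢.boxVertices b F n).ncard = n ^ 2 * Nat.card 𝒢.quotient.Vertex := by
  rw [← hF.ncard_eq]
  refine ncard_translates 𝒢.shiftVertex F (fun a a' w w' hw hw' heq => ?_) b n
  have h1 := congrArg hF.coord heq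
  rw [hF.coord_shiftVertex, hF.coord_shiftVertex, hF.coord_eq_zero hw, hF.coord_eq_zero hw',
    add_zero, add_zero] at h1
  subst h1
  exact ⟨rfl, (𝒢.shiftVertexEquiv a).injective heq⟩

lemma IsFundamental.ncard_darts_box (hF : IsFundamental F)
    (b : Module.Basis (Fin 2) ℤ (ℤ × ℤ)) (n : ℕ) :
    {d | 𝒢.vertexOf d ∈ 𝒢.boxVertices b F n}.ncard = n ^ 2 * Nat.card 𝒢.quotient.Dart := by
  rw [← hF.ncard_darts, ← ncard_translates 𝒢.shift {d | 𝒢.vertexOf d ∈ F} _ b n]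
  · congr 1
    ext d
    constructor
    · rintro ⟨i, hi, j, hj, w, hw, hwd⟩
      refine ⟨i, hi, j, hj, 𝒢.shift (-((i : ℤ) • b 0 + (j : ℤ) • b 1)) d, ?_, shift_shift_neg _ _ _⟩
      rw [Set.mem_ofPred_eq, ← shiftVertex_vertexOf, ← hwd, ← shiftVertex_add, neg_add_cancel,
        shiftVertex_zero]
      exact hw
    · rintro ⟨i, hi, j, hj, w, hw, rfl⟩
      exact ⟨i, hi, j, hj, 𝒢.vertexOf w, hw, rfl⟩
  · intro a a' w w' hw hw' heq
    have h1 := congrArg (fun d => hF.coord (𝒢.vertexOf d)) heq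
    simp only [← shiftVertex_vertexOf] at h1
    rw [hF.coord_shiftVertex, hF.coord_shiftVertex, hF.coord_eq_zero hw, hF.coord_eq_zero hw',
      add_zero, add_zero] at h1
    subst h1
    exact ⟨rfl, 𝒢.shift_injective a heq⟩

lemma finite_boxVertices (hF : F.Finite) (n : ℕ) : (𝒢.boxVertices b F n).Finite := by
  refine (((Set.finite_Iio n).prod (Set.finite_Iio n)).prod hF).image
    (fun p : (ℕ × ℕ) × 𝒢.Vertex => 𝒢.shiftVertex ((p.1.1 : ℤ) • b 0 + (p.1.2 : ℤ) • b 1) p.2)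
    |>.subset ?_
  rintro _ ⟨i, hi, j, hj, w, hw, rfl⟩
  exact ⟨((i, j), w), ⟨⟨hi, hj⟩, hw⟩, rfl⟩

lemma induce_mono {α β : Type*} (G : Graph α β) {X Y : Set α} (h : X ⊆ Y) :
    G.induce X ≤ G.induce Y :=
  ⟨h, fun _ _ _ hl => ⟨hl.1, h hl.2.1, h hl.2.2⟩⟩

lemma exists_repr_bound (b : Module.Basis (Fin 2) ℤ (ℤ × ℤ)) {X : Type*} (f : X → ℤ × ℤ)
    {S : Set X} (hS : S.Finite) : ∃ C : ℕ, ∀ s ∈ S, ∀ i, |b.repr (f s) i| ≤ C := by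
  obtain ⟨C, hC⟩ := (hS.image fun s => ∑ i, (b.repr (f s) i).natAbs).bddAbove
  refine ⟨C, fun s hs i => ?_⟩
  have h1 := hC (Set.mem_image_of_mem _ hs)
  have h2 := Finset.single_le_sum (f := fun i => (b.repr (f s) i).natAbs)
    (fun _ _ => Nat.zero_le _) (Finset.mem_univ i)
  have h3 : (b.repr (f s) i).natAbs ≤ C := h2.trans h1
  rw [Int.abs_eq_natAbs]
  exact_mod_cast h3

/-- Disjoint translates of a finite set of vertices fill the large boxes up to the boundary. -/
lemma IsExhaustion.exists_pow_le (h : 𝒢.IsPlanarLatticeGraph) (hF : 𝒢.IsExhaustion b F)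
    {S : Set 𝒢.Vertex} (hS : S.Finite) {m : ℕ} (hm : 1 ≤ m)
    (hdisj : ∀ a : ℤ × ℤ, ∀ v ∈ S, 𝒢.shiftVertex ((m : ℤ) • a) v ∈ S → a = 0) :
    ∃ R, ∀ q N, m * q + R ≤ N →
      numSpanningTrees (𝒢.toGraph.induce S) ^ (q ^ 2) ≤ numSpanningTrees (𝒢.box b F N) := by
  have hF0 : IsFundamental F := hF.fundamental
  obtain ⟨C, hC⟩ := exists_repr_bound b hF0.coord hS
  -- `C` bounds the coordinates on `S`. Starting the translations at `C` keeps all coordinates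
  -- nonnegative, `m * C + C` leaves room at the far side, and the final `1` ensures `1 ≤ N`.
  refine ⟨m * C + C + 1, fun q N hN => ?_⟩
  let t : Fin q × Fin q → ℤ × ℤ := fun p => ((C + p.1 : ℕ) : ℤ) • b 0 + ((C + p.2 : ℕ) : ℤ) • b 1
  have ht : ∀ p, b.repr (t p) 0 = (C + p.1 : ℕ) ∧ b.repr (t p) 1 = (C + p.2 : ℕ) := fun p =>
    repr_lattice b _ _
  have hbound : ∀ k < q, ∀ x : ℤ, |x| ≤ C →
      0 ≤ (m : ℤ) * (C + k : ℕ) + x ∧ (m : ℤ) * (C + k : ℕ) + x < N := by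
    intro k hk x hx
    have h1 : C ≤ m * (C + k) := (Nat.le_add_right C k).trans (Nat.le_mul_of_pos_left _ hm)
    have h2 : m * (C + k) + m ≤ m * C + m * q := by
      rw [← Nat.mul_succ, ← Nat.mul_add]
      exact Nat.mul_le_mul_left m (by omega)
    rw [abs_le] at hx
    zify at h1 h2 hN hm
    push_cast
    constructor <;> linarith
  have key := prod_numSpanningTrees_le (G := 𝒢.box b F N)
    (fun p => 𝒢.toGraph.induce (𝒢.shiftVertex ((m : ℤ) • t p) '' S))
    (𝒢.finite_edgeSet_induce h (finite_boxVertices (hF0.finite h) N))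
    (hF.connected N (by omega)) (fun p => ?_) (fun p p' hpp' => ?_)
  · simp only [numSpanningTrees_induce_shift, Finset.prod_const, Finset.card_univ,
      Fintype.card_prod, Fintype.card_fin, ← sq] at key
    exact key
  · refine induce_mono _ ?_
    rintro _ ⟨s, hs, rfl⟩
    rw [hF0.mem_boxVertices_iff]
    intro i
    rw [hF0.coord_shiftVertex, map_add, map_smul, Finsupp.add_apply, Finsupp.smul_apply,
      smul_eq_mul]
    fin_cases i
    · change 0 ≤ (m : ℤ) * b.repr (t p) 0 + _ ∧ (m : ℤ) * b.repr (t p) 0 + _ < _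
      rw [(ht p).1]
      exact hbound _ p.1.2 _ (hC s hs 0)
    · change 0 ≤ (m : ℤ) * b.repr (t p) 1 + _ ∧ (m : ℤ) * b.repr (t p) 1 + _ < _
      rw [(ht p).2]
      exact hbound _ p.2.2 _ (hC s hs 1)
  · rw [Graph.vertexSet_induce, Graph.vertexSet_induce, Set.disjoint_left]
    rintro _ ⟨s, hs, rfl⟩ ⟨s', hs', heq⟩
    have h1 : 𝒢.shiftVertex ((m : ℤ) • (t p - t p')) s = s' := by
      have h2 := congrArg (𝒢.shiftVertex (-((m : ℤ) • t p'))) heq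
      rw [← shiftVertex_add, ← shiftVertex_add, neg_add_cancel, shiftVertex_zero] at h2
      rw [h2, smul_sub, sub_eq_neg_add]
    have h2 := hdisj _ s hs (by rwa [h1])
    rw [sub_eq_zero] at h2
    refine hpp' (Prod.ext (Fin.ext ?_) (Fin.ext ?_))
    · have h3 := (ht p).1
      rw [h2, (ht p').1] at h3
      omega
    · have h3 := (ht p).2
      rw [h2, (ht p').2] at h3
      omega

/-- With `q = (N - R) / m` rounded down, `q ≥ N / m - K` for the constant `K` below, so `q ^ 2`
falls short of `(N / m) ^ 2` by a lower-order term only. -/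
lemma eventually_le_of_pow_le {t : ℕ → ℕ} {τ m R : ℕ} (hm : 1 ≤ m)
    (h : ∀ q N, m * q + R ≤ N → τ ^ (q ^ 2) ≤ t N) {ε : ℝ} (hε : 0 < ε) :
    ∀ᶠ N in atTop, Real.log τ / (m : ℝ) ^ 2 - ε ≤ Real.log (t N) / (N : ℝ) ^ 2 := by
  have hm0 : (0 : ℝ) < m := by exact_mod_cast hm
  let K : ℝ := (R + m) / m
  have hlim : Tendsto (fun N : ℕ => 1 / (m : ℝ) - K / N) atTop (𝓝 (1 / m - 0)) :=
    tendsto_const_nhds.sub (tendsto_const_div_atTop_nhds_zero_nat K)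
  rw [sub_zero] at hlim
  have hlim2 : Tendsto (fun N : ℕ => (1 / (m : ℝ) - K / N) ^ 2 * Real.log τ) atTop
      (𝓝 ((1 / m) ^ 2 * Real.log τ)) := (hlim.pow 2).mul_const _
  have e1 := hlim2.eventually (lt_mem_nhds (show Real.log τ / (m : ℝ) ^ 2 - ε <
    (1 / m) ^ 2 * Real.log τ by rw [one_div, inv_pow, mul_comm, ← div_eq_mul_inv]; linarith))
  have e2 := hlim.eventually (lt_mem_nhds (show (0 : ℝ) < 1 / m by positivity))
  filter_upwards [e1, e2, eventually_ge_atTop (R + 1)] with N h1 h2 h3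
  refine h1.le.trans ?_
  have hN : (0 : ℝ) < N := by exact_mod_cast (by omega : 0 < N)
  have hq : (1 / (m : ℝ) - K / N) * N ≤ ((N - R) / m : ℕ) := by
    have h4 : N - R < m * ((N - R) / m) + m := by
      have := Nat.lt_mul_div_succ (N - R) hm
      rwa [Nat.mul_add, mul_one] at this
    have h5 : N < m * ((N - R) / m) + m + R := by omega
    have h6 : (N : ℝ) < m * ((N - R) / m : ℕ) + m + R := by exact_mod_cast h5
    have h7 : (1 / (m : ℝ) - K / N) * N = (N - (R + m)) / m := by
      simp only [K]
      field_simp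
    rw [h7, div_le_iff₀ hm0]
    linarith
  -- For `τ = 0` the convention `Real.log 0 = 0` makes the lower bound vanish.
  rcases Nat.eq_zero_or_pos τ with rfl | hτ
  · simp only [Nat.cast_zero, Real.log_zero, mul_zero]
    exact div_nonneg (Real.log_natCast_nonneg _) (by positivity)
  · have h4 := h ((N - R) / m) N (by
      have := Nat.mul_div_le (N - R) m
      omega)
    have h5 : (((N - R) / m : ℕ) : ℝ) ^ 2 * Real.log τ ≤ Real.log (t N) := by
      have h6 := Real.log_le_log (by exact_mod_cast Nat.pow_pos hτ)
        (show ((τ ^ (((N - R) / m) ^ 2) : ℕ) : ℝ) ≤ t N by exact_mod_cast h4)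
      rwa [Nat.cast_pow, Real.log_pow, Nat.cast_pow] at h6
    rw [le_div_iff₀ (by positivity)]
    refine le_trans ?_ h5
    rw [mul_right_comm, ← mul_pow]
    gcongr

/-- The limit is the supremum; the index is shifted to leave out `u 0`, which need not be a lower
bound for later terms. -/
lemma exists_tendsto_of_eventually_le {u : ℕ → ℝ} {B : ℝ} (hB : ∀ n, u n ≤ B)
    (h : ∀ m, 1 ≤ m → ∀ ε > 0, ∀ᶠ N in atTop, u m - ε ≤ u N) : ∃ l, Tendsto u atTop (𝓝 l) := by
  have hbdd : BddAbove (Set.range fun n => u (n + 1)) := ⟨B, by rintro _ ⟨n, rfl⟩; exact hB _⟩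
  refine ⟨⨆ n, u (n + 1), tendsto_order.2 ⟨fun a ha => ?_, fun a ha => ?_⟩⟩
  · obtain ⟨m, hm⟩ := exists_lt_of_lt_ciSup ha
    filter_upwards [h (m + 1) (by omega) ((u (m + 1) - a) / 2) (by linarith)] with N hN
    linarith
  · filter_upwards [eventually_ge_atTop 1] with N hN
    have := le_ciSup hbdd (N - 1)
    simp only [Nat.sub_add_cancel hN] at this
    exact this.trans_lt ha

lemma le_of_eventually_le {v : ℕ → ℝ} {c l : ℝ} (hl : Tendsto v atTop (𝓝 l))
    (h : ∀ ε > 0, ∀ᶠ N in atTop, c - ε ≤ v N) : c ≤ l :=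
  le_of_forall_pos_sub_le fun ε hε => ge_of_tendsto hl (h ε hε)

/-- Coordinates inside one box differ by less than `m`. -/
lemma IsFundamental.eq_zero_of_mem_boxVertices {b : Module.Basis (Fin 2) ℤ (ℤ × ℤ)}
    {F : Set 𝒢.Vertex} (hF : IsFundamental F) {m : ℕ} (hm : 1 ≤ m) (a : ℤ × ℤ) :
    ∀ v ∈ 𝒢.boxVertices b F m, 𝒢.shiftVertex ((m : ℤ) • a) v ∈ 𝒢.boxVertices b F m → a = 0 := by
  intro v hv hav
  rw [hF.mem_boxVertices_iff] at hv hav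
  refine b.repr.map_eq_zero_iff.1 (Finsupp.ext fun i => ?_)
  have h1 := hv i
  have h2 := hav i
  rw [hF.coord_shiftVertex, map_add, map_smul, Finsupp.add_apply, Finsupp.smul_apply,
    smul_eq_mul] at h2
  have hm' : (0 : ℤ) < m := by exact_mod_cast hm
  rw [Finsupp.zero_apply]
  refine le_antisymm (not_lt.1 fun hlt => ?_) (not_lt.1 fun hlt => ?_)
  · nlinarith
  · nlinarith

/-- The entropy is well defined as soon as there is an admissible exhaustion, and it is bounded
below by the spanning trees of the finite induced subgraphs. -/
theorem exists_hasSpanningTreeEntropy (h : 𝒢.IsPlanarLatticeGraph)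
    (hex : ∃ b F, 𝒢.IsExhaustion b F) : ∃ z, 𝒢.HasSpanningTreeEntropy z ∧
      ∀ (S : Set 𝒢.Vertex) (m : ℕ), S.Finite → 1 ≤ m →
        (∀ a : ℤ × ℤ, ∀ v ∈ S, 𝒢.shiftVertex ((m : ℤ) • a) v ∈ S → a = 0) →
        Real.log (numSpanningTrees (𝒢.toGraph.induce S)) / (m : ℝ) ^ 2 ≤
          Nat.card 𝒢.quotient.Vertex * z := by
  have := h.quotientFinite
  have : Finite 𝒢.quotient.Vertex := Quotient.finite _
  have hK : (0 : ℝ) < Nat.card 𝒢.quotient.Vertex := by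
    have : Nonempty 𝒢.quotient.Vertex := ⟨𝒢.projVertex h.connected.1.some⟩
    exact_mod_cast Nat.card_pos
  have hpack : ∀ {b F}, 𝒢.IsExhaustion b F → ∀ (S : Set 𝒢.Vertex) (m : ℕ), S.Finite → 1 ≤ m →
      (∀ a : ℤ × ℤ, ∀ v ∈ S, 𝒢.shiftVertex ((m : ℤ) • a) v ∈ S → a = 0) → ∀ ε > 0,
      ∀ᶠ N : ℕ in atTop, Real.log (numSpanningTrees (𝒢.toGraph.induce S)) / (m : ℝ) ^ 2 - ε ≤
        Real.log (numSpanningTrees (𝒢.box b F N)) / (N : ℝ) ^ 2 := by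
    intro b F hF S m hS hm hd ε hε
    obtain ⟨R, hR⟩ := hF.exists_pow_le h hS hm hd
    exact eventually_le_of_pow_le hm hR hε
  have hfin : ∀ {b F}, 𝒢.IsExhaustion b F → ∀ m, (𝒢.boxVertices b F m).Finite := fun hF m =>
    finite_boxVertices (IsFundamental.finite hF.fundamental h) m
  have hlim : ∀ {b F}, 𝒢.IsExhaustion b F → ∃ l, Tendsto (fun N : ℕ =>
      Real.log (numSpanningTrees (𝒢.box b F N)) / (N : ℝ) ^ 2) atTop (𝓝 l) := by
    intro b F hF
    have hF0 : IsFundamental F := hF.fundamental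
    refine exists_tendsto_of_eventually_le (B := Nat.card 𝒢.quotient.Dart * Real.log 2)
      (fun n => ?_) fun m hm => hpack hF _ m (hfin hF m) hm (hF0.eq_zero_of_mem_boxVertices hm)
    refine div_le_of_le_mul₀ (by positivity) (by positivity) ?_
    -- Every edge of the box has a dart that starts in the box, and there are `n ^ 2` times
    -- `Nat.card 𝒢.quotient.Dart` such darts; spanning trees are subsets of the edge set.
    have hd := 𝒢.finite_setOf_vertexOf_mem h (hfin hF n)
    have h1 : (𝒢.box b F n).edgeSet.ncard ≤ n ^ 2 * Nat.card 𝒢.quotient.Dart := by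
      rw [← hF0.ncard_darts_box b n]
      exact (Set.ncard_le_ncard (𝒢.edgeSet_induce_subset _) (hd.image _)).trans
        (Set.ncard_image_le hd)
    have h2 := (numSpanningTrees_le_two_pow (𝒢.finite_edgeSet_induce h (hfin hF n))).trans
      (Nat.pow_le_pow_right two_pos h1)
    rcases Nat.eq_zero_or_pos (numSpanningTrees (𝒢.box b F n)) with h0 | h0
    · rw [h0, Nat.cast_zero, Real.log_zero]
      positivity
    · have h3 := Real.log_le_log (by exact_mod_cast h0)
        (show ((numSpanningTrees (𝒢.box b F n) : ℕ) : ℝ) ≤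
          ((2 ^ (n ^ 2 * Nat.card 𝒢.quotient.Dart) : ℕ) : ℝ) by exact_mod_cast h2)
      rw [Nat.cast_pow, Real.log_pow] at h3
      push_cast at h3
      linarith
  obtain ⟨b, F, hF⟩ := hex
  obtain ⟨l, hl⟩ := hlim hF
  refine ⟨l / Nat.card 𝒢.quotient.Vertex, ⟨⟨b, F, hF⟩, fun b' F' hF' => ?_⟩, fun S m hS hm hd => ?_⟩
  · obtain ⟨l', hl'⟩ := hlim hF'
    -- The boxes of either exhaustion are packed into those of the other.
    have hll' : l' = l := by
      refine le_antisymm (le_of_tendsto hl' ?_) (le_of_tendsto hl ?_)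
      · filter_upwards [eventually_ge_atTop 1] with m hm
        exact le_of_eventually_le hl (hpack hF _ m (hfin hF' m) hm (IsFundamental.eq_zero_of_mem_boxVertices hF'.fundamental hm))
      · filter_upwards [eventually_ge_atTop 1] with m hm
        exact le_of_eventually_le hl' (hpack hF' _ m (hfin hF m) hm (IsFundamental.eq_zero_of_mem_boxVertices hF.fundamental hm))
    rw [← hll']
    refine (hl'.div_const _).congr fun n => ?_
    rw [show (𝒢.box b' F' n).vertexSet = 𝒢.boxVertices b' F' n from rfl,
      IsFundamental.ncard_boxVertices hF'.fundamental, div_div]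
    push_cast
    rfl
  · rw [mul_div_cancel₀ _ hK.ne']
    exact le_of_eventually_le hl (hpack hF S m hS hm hd)

end PeriodicGraph

/-! ### Flows on forests and connectedness of the dual. -/

section Connected

variable {α β : Type*} {G : Graph α β}

lemma IsConnected.of_base {r : α} (hr : r ∈ G.vertexSet)
    (h : ∀ x ∈ G.vertexSet, Reachable G r x) : IsConnected G :=
  ⟨⟨r, hr⟩, fun x hx y hy => (h x hx).symm.trans (h y hy)⟩

lemma IsConnected.insert_induce {X : Set α} {e : β} {u w : α}
    (hX : IsConnected (G.induce X)) (he : G.IsLink e u w) (hu : u ∈ X) :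
    IsConnected (G.induce (insert w X)) := by
  have hm : G.induce X ≤ G.induce (insert w X) :=
    PeriodicGraph.induce_mono G (Set.subset_insert w X)
  refine IsConnected.of_base (r := u) (Or.inr hu) ?_
  rintro x (rfl | hx)
  · exact .of_isLink (e := e) (by
      rw [Graph.induce_isLink]; exact ⟨he, Or.inr hu, Or.inl rfl⟩)
  · exact (hX.2 u hu x hx).mono hm

lemma IsConnected.exists_isSpanningTree_subset {A : Set β} (hV : G.vertexSet.Finite)
    (hA : A ⊆ G.edgeSet) (hc : IsConnected (G.restrict A)) :
    ∃ T ⊆ A, T.Finite ∧ IsSpanningTree G T := by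
  obtain ⟨T, hTA, hTf, hTc, hT⟩ := exists_connected_subset_ncard hV hc
  exact ⟨T, hTA, hTf, (isSpanningTree_iff hV hTf).2 ⟨hTA.trans hA, hTc, hT⟩⟩

end Connected

section Cycles

open Function

/-- An invariant set is a union of cycles, and `c` sums to zero over each of them. -/
lemma sum_invariant_eq_zero {A M : Type*} [Fintype A] [AddCommGroup M] (σ : Equiv.Perm A)
    (c : A → M) (hc : ∀ x, ∑ i ∈ Finset.range (minimalPeriod σ x), c (σ^[i] x) = 0)
    (W : A → Prop) [DecidablePred W] (hW : ∀ x, W (σ x) ↔ W x) : ∑ x with W x, c x = 0 := by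
  classical
  have : Fintype (Quotient (Equiv.Perm.SameCycle.setoid σ)) := Fintype.ofFinite _
  have hWc : ∀ {x y}, σ.SameCycle x y → W x → W y := fun h => h.of_invariant
    (fun x => (hW x).2) fun x hx => (hW _).1 (by rwa [Equiv.apply_symm_apply])
  rw [← Finset.sum_fiberwise _ (Quotient.mk (Equiv.Perm.SameCycle.setoid σ))]
  refine Finset.sum_eq_zero fun q _ => ?_
  induction q using Quotient.inductionOn with
  | h a =>
    by_cases ha : W a
    · have hinj : Set.InjOn (fun i => σ^[i] a) (Finset.range (minimalPeriod σ a)) := by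
        rw [Finset.coe_range]
        exact iterate_injOn_Iio_minimalPeriod
      have hsc : ∀ i, σ.SameCycle a (σ^[i] a) := fun i => ⟨i, by
        rw [zpow_natCast, Equiv.Perm.coe_pow]⟩
      have himg : (Finset.range (minimalPeriod σ a)).image (fun i => σ^[i] a) =
          (Finset.univ.filter W).filter fun x => Quotient.mk (Equiv.Perm.SameCycle.setoid σ) x =
            Quotient.mk (Equiv.Perm.SameCycle.setoid σ) a := by
        refine Finset.eq_of_subset_of_card_le (fun x hx => ?_) ?_
        · obtain ⟨i, -, rfl⟩ := Finset.mem_image.1 hx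
          rw [Finset.mem_filter, Finset.mem_filter]
          exact ⟨⟨Finset.mem_univ _, hWc (hsc i) ha⟩, mk_eq_mk_iff_sameCycle.2 (hsc i).symm⟩
        · rw [Finset.card_image_of_injOn hinj, Finset.card_range, ← card_mk_eq,
            Nat.card_eq_fintype_card, Fintype.card_subtype]
          exact Finset.card_le_card (Finset.filter_subset_filter _ (Finset.subset_univ _))
      rw [← himg, Finset.sum_image hinj, hc]
    · refine Finset.sum_eq_zero fun x hx => ?_
      rw [Finset.mem_filter, Finset.mem_filter] at hx
      exact absurd (hWc (mk_eq_mk_iff_sameCycle.1 hx.2) hx.1.2) ha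

end Cycles

namespace EmbeddedGraph

open Function

variable (G : EmbeddedGraph.{u})

/-- A flow without sources that is supported on a forest vanishes. -/
lemma flow_eq_zero [Fintype G.Dart] {M : Type*} [AddCommGroup M] {T : Set G.Edge}
    (hT : IsAcyclicSet G.toGraph T) (c : G.Dart → M) (hrev : ∀ d, c (G.rev d) = -c d)
    (hoff : ∀ d, G.edgeOf d ∉ T → c d = 0)
    (hdiv : ∀ d, ∑ i ∈ Finset.range (minimalPeriod G.next d), c (G.next^[i] d) = 0) (d : G.Dart) :
    c d = 0 := by
  classical
  by_cases hd : G.edgeOf d ∈ T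
  swap
  · exact hoff d hd
  -- `W` is the side of the initial vertex of `d` once the edge of `d` is deleted from `T`. The
  -- total flow out of `W` is zero, darts with both ends in `W` cancel in pairs, and `d` is the only
  -- dart on `T` that leaves `W`.
  let W : G.Dart → Prop := fun x =>
    Reachable (G.toGraph.restrict (T \ {G.edgeOf d})) (G.vertexOf d) (G.vertexOf x)
  have hWd : ¬ W (G.rev d) := hT _ hd _ _ (G.toGraph_isLink d)
  have h0 := sum_invariant_eq_zero G.next c hdiv W fun x => by
    simp only [W, G.vertexOf_next]
  rw [← Finset.sum_filter_add_sum_filter_not _ fun x => W (G.rev x),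
    Finset.sum_involution (s := (Finset.univ.filter W).filter fun x => W (G.rev x))
      (fun x _ => G.rev x), zero_add, Finset.sum_eq_single d] at h0
  · exact h0
  · intro x hx hxd
    simp only [Finset.mem_filter, Finset.mem_univ, true_and] at hx
    refine hoff x fun hxT => ?_
    by_cases hxe : G.edgeOf d = G.edgeOf x
    · rcases G.edgeOf_eq_iff.1 hxe with rfl | rfl
      · exact hxd rfl
      · exact hWd hx.1
    · refine hx.2 (hx.1.trans (.of_isLink (e := G.edgeOf x) ?_))
      rw [Graph.restrict_isLink]
      exact ⟨⟨hxT, Ne.symm hxe⟩, G.toGraph_isLink x⟩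
  · intro hd'
    refine absurd ?_ hd'
    simp only [Finset.mem_filter, Finset.mem_univ, true_and]
    exact ⟨.refl, hWd⟩
  · intro x _
    rw [hrev, add_neg_cancel]
  · intro x _ _
    exact G.rev_ne x
  · intro x hx
    simp only [Finset.mem_filter, Finset.mem_univ, true_and] at hx ⊢
    rw [G.rev_rev]
    exact hx.symm
  · intro x _
    exact G.rev_rev x

lemma isConnected_dual (h : IsConnected G.toGraph) : IsConnected G.dual.toGraph := by
  rw [isConnected_toGraph_iff] at h ⊢
  refine ⟨h.1, fun p h1 h2 h3 => h.2 p (fun d hd => ?_) (fun d hd => ?_) h3⟩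
  · have h4 := h3 _ (h2 d hd)
    change p (G.rev ((G.rev.trans G.next.symm).symm d)) at h4
    rwa [Equiv.symm_trans_apply, Equiv.symm_symm, G.rev_symm, G.rev_rev] at h4
  · have h4 := h1 _ (h3 d hd)
    change p (G.next.symm (G.rev (G.rev d))) at h4
    rwa [G.rev_rev] at h4

/-- Deleting the edges of a forest does not disconnect the dual graph. -/
lemma isConnected_dual_restrict_compl [Finite G.Dart] (h : IsConnected G.toGraph)
    {T : Set G.Edge} (hT : IsAcyclicSet G.toGraph T) (A : Set G.dual.Edge)
    (hA : ∀ d : G.Dart, G.edgeOf d ∉ T → G.dual.edgeOf d ∈ A) :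
    IsConnected (G.dual.toGraph.restrict A) := by
  classical
  have : Fintype G.Dart := Fintype.ofFinite _
  have hd := G.isConnected_dual h
  obtain ⟨f, hf⟩ := hd.1
  -- `φ` is the indicator of the component of `f` in the restricted dual. Its jump across a dart, `ψ
  -- (G.next d) - ψ d`, telescopes around each vertex and vanishes off `T`; being a flow on a forest
  -- it is zero, so `φ` is constant on the connected full dual.
  let φ : G.Face → ℤ := fun x => if Reachable (G.dual.toGraph.restrict A) f x then 1 else 0
  let ψ : G.Dart → ℤ := fun d => φ (G.faceOf (G.next.symm d))
  have hface : ∀ d, G.faceOf (G.next.symm (G.rev d)) = G.faceOf d := fun d =>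
    G.dual.vertexOf_next d
  have hψ : ∀ d, ψ (G.next d) = φ (G.faceOf d) := fun d => by
    simp only [ψ, Equiv.symm_apply_apply]
  have hψ' : ∀ d, ψ d = φ (G.faceOf (G.rev d)) := fun d => by
    have h1 := hface (G.rev d)
    rw [G.rev_rev] at h1
    simp only [ψ]
    rw [h1]
  have hflow : ∀ d, ψ (G.next d) - ψ d = 0 := by
    refine G.flow_eq_zero hT (fun d => ψ (G.next d) - ψ d) (fun d => ?_) (fun d hdT => ?_)
      (fun d => ?_)
    · rw [hψ, hψ, hψ', hψ', G.rev_rev, neg_sub]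
    · have hlink : Reachable (G.dual.toGraph.restrict A) (G.faceOf d) (G.faceOf (G.rev d)) :=
        .of_isLink (e := G.dual.edgeOf d) ⟨hA d hdT, G.dual.toGraph_isLink d⟩
      have h1 : φ (G.faceOf d) = φ (G.faceOf (G.rev d)) := by
        simp only [φ]
        congr 1
        exact propext ⟨fun h => h.trans hlink, fun h => h.trans hlink.symm⟩
      rw [hψ, hψ', h1, sub_self]
    · have h1 := Finset.sum_range_sub (fun i => ψ (G.next^[i] d)) (minimalPeriod G.next d)
      simp only [iterate_succ_apply', iterate_minimalPeriod, iterate_zero, id, sub_self] at h1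
      exact h1
  have hφ : ∀ d, φ (G.faceOf d) = φ (G.faceOf (G.rev d)) := fun d => by
    rw [← hψ, ← hψ', sub_eq_zero.1 (hflow d)]
  refine IsConnected.of_base (r := f) hf fun x _ => ?_
  have hx : φ x = 1 := by
    refine (hd.2 f trivial x trivial).of_invariant (p := fun x => φ x = 1) ?_ (if_pos .refl)
    rintro _ _ _ ⟨d, rfl, rfl, rfl⟩ h1
    exact (hφ d).symm.trans h1
  by_contra hcon
  simp only [φ] at hx
  rw [if_neg hcon] at hx
  exact zero_ne_one hx

variable {G} in
lemma edgeOf_mem_edgeSet_induce {S : Set G.Vertex} {d : G.Dart} :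
    G.edgeOf d ∈ (G.toGraph.induce S).edgeSet ↔ G.vertexOf d ∈ S ∧ G.vertexOf (G.rev d) ∈ S := by
  constructor
  · rintro ⟨_, _, ⟨d', hd', rfl, rfl⟩, h1, h2⟩
    rcases G.edgeOf_eq_iff.1 hd' with rfl | rfl
    · exact ⟨h1, h2⟩
    · rw [G.rev_rev]
      exact ⟨h2, h1⟩
  · rintro ⟨h1, h2⟩
    exact ⟨_, _, G.toGraph_isLink d, h1, h2⟩

end EmbeddedGraph

/-! ### Existence of admissible exhaustions. -/

namespace PeriodicGraph

open Function

variable {𝒢 : PeriodicGraph.{u}}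

lemma IsPlanarLatticeGraph.isConnected_quotient (h : 𝒢.IsPlanarLatticeGraph) :
    IsConnected 𝒢.quotient.toGraph := by
  obtain ⟨⟨d⟩, hc⟩ := 𝒢.isConnected_toGraph_iff.1 h.connected
  refine 𝒢.quotient.isConnected_toGraph_iff.2 ⟨⟨𝒢.proj d⟩, fun p h1 h2 h3 x y hx => ?_⟩
  obtain ⟨x, rfl⟩ := 𝒢.exists_proj x
  obtain ⟨y, rfl⟩ := 𝒢.exists_proj y
  exact hc (fun d => p (𝒢.proj d)) (fun d hd => h1 _ hd)
    (fun d hd => by rw [proj_next_symm]; exact h2 _ hd) (fun d hd => h3 _ hd) x y hx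

/-- The action on darts is free, so a vertex fixed by a nonzero translation would carry infinitely
many darts. -/
lemma IsPlanarLatticeGraph.shiftVertex_free (h : 𝒢.IsPlanarLatticeGraph) {a : ℤ × ℤ}
    {v : 𝒢.Vertex} (ha : 𝒢.shiftVertex a v = v) : a = 0 := by
  obtain ⟨d, rfl⟩ := 𝒢.exists_vertexOf v
  by_contra hne
  refine Set.infinite_of_injective_forall_mem (f := fun n : ℕ => 𝒢.shift ((n : ℤ) • a) d)
    (fun m n hmn => ?_) (fun n => ?_) (h.locallyFinite (𝒢.vertexOf d))
  · have h1 : 𝒢.shift (-((n : ℤ) • a) + (m : ℤ) • a) d = d := by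
      have h2 := congrArg (𝒢.shift (-((n : ℤ) • a))) hmn
      simp only at h2
      rwa [shift_neg_shift, ← 𝒢.shift_add] at h2
    have h2 := 𝒢.shift_free _ _ h1
    rw [neg_add_eq_zero] at h2
    exact_mod_cast smul_left_injective ℤ hne h2.symm
  · change 𝒢.vertexOf (𝒢.shift ((n : ℤ) • a) d) = _
    rw [← shiftVertex_vertexOf]
    induction n with
    | zero => rw [Nat.cast_zero, zero_smul, shiftVertex_zero]
    | succ n ih => rw [Nat.cast_succ, add_smul, one_smul, shiftVertex_add, ha, ih]

/-- Orbits are added one at a time: as `𝒢` is connected, some edge leads from an orbit already met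
to a new one, and a translate of that edge starts in the set built so far. -/
lemma exists_connected_fundamental (h : 𝒢.IsPlanarLatticeGraph) :
    ∃ F : Set 𝒢.Vertex, IsFundamental F ∧ IsConnected (𝒢.toGraph.induce F) := by
  have := h.quotientFinite
  have : Finite 𝒢.quotient.Vertex := Quotient.finite _
  obtain ⟨⟨r, -⟩, hc⟩ := h.connected
  have : Nonempty 𝒢.quotient.Vertex := ⟨𝒢.projVertex r⟩
  have hpos : 0 < Nat.card 𝒢.quotient.Vertex := Nat.card_pos
  have key : ∀ k, k + 1 ≤ Nat.card 𝒢.quotient.Vertex → ∃ F : Set 𝒢.Vertex, F.Finite ∧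
      F.ncard = k + 1 ∧ Set.InjOn 𝒢.projVertex F ∧ IsConnected (𝒢.toGraph.induce F) := by
    intro k
    induction k with
    | zero =>
      refine fun _ => ⟨{r}, Set.finite_singleton r, by simp, Set.injOn_singleton _ _, ⟨r, rfl⟩, ?_⟩
      rintro x rfl y rfl
      exact .refl
    | succ k ih =>
      intro hk
      obtain ⟨F, hFf, hF, hinj, hFc⟩ := ih (by omega)
      obtain ⟨e, u, w, hl, ⟨u', hu', huu'⟩, hw⟩ : ∃ e u w, 𝒢.toGraph.IsLink e u w ∧
          𝒢.projVertex u ∈ 𝒢.projVertex '' F ∧ 𝒢.projVertex w ∉ 𝒢.projVertex '' F := by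
        by_contra! hcon
        obtain ⟨v, hv⟩ := hFc.1
        have : 𝒢.projVertex '' F = Set.univ := Set.eq_univ_of_forall fun x => by
          obtain ⟨x, rfl⟩ := 𝒢.exists_projVertex x
          exact (hc v trivial x trivial).of_invariant
            (p := fun x => 𝒢.projVertex x ∈ 𝒢.projVertex '' F) hcon ⟨v, hv, rfl⟩
        have h1 := hinj.ncard_image
        rw [this, Set.ncard_univ] at h1
        omega
      obtain ⟨a, rfl⟩ := 𝒢.projVertex_eq_iff.1 huu'.symm
      have hw' : 𝒢.projVertex (𝒢.shiftVertex a w) ∉ 𝒢.projVertex '' F := by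
        rwa [projVertex_shiftVertex]
      have hwF : 𝒢.shiftVertex a w ∉ F := fun h => hw' ⟨_, h, rfl⟩
      refine ⟨insert (𝒢.shiftVertex a w) F, hFf.insert _, ?_, (Set.injOn_insert hwF).2 ⟨hinj, hw'⟩,
        hFc.insert_induce (isLink_shift a hl) hu'⟩
      rw [Set.ncard_insert_of_notMem hwF hFf, hF]
  obtain ⟨F, hFf, hF, hinj, hFc⟩ := key (Nat.card 𝒢.quotient.Vertex - 1) (by omega)
  have himg : 𝒢.projVertex '' F = Set.univ := Set.eq_of_subset_of_ncard_le (Set.subset_univ _) (by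
    rw [hinj.ncard_image, Set.ncard_univ]; omega)
  refine ⟨F, fun v => ?_, hFc⟩
  obtain ⟨w, hw, hwv⟩ : 𝒢.projVertex v ∈ 𝒢.projVertex '' F := himg ▸ trivial
  obtain ⟨a, rfl⟩ := 𝒢.projVertex_eq_iff.1 hwv.symm
  refine ⟨a, hw, fun a' ha' => ?_⟩
  have h1 := hinj ha' hw (by rw [projVertex_shiftVertex, projVertex_shiftVertex])
  have h2 : 𝒢.shiftVertex (-a + a') v = v := by
    rw [shiftVertex_add, h1, ← shiftVertex_add, neg_add_cancel, shiftVertex_zero]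
  exact (neg_add_eq_zero.1 (h.shiftVertex_free h2)).symm

variable (𝒢) in
/-- The image of an edge in the quotient by the lattice. -/
def projEdge (e : 𝒢.Edge) : 𝒢.quotient.Edge :=
  Quotient.liftOn e (fun d => 𝒢.quotient.edgeOf (𝒢.proj d)) fun d d' h => by
    rcases 𝒢.edgeOf_eq_iff.1 (Quotient.sound (s := Equiv.Perm.SameCycle.setoid 𝒢.rev) h) with
      rfl | rfl
    · rfl
    · rw [proj_rev, EmbeddedGraph.edgeOf_rev]

lemma projEdge_edgeOf (d : 𝒢.Dart) : 𝒢.projEdge (𝒢.edgeOf d) = 𝒢.quotient.edgeOf (𝒢.proj d) := rfl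

/-- Edges of `T` have both ends in `F`, so distinct ones are not translates of each other, and the
image is a connected set with the right number of edges. -/
lemma isSpanningTree_projEdge (h : 𝒢.IsPlanarLatticeGraph) {F : Set 𝒢.Vertex}
    (hF : IsFundamental F) {T : Set 𝒢.Edge} (hT : IsSpanningTree (𝒢.toGraph.induce F) T) :
    IsSpanningTree 𝒢.quotient.toGraph (𝒢.projEdge '' T) ∧
      (𝒢.projEdge '' T).ncard + 1 = Nat.card 𝒢.quotient.Vertex := by
  have := h.quotientFinite
  have : Finite 𝒢.quotient.Vertex := Quotient.finite _
  have : Finite 𝒢.quotient.Edge := Quotient.finite _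
  have hTf : T.Finite := (𝒢.finite_edgeSet_induce h (hF.finite h)).subset hT.subset
  have hcard := ((isSpanningTree_iff (hF.finite h) hTf).1 hT).2.2
  rw [Graph.vertexSet_induce, hF.ncard_eq] at hcard
  have hinj : Set.InjOn 𝒢.projEdge T := by
    intro e he e' he' hee'
    obtain ⟨d, rfl⟩ := 𝒢.exists_edgeOf e
    obtain ⟨d', rfl⟩ := 𝒢.exists_edgeOf e'
    have h1 := EmbeddedGraph.edgeOf_mem_edgeSet_induce.1 (hT.subset he)
    have h2 := EmbeddedGraph.edgeOf_mem_edgeSet_induce.1 (hT.subset he')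
    rw [projEdge_edgeOf, projEdge_edgeOf, EmbeddedGraph.edgeOf_eq_iff, ← proj_rev, eq_comm,
      proj_eq_iff, @eq_comm _ (𝒢.proj d'), proj_eq_iff] at hee'
    rcases hee' with ⟨a, rfl⟩ | ⟨a, rfl⟩
    · rw [hF.eq_zero h1.1 h2.1, 𝒢.shift_zero]
    · rw [hF.eq_zero h1.2 h2.1, 𝒢.shift_zero, 𝒢.edgeOf_rev]
  have hcard' : (𝒢.projEdge '' T).ncard + 1 = Nat.card 𝒢.quotient.Vertex := by
    rw [hinj.ncard_image, hcard]
  refine ⟨(isSpanningTree_iff (Set.toFinite _) (Set.toFinite _)).2 ⟨?_, ⟨?_, ?_⟩, ?_⟩, hcard'⟩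
  · rintro _ ⟨e, -, rfl⟩
    obtain ⟨d, rfl⟩ := 𝒢.exists_edgeOf e
    exact (𝒢.quotient.toGraph_isLink (𝒢.proj d)).edge_mem
  · obtain ⟨v, -⟩ := hT.connected.1
    exact ⟨𝒢.projVertex v, trivial⟩
  · intro x _ y _
    obtain ⟨v, hv, rfl⟩ := hF.bijOn_projVertex.surjOn (Set.mem_univ x)
    obtain ⟨w, hw, rfl⟩ := hF.bijOn_projVertex.surjOn (Set.mem_univ y)
    refine (hT.connected.2 v hv w hw).map 𝒢.projVertex fun e x y hxy => ?_
    rw [Graph.restrict_isLink, Graph.induce_isLink] at hxy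
    obtain ⟨he, ⟨d, rfl, rfl, rfl⟩, -⟩ := hxy
    exact .of_isLink (e := 𝒢.projEdge (𝒢.edgeOf d)) (by
      rw [Graph.restrict_isLink]
      exact ⟨⟨_, he, rfl⟩, 𝒢.quotient.toGraph_isLink (𝒢.proj d)⟩)
  · rw [hcard', ← Set.ncard_univ]
    rfl

/-- The difference of the coordinates of the ends of a dart of the quotient. -/
def IsFundamental.voltage {F : Set 𝒢.Vertex} (hF : IsFundamental F) (x : 𝒢.quotient.Dart) :
    ℤ × ℤ :=
  Quotient.liftOn x (fun d => hF.coord (𝒢.vertexOf (𝒢.rev d)) - hF.coord (𝒢.vertexOf d)) (by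
    rintro d _ ⟨a, rfl⟩
    simp only [← 𝒢.shift_rev, ← shiftVertex_vertexOf, hF.coord_shiftVertex]
    abel)

lemma IsFundamental.voltage_proj {F : Set 𝒢.Vertex} (hF : IsFundamental F) (d : 𝒢.Dart) :
    hF.voltage (𝒢.proj d) = hF.coord (𝒢.vertexOf (𝒢.rev d)) - hF.coord (𝒢.vertexOf d) := rfl

/-- The voltages of two edges generate the lattice. -/
lemma exists_span_voltage (h : 𝒢.IsPlanarLatticeGraph) {F : Set 𝒢.Vertex} (hF : IsFundamental F)
    (hc : IsConnected (𝒢.toGraph.induce F)) :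
    ∃ x y, Submodule.span ℤ {hF.voltage x, hF.voltage y} = ⊤ := by
  have := h.quotientFinite
  have : Fintype 𝒢.quotient.Dart := Fintype.ofFinite _
  let _ : Fintype 𝒢.quotient.dual.Dart := ‹Fintype 𝒢.quotient.Dart›
  have : Finite 𝒢.quotient.Vertex := Quotient.finite _
  have : Finite 𝒢.quotient.Edge := Quotient.finite _
  have : Finite 𝒢.quotient.dual.Vertex := Quotient.finite _
  obtain ⟨T, hT⟩ := hc.exists_isSpanningTree (𝒢.finite_edgeSet_induce h (hF.finite h))
  obtain ⟨hT1, hT2⟩ := isSpanningTree_projEdge h hF hT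
  set T₁ : Set 𝒢.quotient.Edge := 𝒢.projEdge '' T with hT₁
  obtain ⟨T₂, hT₂, hT₂f, hT3⟩ := IsConnected.exists_isSpanningTree_subset
    (G := 𝒢.quotient.dual.toGraph) (A := (T₁ᶜ : Set 𝒢.quotient.Edge)) (Set.toFinite _)
    (fun e _ => by
      obtain ⟨d, rfl⟩ := 𝒢.quotient.dual.exists_edgeOf e
      exact (𝒢.quotient.dual.toGraph_isLink d).edge_mem)
    (𝒢.quotient.isConnected_dual_restrict_compl h.isConnected_quotient hT1.acyclic _
      fun d hd => hd)
  have hT4 := ((isSpanningTree_iff (Set.toFinite _) hT₂f).1 hT3).2.2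
  replace hT4 : Set.ncard (α := 𝒢.quotient.Edge) T₂ + 1 = Nat.card 𝒢.quotient.Face := by
    rw [← Set.ncard_univ]
    exact hT4
  have hdisj : Disjoint T₁ T₂ := Set.disjoint_left.2 fun e h1 h2 => hT₂ h2 h1
  -- Euler characteristic `0` gives `E - (V - 1) - (F - 1) = 2`.
  have hrest : ((T₁ ∪ T₂)ᶜ : Set 𝒢.quotient.Edge).ncard = 2 := by
    have h1 := Set.ncard_add_ncard_compl (T₁ ∪ T₂)
    rw [Set.ncard_union_eq hdisj] at h1
    have h2 := h.torus
    unfold EmbeddedGraph.eulerChar at h2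
    omega
  obtain ⟨e, e', -, hee'⟩ := Set.ncard_eq_two.1 hrest
  obtain ⟨x, rfl⟩ := 𝒢.quotient.exists_edgeOf e
  obtain ⟨y, rfl⟩ := 𝒢.quotient.exists_edgeOf e'
  refine ⟨x, y, ?_⟩
  set M := Submodule.span ℤ {hF.voltage x, hF.voltage y}
  have hxM : hF.voltage x ∈ M := Submodule.subset_span (Or.inl rfl)
  have hyM : hF.voltage y ∈ M := Submodule.subset_span (Or.inr rfl)
  have hrev : ∀ z, hF.voltage (𝒢.quotient.rev z) = -hF.voltage z := by
    intro z
    obtain ⟨d, rfl⟩ := 𝒢.exists_proj z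
    rw [← proj_rev, hF.voltage_proj, hF.voltage_proj, 𝒢.rev_rev, neg_sub]
  -- Modulo `M` the voltage vanishes on `T₁`, whose edges lift into `F`, and on the two leftover
  -- edges, so it is supported on the dual tree `T₂`. It sums to zero around each face because the
  -- faces of `𝒢` close up. Thus it is a flow on a forest of the dual.
  have hmem : ∀ z, hF.voltage z ∈ M := by
    intro z
    rw [← Submodule.Quotient.mk_eq_zero]
    refine 𝒢.quotient.dual.flow_eq_zero (T := T₂) hT3.acyclic
      (fun z : 𝒢.quotient.Dart => (Submodule.Quotient.mk (hF.voltage z) : (ℤ × ℤ) ⧸ M))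
      (fun z => ?_) (fun z hz => ?_) (fun z => ?_) z
    · exact congrArg Submodule.Quotient.mk (hrev z)
    · rw [Submodule.Quotient.mk_eq_zero]
      have hz' : 𝒢.quotient.edgeOf z ∉ T₂ := hz
      by_cases hz1 : 𝒢.quotient.edgeOf z ∈ T₁
      · obtain ⟨e, he, hez⟩ := hz1
        obtain ⟨d, rfl⟩ := 𝒢.exists_edgeOf e
        obtain ⟨h1, h2⟩ := EmbeddedGraph.edgeOf_mem_edgeSet_induce.1 (hT.subset he)
        have h0 : hF.voltage (𝒢.proj d) = 0 := by
          rw [hF.voltage_proj, hF.coord_eq_zero h1, hF.coord_eq_zero h2, sub_zero]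
        rcases 𝒢.quotient.edgeOf_eq_iff.1 hez with rfl | rfl
        · rw [h0]
          exact M.zero_mem
        · rw [hrev, h0, neg_zero]
          exact M.zero_mem
      · have h1 : 𝒢.quotient.edgeOf z ∈ ((T₁ ∪ T₂)ᶜ : Set 𝒢.quotient.Edge) := by
          rintro (h1 | h1)
          · exact hz1 h1
          · exact hz' h1
        rw [hee'] at h1
        rcases h1 with h1 | h1
        · rcases 𝒢.quotient.edgeOf_eq_iff.1 h1.symm with rfl | rfl
          · exact hxM
          · rw [hrev]
            exact M.neg_mem hxM
        · rcases 𝒢.quotient.edgeOf_eq_iff.1 (Eq.symm h1) with rfl | rfl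
          · exact hyM
          · rw [hrev]
            exact M.neg_mem hyM
    · obtain ⟨d, rfl⟩ := 𝒢.exists_proj z
      have hper : minimalPeriod 𝒢.quotient.dual.next (𝒢.proj d) = minimalPeriod 𝒢.faceNext d :=
        𝒢.minimalPeriod_proj 𝒢.shift_faceNext 𝒢.proj_faceNext (h.minimalPeriod_faceNext_pos d)
      rw [hper]
      have hit : ∀ i, (𝒢.quotient.dual.next^[i] (𝒢.proj d) : 𝒢.quotient.Dart) =
          𝒢.proj (𝒢.faceNext^[i] d) := fun i =>
        ((Semiconj.iterate_right (f := 𝒢.proj) (ga := 𝒢.faceNext) (gb := 𝒢.quotient.faceNext)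
          𝒢.proj_faceNext i).eq d).symm
      have h1 := Finset.sum_range_sub (fun i => (Submodule.Quotient.mk
        (hF.coord (𝒢.vertexOf (𝒢.faceNext^[i] d))) : (ℤ × ℤ) ⧸ M)) (minimalPeriod 𝒢.faceNext d)
      rw [iterate_minimalPeriod, iterate_zero, id, sub_self] at h1
      refine Eq.trans (Finset.sum_congr rfl fun i _ => ?_) h1
      refine (congrArg (fun z => (Submodule.Quotient.mk (hF.voltage z) : (ℤ × ℤ) ⧸ M))
        (hit i)).trans ?_
      simp only [hF.voltage_proj, iterate_succ_apply', Submodule.Quotient.mk_sub,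
        EmbeddedGraph.faceNext_apply, EmbeddedGraph.vertexOf_next_symm]
  refine eq_top_iff.2 fun a _ => ?_
  obtain ⟨⟨v, -⟩, hconn⟩ := h.connected
  -- Summing voltages along a walk from `v` to its translate by `a` shows `a ∈ M`.
  have h1 := (hconn v trivial (𝒢.shiftVertex a v) trivial).of_invariant
    (p := fun w => hF.coord w - hF.coord v ∈ M) (by
      rintro _ _ _ ⟨d, rfl, rfl, rfl⟩ hd
      have h2 := M.add_mem hd (hmem (𝒢.proj d))
      rwa [hF.voltage_proj, sub_add_sub_cancel'] at h2) (by rw [sub_self]; exact M.zero_mem)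
  rwa [hF.coord_shiftVertex, add_sub_cancel_right] at h1

/-- Each basis vector is the voltage of an edge, so neighbouring copies of a connected fundamental
domain are joined by an edge, and a box is connected as a grid is. -/
lemma exists_isExhaustion (h : 𝒢.IsPlanarLatticeGraph) : ∃ b F, 𝒢.IsExhaustion b F := by
  obtain ⟨F, hF, hc⟩ := exists_connected_fundamental h
  obtain ⟨x, y, hxy⟩ := exists_span_voltage h hF hc
  have hspan : ⊤ ≤ Submodule.span ℤ (Set.range ![hF.voltage x, hF.voltage y]) := by
    rw [Matrix.range_cons_cons_empty, hxy]
  let b : Module.Basis (Fin 2) ℤ (ℤ × ℤ) := .mk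
    (linearIndependent_of_top_le_span_of_card_eq_finrank hspan (by simp)) hspan
  have hb : ∀ k : Fin 2, ∃ z, b k = hF.voltage z := by
    intro k
    rw [Module.Basis.mk_apply]
    fin_cases k
    · exact ⟨x, rfl⟩
    · exact ⟨y, rfl⟩
  obtain ⟨⟨r, hr⟩, hFc⟩ := hc
  refine ⟨b, F, hF, fun n hn => ?_⟩
  let t : ℕ → ℕ → ℤ × ℤ := fun i j => (i : ℤ) • b 0 + (j : ℤ) • b 1
  have hmem : ∀ {i j w}, i < n → j < n → w ∈ F →
      𝒢.shiftVertex (t i j) w ∈ 𝒢.boxVertices b F n := fun hi hj hw => ⟨_, hi, _, hj, _, hw, rfl⟩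
  have hin : ∀ {i j v w}, i < n → j < n → v ∈ F → w ∈ F →
      Reachable (𝒢.box b F n) (𝒢.shiftVertex (t i j) v) (𝒢.shiftVertex (t i j) w) := by
    intro i j v w hi hj hv hw
    refine (hFc v hv w hw).map _ fun e x y hxy => .of_isLink (e := 𝒢.shiftEdge (t i j) e) ?_
    rw [Graph.induce_isLink] at hxy
    unfold box
    rw [Graph.induce_isLink]
    exact ⟨isLink_shift _ hxy.1, hmem hi hj hxy.2.1, hmem hi hj hxy.2.2⟩
  have hstep : ∀ (k : Fin 2) {i j i' j'}, i < n → j < n → i' < n → j' < n → t i' j' = t i j + b k →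
      Reachable (𝒢.box b F n) (𝒢.shiftVertex (t i j) r) (𝒢.shiftVertex (t i' j') r) := by
    intro k i j i' j' hi hj hi' hj' ht
    obtain ⟨z, hz⟩ := hb k
    obtain ⟨d, rfl⟩ := 𝒢.exists_proj z
    rw [hF.voltage_proj] at hz
    -- The translate of `d` by `t i j - c` runs from the copy of `F` at `t i j` to the copy at `t i
    -- j + b k`.
    set c := hF.coord (𝒢.vertexOf d)
    have h1 : 𝒢.shiftVertex (-c) (𝒢.vertexOf d) ∈ F := hF.shiftVertex_neg_coord_mem _
    have h2 : 𝒢.shiftVertex (-(c + b k)) (𝒢.vertexOf (𝒢.rev d)) ∈ F := by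
      rw [hz, add_sub_cancel]
      exact hF.shiftVertex_neg_coord_mem _
    refine (hin hi hj hr h1).trans (Reachable.trans ?_ (hin hi' hj' h2 hr))
    refine .of_isLink (e := 𝒢.shiftEdge (t i j + -c) (𝒢.edgeOf d)) ?_
    have h3 := isLink_shift (t i j + -c) (𝒢.toGraph_isLink d)
    unfold box
    rw [Graph.induce_isLink]
    refine ⟨?_, hmem hi hj h1, hmem hi' hj' h2⟩
    rw [← shiftVertex_add, ← shiftVertex_add, ht,
      show t i j + b k + -(c + b k) = t i j + -c by abel]
    exact h3
  have hrow : ∀ i, i < n →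
      Reachable (𝒢.box b F n) (𝒢.shiftVertex (t 0 0) r) (𝒢.shiftVertex (t i 0) r) := by
    intro i
    induction i with
    | zero => exact fun _ => .refl
    | succ i ih =>
      intro hi
      exact (ih (by omega)).trans (hstep 0 (by omega) hn hi hn (by
        simp only [t]; push_cast; rw [add_smul, one_smul]; abel))
  have hall : ∀ i j, i < n → j < n →
      Reachable (𝒢.box b F n) (𝒢.shiftVertex (t 0 0) r) (𝒢.shiftVertex (t i j) r) := by
    intro i j hi
    induction j with
    | zero => exact fun _ => hrow i hi
    | succ j ih =>
      intro hj
      exact (ih (by omega)).trans (hstep 1 hi (by omega) hi hj (by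
        simp only [t]; push_cast; rw [add_smul (j : ℤ), one_smul]; abel))
  refine IsConnected.of_base (r := 𝒢.shiftVertex (t 0 0) r) (hmem hn hn hr) ?_
  rintro _ ⟨i, hi, j, hj, w, hw, rfl⟩
  exact (hall i j hi hj).trans (hin hi hj hr hw)

end PeriodicGraph

/-! ### Double counting. -/

section Counting

/-- If all the fibres over a finite set have `k` elements, so has the preimage `k` times. -/
lemma ncard_preimage_of_fibers {A B : Type*} (f : A → B) {k : ℕ} {X : Set B} (hX : X.Finite)
    (hk : k ≠ 0) (h : ∀ y, Nat.card {x // f x = y} = k) :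
    (f ⁻¹' X).Finite ∧ (f ⁻¹' X).ncard = k * X.ncard := by
  have hfib : ∀ y, {x | f x = y}.Finite := fun y => by
    have : Finite {x // f x = y} := Nat.finite_of_card_ne_zero (by rwa [h y])
    exact this
  have hfin : (f ⁻¹' X).Finite := (hX.biUnion fun y _ => hfib y).subset fun x hx =>
    Set.mem_biUnion (x := f x) hx rfl
  refine ⟨hfin, ?_⟩
  classical
  rw [Set.ncard_eq_toFinset_card _ hfin, Set.ncard_eq_toFinset_card _ hX,
    Finset.card_eq_sum_card_fiberwise (f := f) (t := hX.toFinset) (fun x hx => by simpa using hx),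
    Finset.sum_const_nat (m := k), mul_comm]
  intro y hy
  rw [← h y, ← Set.ncard_coe_finset]
  refine congrArg Set.ncard (Set.ext fun x => ?_)
  simp only [Finset.coe_filter, Set.Finite.mem_toFinset, Set.mem_preimage, Set.mem_ofPred_eq]
  exact ⟨fun hx => hx.2, fun hx => ⟨by rw [hx]; simpa using hy, hx⟩⟩

/-- Weighted double counting. -/
lemma card_mul_le_card_mul_of_weights {A B : Type*} (s : Finset A) (t : Finset B)
    (R : A → B → Prop) [∀ a b, Decidable (R a b)] (p : A → ℕ) (q : B → ℕ) {k m n : ℕ} (hk : 0 < k)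
    (hp : ∀ a ∈ s, k ^ p a ≤ (t.filter fun b => R a b).card)
    (hq : ∀ b ∈ t, (s.filter fun a => R a b).card ≤ k ^ q b)
    (hpq : ∀ a ∈ s, ∀ b ∈ t, R a b → p a + n = q b + m) :
    k ^ m * s.card ≤ k ^ n * t.card := by
  have hk0 : (0 : ℝ) < k := by exact_mod_cast hk
  -- A related pair has weight `k ^ m / k ^ p a`, which `hpq` identifies with `k ^ n / k ^ q b`.
  -- Rows then sum to at least `k ^ m` and columns to at most `k ^ n`.
  have h1 : ∀ a ∈ s, (k : ℝ) ^ m ≤ ∑ b ∈ t, if R a b then (k : ℝ) ^ m / k ^ p a else 0 := by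
    intro a ha
    rw [← Finset.sum_filter, Finset.sum_const, nsmul_eq_mul, ← mul_div_assoc,
      le_div_iff₀ (by positivity), mul_comm]
    have : ((k ^ p a : ℕ) : ℝ) ≤ (t.filter fun b => R a b).card := by exact_mod_cast hp a ha
    push_cast at this
    gcongr
  have h2 : ∀ b ∈ t, ∑ a ∈ s, (if R a b then (k : ℝ) ^ m / k ^ p a else 0) ≤ (k : ℝ) ^ n := by
    intro b hb
    rw [← Finset.sum_filter, Finset.sum_congr rfl (g := fun _ => (k : ℝ) ^ n / k ^ q b),
      Finset.sum_const, nsmul_eq_mul, ← mul_div_assoc, div_le_iff₀ (by positivity), mul_comm]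
    · have : ((s.filter fun a => R a b).card : ℝ) ≤ (k ^ q b : ℕ) := by exact_mod_cast hq b hb
      push_cast at this
      gcongr
    · intro a ha
      rw [Finset.mem_filter] at ha
      rw [div_eq_div_iff (by positivity) (by positivity), ← pow_add, ← pow_add, add_comm m,
        ← hpq a ha.1 b hb ha.2, add_comm]
  have h3 : (k : ℝ) ^ m * s.card ≤ (k : ℝ) ^ n * t.card := by
    calc (k : ℝ) ^ m * s.card = ∑ _a ∈ s, (k : ℝ) ^ m := by
          rw [Finset.sum_const, nsmul_eq_mul, mul_comm]
      _ ≤ ∑ a ∈ s, ∑ b ∈ t, if R a b then (k : ℝ) ^ m / k ^ p a else 0 := Finset.sum_le_sum h1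
      _ = ∑ b ∈ t, ∑ a ∈ s, if R a b then (k : ℝ) ^ m / k ^ p a else 0 := Finset.sum_comm
      _ ≤ ∑ _b ∈ t, (k : ℝ) ^ n := Finset.sum_le_sum h2
      _ = (k : ℝ) ^ n * t.card := by rw [Finset.sum_const, nsmul_eq_mul, mul_comm]
  exact_mod_cast h3

end Counting

/-! ### Half-edge sets and corner sets in cubic graphs. -/

namespace EmbeddedGraph

open Function

variable {G : EmbeddedGraph.{u}}

lemma card_edgeOf (e : G.Edge) : Nat.card {d // G.edgeOf d = e} = 2 := by
  obtain ⟨d, rfl⟩ := G.exists_edgeOf e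
  exact (card_mk_eq G.rev d).trans (G.minimalPeriod_rev d)

namespace IsRegular

variable (h3 : G.IsRegular 3)
include h3

lemma minimalPeriod_next (d : G.Dart) : minimalPeriod G.next d = 3 := by
  rw [← G.vertexDegree_vertexOf, h3]

lemma next_next_next (d : G.Dart) : G.next (G.next (G.next d)) = d := by
  have h := isPeriodicPt_minimalPeriod G.next d
  rw [h3.minimalPeriod_next] at h
  exact h

lemma next_ne (d : G.Dart) : G.next d ≠ d := fun h => by
  have h1 := minimalPeriod_eq_one_iff_isFixedPt.2 h
  rw [h3.minimalPeriod_next] at h1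
  omega

lemma next_next_ne (d : G.Dart) : G.next (G.next d) ≠ d := fun h => by
  have h1 := h3.next_next_next d
  rw [h] at h1
  exact h3.next_ne d h1

lemma eq_of_vertexOf_eq {d d' : G.Dart} (h : G.vertexOf d' = G.vertexOf d) :
    d' = d ∨ d' = G.next d ∨ d' = G.next (G.next d) := by
  refine (G.vertexOf_eq_iff.1 h.symm).of_invariant
    (p := fun x => x = d ∨ x = G.next d ∨ x = G.next (G.next d)) ?_ ?_ (Or.inl rfl)
  · rintro _ (rfl | rfl | rfl)
    · exact Or.inr (Or.inl rfl)
    · exact Or.inr (Or.inr rfl)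
    · exact Or.inl (h3.next_next_next _)
  · rintro _ (rfl | rfl | rfl)
    · exact Or.inr (Or.inr (by rw [Equiv.symm_apply_eq, h3.next_next_next]))
    · exact Or.inl (by rw [Equiv.symm_apply_apply])
    · exact Or.inr (Or.inl (by rw [Equiv.symm_apply_apply]))

end IsRegular

/-- `L` consists of both halves of each edge in `T` and of one half of each other edge with both
ends in `S`. -/
structure IsHalfEdgeSet (S : Set G.Vertex) (T : Set G.Edge) (L : Set G.Dart) : Prop where
  subset : ∀ d ∈ L, G.edgeOf d ∈ (G.toGraph.induce S).edgeSet
  mem : ∀ d, G.edgeOf d ∈ T → d ∈ L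
  mem_iff : ∀ d, G.edgeOf d ∈ (G.toGraph.induce S).edgeSet → G.edgeOf d ∉ T →
    (d ∈ L ↔ G.rev d ∉ L)

/-- At each vertex of a cubic graph, the corners opposite to the darts in `U` form a spanning tree
of the darts in `L`. -/
structure IsCornerSet (L U : Set G.Dart) : Prop where
  mem : ∀ x ∈ U, G.next x ∈ L ∧ G.next (G.next x) ∈ L
  of_notMem : ∀ x, x ∉ L → G.next x ∈ L → G.next (G.next x) ∈ L → x ∈ U
  of_mem : ∀ x ∈ L, G.next x ∈ L → G.next (G.next x) ∈ L →
    (x ∉ U ∧ G.next x ∈ U ∧ G.next (G.next x) ∈ U) ∨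
      (x ∈ U ∧ G.next x ∉ U ∧ G.next (G.next x) ∈ U) ∨
      (x ∈ U ∧ G.next x ∈ U ∧ G.next (G.next x) ∉ U)

variable {S : Set G.Vertex} {T : Set G.Edge} {L U : Set G.Dart}

lemma exists_edgeOf_mem_of_isSpanningTree (hS : 2 ≤ S.ncard)
    (hT : IsSpanningTree (G.toGraph.induce S) T) {v : G.Vertex} (hv : v ∈ S) :
    ∃ d, G.vertexOf d = v ∧ G.edgeOf d ∈ T := by
  by_contra! hcon
  obtain ⟨w, hw, hwv⟩ := Set.exists_ne_of_one_lt_ncard hS v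
  refine hwv ((hT.connected.2 v hv w hw).of_invariant (p := fun w => w = v) ?_ rfl)
  rintro e u w he rfl
  rw [Graph.restrict_isLink] at he
  obtain ⟨he, ⟨d, rfl, hd, rfl⟩, -⟩ := he
  exact absurd he (hcon d hd)

lemma sum_edge_darts (X : Set G.Edge) (hX : X.Finite) :
    {d | G.edgeOf d ∈ X}.Finite ∧ {d | G.edgeOf d ∈ X}.ncard = 2 * X.ncard :=
  ncard_preimage_of_fibers G.edgeOf hX two_ne_zero card_edgeOf

lemma sum_vertex_darts (h3 : G.IsRegular 3) (X : Set G.Vertex) (hX : X.Finite) :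
    {d | G.vertexOf d ∈ X}.Finite ∧ {d | G.vertexOf d ∈ X}.ncard = 3 * X.ncard :=
  ncard_preimage_of_fibers G.vertexOf hX three_ne_zero h3

/-- Inclusion-exclusion for `L` and its reversal: the union consists of all darts on induced edges,
the intersection of the darts on `T`. -/
lemma IsHalfEdgeSet.ncard (hE : (G.toGraph.induce S).edgeSet.Finite)
    (hTE : T ⊆ (G.toGraph.induce S).edgeSet) (hL : IsHalfEdgeSet S T L) :
    L.Finite ∧ L.ncard = (G.toGraph.induce S).edgeSet.ncard + T.ncard := by
  classical
  set E := (G.toGraph.induce S).edgeSet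
  obtain ⟨hDf, hD⟩ := G.sum_edge_darts E hE
  obtain ⟨hTf, hT⟩ := G.sum_edge_darts T (hE.subset hTE)
  have hLf : L.Finite := hDf.subset hL.subset
  refine ⟨hLf, ?_⟩
  have hrev : ∀ X : Set G.Dart, (G.rev ⁻¹' X).ncard = X.ncard := fun X =>
    Set.ncard_preimage_of_injective_subset_range G.rev.injective fun x _ => G.rev.surjective x
  have h1 : L ∪ G.rev ⁻¹' L = {d | G.edgeOf d ∈ E} := by
    ext d
    constructor
    · rintro (h | h)
      · exact hL.subset d h
      · have := hL.subset _ h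
        rwa [G.edgeOf_rev] at this
    · intro h
      by_cases hdT : G.edgeOf d ∈ T
      · exact Or.inl (hL.mem d hdT)
      · by_cases hd : d ∈ L
        · exact Or.inl hd
        · right
          rw [hL.mem_iff d h hdT, not_not] at hd
          exact hd
  have h2 : L ∩ G.rev ⁻¹' L = {d | G.edgeOf d ∈ T} := by
    ext d
    constructor
    · rintro ⟨h, h'⟩
      by_contra hdT
      exact (hL.mem_iff d (hL.subset d h) hdT).1 h h'
    · intro h
      refine ⟨hL.mem d h, hL.mem _ ?_⟩
      rw [G.edgeOf_rev]
      exact h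
  have h3 := Set.ncard_union_add_ncard_inter L (G.rev ⁻¹' L) hLf
    (hLf.preimage G.rev.injective.injOn)
  rw [h1, h2, hD, hT, hrev] at h3
  omega

/-- The vertices all of whose darts are in `L`. -/
def fullVertices (S : Set G.Vertex) (L : Set G.Dart) : Set G.Vertex :=
  {v ∈ S | ∀ d, G.vertexOf d = v → d ∈ L}

/-- The vertices none of whose darts is in `U`. -/
def emptyVertices (S : Set G.Vertex) (U : Set G.Dart) : Set G.Vertex :=
  {v ∈ S | ∀ d, G.vertexOf d = v → d ∉ U}

lemma vertexOf_mem_fullVertices (h3 : G.IsRegular 3) {d : G.Dart} (hd : G.vertexOf d ∈ S) :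
    G.vertexOf d ∈ fullVertices S L ↔ d ∈ L ∧ G.next d ∈ L ∧ G.next (G.next d) ∈ L := by
  constructor
  · rintro ⟨-, h⟩
    exact ⟨h _ rfl, h _ (G.vertexOf_next d), h _ (by rw [G.vertexOf_next, G.vertexOf_next])⟩
  · rintro ⟨h0, h1, h2⟩
    refine ⟨hd, fun d' hd' => ?_⟩
    rcases h3.eq_of_vertexOf_eq hd' with rfl | rfl | rfl <;> assumption

lemma vertexOf_mem_emptyVertices (h3 : G.IsRegular 3) {d : G.Dart} (hd : G.vertexOf d ∈ S) :
    G.vertexOf d ∈ emptyVertices S U ↔ d ∉ U ∧ G.next d ∉ U ∧ G.next (G.next d) ∉ U := by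
  constructor
  · rintro ⟨-, h⟩
    exact ⟨h _ rfl, h _ (G.vertexOf_next d), h _ (by rw [G.vertexOf_next, G.vertexOf_next])⟩
  · rintro ⟨h0, h1, h2⟩
    refine ⟨hd, fun d' hd' => ?_⟩
    rcases h3.eq_of_vertexOf_eq hd' with rfl | rfl | rfl <;> assumption

/-- Identities at a vertex are summed over its three darts, which triples every count. -/
lemma sum_next_indicator (h3 : G.IsRegular 3) (hS : S.Finite) (X : Set G.Dart)
    (hX : ∀ x ∈ X, G.vertexOf x ∈ S) [DecidablePred (· ∈ X)] :
    ∑ x ∈ (G.sum_vertex_darts h3 S hS).1.toFinset, ((if x ∈ X then 1 else 0) +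
      (if G.next x ∈ X then 1 else 0) + if G.next (G.next x) ∈ X then 1 else 0 : ℤ) =
      3 * X.ncard := by
  set D := (G.sum_vertex_darts h3 S hS).1.toFinset with hDdef
  have hmem : ∀ x, x ∈ D ↔ G.vertexOf x ∈ S := fun x => by simp [hDdef]
  have hnext : ∀ f : G.Dart → ℤ, ∑ x ∈ D, f (G.next x) = ∑ x ∈ D, f x := fun f =>
    Finset.sum_equiv G.next (fun x => by rw [hmem, hmem, G.vertexOf_next]) fun _ _ => rfl
  have h0 : ∑ x ∈ D, (if x ∈ X then 1 else 0 : ℤ) = X.ncard := by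
    rw [Finset.sum_boole, ← Set.ncard_coe_finset]
    congr 2
    ext x
    simp only [Finset.coe_filter, hmem, Set.mem_ofPred_eq]
    exact ⟨fun h => h.2, fun h => ⟨hX x h, h⟩⟩
  rw [Finset.sum_add_distrib, Finset.sum_add_distrib, h0,
    hnext fun x => if x ∈ X then 1 else 0,
    hnext fun x => if G.next x ∈ X then 1 else 0,
    hnext fun x => if x ∈ X then 1 else 0, h0]
  ring

lemma sum_vertex_indicator (h3 : G.IsRegular 3) (hS : S.Finite) (X : Set G.Vertex)
    (hX : X ⊆ S) [DecidablePred (· ∈ X)] :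
    ∑ x ∈ (G.sum_vertex_darts h3 S hS).1.toFinset, (if G.vertexOf x ∈ X then 1 else 0 : ℤ) =
      3 * X.ncard := by
  rw [Finset.sum_boole, ← Set.ncard_coe_finset]
  have h1 := (G.sum_vertex_darts h3 X (hS.subset hX)).2
  have h2 : (((G.sum_vertex_darts h3 S hS).1.toFinset.filter
      fun x => G.vertexOf x ∈ X : Finset G.Dart) : Set G.Dart) = {d | G.vertexOf d ∈ X} := by
    ext x
    simp only [Finset.coe_filter, Set.Finite.mem_toFinset, Set.mem_ofPred_eq]
    exact ⟨fun h => h.2, fun h => ⟨hX h, h⟩⟩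
  rw [h2, h1]
  push_cast
  ring

/-- Unless all three darts at a vertex are in `L`, the corners there are forced. -/
lemma IsCornerSet.mem_iff (hU : IsCornerSet L U) {x : G.Dart}
    (hx : ¬ (x ∈ L ∧ G.next x ∈ L ∧ G.next (G.next x) ∈ L)) :
    x ∈ U ↔ G.next x ∈ L ∧ G.next (G.next x) ∈ L :=
  ⟨fun h => hU.mem x h, fun h => hU.of_notMem x (fun h' => hx ⟨h', h⟩) h.1 h.2⟩

lemma IsRegular.exists_next_mem (h3 : G.IsRegular 3) (hne : ∀ v ∈ S, ∃ d ∈ L, G.vertexOf d = v)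
    {x : G.Dart} (hx : G.vertexOf x ∈ S) : x ∈ L ∨ G.next x ∈ L ∨ G.next (G.next x) ∈ L := by
  obtain ⟨d, hd, hdx⟩ := hne _ hx
  rcases h3.eq_of_vertexOf_eq hdx with rfl | rfl | rfl <;> simp [hd]

section CornerSet

variable (h3 : G.IsRegular 3) (hS : S.Finite)
  (hLS : ∀ x ∈ L, G.vertexOf x ∈ S) (hne : ∀ v ∈ S, ∃ d ∈ L, G.vertexOf d = v)
  (hU : IsCornerSet L U)
include h3 hU

-- A tree on `k` points has `k - 1` edges. Here `k` is the number of darts of `L` at the vertex, `k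
-- = 1` exactly when no corner is used, and `k = 3` exactly when the vertex is full.
include hne in
lemma IsCornerSet.local_count [DecidablePred (· ∈ L)] [DecidablePred (· ∈ U)]
    [DecidablePred (· ∈ fullVertices S L)] [DecidablePred (· ∈ emptyVertices S U)]
    {x : G.Dart} (hx : G.vertexOf x ∈ S) :
    ((if x ∈ U then 1 else 0) + (if G.next x ∈ U then 1 else 0) +
      (if G.next (G.next x) ∈ U then 1 else 0) + 1 : ℤ) =
      (if x ∈ L then 1 else 0) + (if G.next x ∈ L then 1 else 0) +
        (if G.next (G.next x) ∈ L then 1 else 0) ∧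
    ((if x ∈ L then 1 else 0) + (if G.next x ∈ L then 1 else 0) +
      (if G.next (G.next x) ∈ L then 1 else 0) +
      (if G.vertexOf x ∈ emptyVertices S U then 1 else 0) : ℤ) =
      2 + if G.vertexOf x ∈ fullVertices S L then 1 else 0 := by
  have e3 := h3.next_next_next x
  have hne' := h3.exists_next_mem hne hx
  have hEV := vertexOf_mem_emptyVertices (U := U) h3 hx
  have hFV := vertexOf_mem_fullVertices (L := L) h3 hx
  by_cases hf : x ∈ L ∧ G.next x ∈ L ∧ G.next (G.next x) ∈ L
  · rcases hU.of_mem x hf.1 hf.2.1 hf.2.2 with h | h | h <;> simp [hf, h, hEV, hFV]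
  · have h0 := hU.mem_iff hf
    have h1 := hU.mem_iff (x := G.next x) (by rw [e3]; tauto)
    have h2 := hU.mem_iff (x := G.next (G.next x)) (by rw [e3]; tauto)
    rw [e3] at h1 h2
    simp only [h0, h1, h2, hEV, hFV, hf]
    by_cases l0 : x ∈ L <;> by_cases l1 : G.next x ∈ L <;> by_cases l2 : G.next (G.next x) ∈ L <;>
      simp_all

include hS hLS hne in
lemma IsCornerSet.ncard_add : U.ncard + S.ncard = L.ncard := by
  classical
  have hUS : ∀ x ∈ U, G.vertexOf x ∈ S := fun x hx => by
    rw [← G.vertexOf_next]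
    exact hLS _ (hU.mem x hx).1
  have h1 := sum_next_indicator h3 hS U hUS
  have h2 := sum_next_indicator h3 hS L hLS
  have h4 : ((G.sum_vertex_darts h3 S hS).1.toFinset.card : ℤ) = 3 * S.ncard := by
    rw [← Set.ncard_eq_toFinset_card _ (G.sum_vertex_darts h3 S hS).1,
      (G.sum_vertex_darts h3 S hS).2]
    push_cast
    ring
  rw [← Finset.sum_congr rfl fun x hx => (IsCornerSet.local_count h3 hne hU (x := x)
    (by simpa using hx)).1, Finset.sum_add_distrib, h1, Finset.sum_const, nsmul_eq_mul, h4] at h2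
  omega

-- The numbers of full and of empty vertices differ by an amount that depends only on the sizes of
-- `L` and `S`; this balances the weights in the double counting.
include hS hLS hne in
lemma IsCornerSet.ncard_fullVertices_add :
    L.ncard + (emptyVertices S U).ncard = 2 * S.ncard + (fullVertices S L).ncard := by
  classical
  have h2 := sum_next_indicator h3 hS L hLS
  have h4 : ((G.sum_vertex_darts h3 S hS).1.toFinset.card : ℤ) = 3 * S.ncard := by
    rw [← Set.ncard_eq_toFinset_card _ (G.sum_vertex_darts h3 S hS).1,
      (G.sum_vertex_darts h3 S hS).2]
    push_cast
    ring
  have h5 := sum_vertex_indicator h3 hS (emptyVertices S U) fun v hv => hv.1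
  have h6 := sum_vertex_indicator h3 hS (fullVertices S L) fun v hv => hv.1
  have h7 := Finset.sum_congr (s₁ := (G.sum_vertex_darts h3 S hS).1.toFinset) rfl
    fun x hx => (IsCornerSet.local_count h3 hne hU (x := x) (by simpa using hx)).2
  rw [Finset.sum_add_distrib, h2, h5, Finset.sum_add_distrib, h6, Finset.sum_const, nsmul_eq_mul,
    h4] at h7
  omega

end CornerSet

lemma card_darts_pi (h3 : G.IsRegular 3) {W : Set G.Vertex} (hW : W.Finite) :
    Nat.card (∀ v : W, {d // G.vertexOf d = v}) = 3 ^ W.ncard := by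
  have : Fintype W := hW.fintype
  rw [Nat.card_pi, Finset.prod_congr rfl (g := fun _ => 3) fun v _ => h3 v.1, Finset.prod_const,
    Finset.card_univ, ← Nat.card_eq_fintype_card]
  rfl

lemma finite_darts_pi (h3 : G.IsRegular 3) {W : Set G.Vertex} (hW : W.Finite) :
    Finite (∀ v : W, {d // G.vertexOf d = v}) :=
  Nat.finite_of_card_ne_zero (by rw [card_darts_pi h3 hW]; positivity)

/-- At each full vertex any one of the three corners may be left out; `c` names its opposite dart.
-/
lemma three_pow_le_ncard_isCornerSet (h3 : G.IsRegular 3) (hS : S.Finite)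
    (hLS : ∀ x ∈ L, G.vertexOf x ∈ S) :
    3 ^ (fullVertices S L).ncard ≤ {U | IsCornerSet L U}.ncard := by
  have hW : (fullVertices S L).Finite := hS.subset fun v hv => hv.1
  have hD := (G.sum_vertex_darts h3 S hS).1
  have hfin : {U | IsCornerSet L U}.Finite := hD.finite_subsets.subset fun U hU x hx => by
    have h1 := hLS _ (hU.mem x hx).1
    rwa [G.vertexOf_next] at h1
  have : Finite {U | IsCornerSet L U} := hfin
  rw [← card_darts_pi h3 hW, ← Nat.card_coe_set_eq]
  let Φ : (∀ v : fullVertices S L, {d // G.vertexOf d = v}) → Set G.Dart := fun c =>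
    {x | G.next x ∈ L ∧ G.next (G.next x) ∈ L ∧ ∀ v, (c v : G.Dart) ≠ x}
  have hnot : ∀ (c : ∀ v : fullVertices S L, {d // G.vertexOf d = v}) x, x ∉ L →
      ∀ v, (c v : G.Dart) ≠ x := by
    rintro c x hx v rfl
    exact hx (v.2.2 _ (c v).2)
  have hone : ∀ (c : ∀ v : fullVertices S L, {d // G.vertexOf d = v}) x
      (hx : G.vertexOf x ∈ fullVertices S L) y, G.vertexOf y = G.vertexOf x →
      ((∀ v, (c v : G.Dart) ≠ y) ↔ (c ⟨_, hx⟩ : G.Dart) ≠ y) := by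
    intro c x hx y hy
    refine ⟨fun h => h _, ?_⟩
    rintro h v rfl
    obtain rfl : v = ⟨_, hx⟩ := Subtype.ext ((c v).2.symm.trans hy)
    exact h rfl
  refine Nat.card_le_card_of_injective (fun c => ⟨Φ c, ?_, ?_, ?_⟩) ?_
  · exact fun x hx => ⟨hx.1, hx.2.1⟩
  · exact fun x h0 h1 h2 => ⟨h1, h2, hnot c x h0⟩
  · intro x h0 h1 h2
    have hxS := hLS x h0
    have hx : G.vertexOf x ∈ fullVertices S L := (vertexOf_mem_fullVertices h3 hxS).2 ⟨h0, h1, h2⟩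
    have n1 := h3.next_ne x
    have n2 := h3.next_next_ne x
    have n3 := h3.next_ne (G.next x)
    simp only [Φ, Set.mem_ofPred_eq, h3.next_next_next, h0, h1, h2, true_and]
    rw [hone c x hx x rfl, hone c x hx _ (G.vertexOf_next x),
      hone c x hx _ (by rw [G.vertexOf_next, G.vertexOf_next])]
    rcases h3.eq_of_vertexOf_eq (c ⟨_, hx⟩).2 with h | h | h <;> rw [h]
    · simp [n1.symm, n2.symm]
    · simp [n1, n3.symm]
    · simp [n2, n3]
  · intro c c' hcc'
    have hcc : Φ c = Φ c' := congrArg Subtype.val hcc'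
    funext v
    by_contra hne
    have hv := v.2.2
    have hmem : (c v : G.Dart) ∈ Φ c' := by
      refine ⟨hv _ ?_, hv _ ?_, fun w hw => ?_⟩
      · rw [G.vertexOf_next, (c v).2]
      · rw [G.vertexOf_next, G.vertexOf_next, (c v).2]
      · obtain rfl : w = v := Subtype.ext (by rw [← (c' w).2, hw, (c v).2])
        exact hne (Subtype.ext hw.symm)
    rw [← hcc] at hmem
    exact hmem.2.2 v rfl

/-- `U` determines `L` except at the vertices without corners. There `L` has exactly one dart, which
is the one that `c` selects. -/
lemma ncard_isCornerSet_le (h3 : G.IsRegular 3) (hS : S.Finite) (𝓛 : Set (Set G.Dart))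
    (hLS : ∀ L ∈ 𝓛, ∀ x ∈ L, G.vertexOf x ∈ S)
    (hne : ∀ L ∈ 𝓛, ∀ v ∈ S, ∃ d ∈ L, G.vertexOf d = v) (U : Set G.Dart) :
    {L ∈ 𝓛 | IsCornerSet L U}.ncard ≤ 3 ^ (emptyVertices S U).ncard := by
  have hW : (emptyVertices S U).Finite := hS.subset fun v hv => hv.1
  rw [← card_darts_pi h3 hW, ← Nat.card_coe_set_eq]
  have := finite_darts_pi h3 hW
  choose c hcL hcv using hne
  refine Nat.card_le_card_of_injective (fun L => fun v : emptyVertices S U =>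
    (⟨c L.1 L.2.1 v v.2.1, hcv L.1 L.2.1 v v.2.1⟩ : {d // G.vertexOf d = v})) ?_
  have key : ∀ L (hL : L ∈ 𝓛) L' (hL' : L' ∈ 𝓛), IsCornerSet L U → IsCornerSet L' U →
      (∀ v (hv : v ∈ emptyVertices S U), c L hL v hv.1 = c L' hL' v hv.1) → L ⊆ L' := by
    intro L hL L' hL' hLU hLU' hcc x hx
    have e3 := h3.next_next_next x
    have hxS := hLS L hL x hx
    by_cases h1 : G.next x ∈ U
    · have := (hLU'.mem _ h1).2
      rwa [e3] at this
    by_cases h2 : G.next (G.next x) ∈ U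
    · have := (hLU'.mem _ h2).1
      rwa [e3] at this
    -- Now the corner opposite `x` would be the only one at its vertex, whereas three darts in `L`
    -- require two corners.
    by_cases h0 : x ∈ U
    · obtain ⟨h4, h5⟩ := hLU.mem x h0
      rcases hLU.of_mem x hx h4 h5 with h | h | h
      · exact absurd h.2.1 h1
      · exact absurd h.2.2 h2
      · exact absurd h.2.1 h1
    · have hv := (vertexOf_mem_emptyVertices h3 hxS).2 ⟨h0, h1, h2⟩
      have hc : c L hL (G.vertexOf x) hxS = x := by
        have h4 := hcL L hL _ hxS
        rcases h3.eq_of_vertexOf_eq (hcv L hL _ hxS) with h | h | h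
        · exact h
        · rw [h] at h4
          by_cases h5 : G.next (G.next x) ∈ L
          · rcases hLU.of_mem x hx h4 h5 with h | h | h
            · exact absurd h.2.1 h1
            · exact absurd h.1 h0
            · exact absurd h.1 h0
          · refine absurd (hLU.of_notMem _ h5 ?_ ?_) h2
            · rwa [e3]
            · rwa [e3]
        · rw [h] at h4
          by_cases h5 : G.next x ∈ L
          · rcases hLU.of_mem x hx h5 h4 with h | h | h
            · exact absurd h.2.1 h1
            · exact absurd h.1 h0
            · exact absurd h.1 h0
          · refine absurd (hLU.of_notMem _ h5 h4 ?_) h1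
            rwa [e3]
      have h6 := hcL L' hL' _ hxS
      rwa [← hcc _ hv, hc] at h6
  rintro ⟨L, hL, hLU⟩ ⟨L', hL', hLU'⟩ h
  have hcc : ∀ v (hv : v ∈ emptyVertices S U), c L hL v hv.1 = c L' hL' v hv.1 := fun v hv =>
    congrArg Subtype.val (congrFun h ⟨v, hv⟩)
  exact Subtype.ext ((key L hL L' hL' hLU hLU' hcc).antisymm
    (key L' hL' L hL hLU' hLU fun v hv => (hcc v hv).symm))

/-- The sets of half-edges that belong to the spanning trees of `G[S]`. -/
def halfEdgeSets (S : Set G.Vertex) : Set (Set G.Dart) :=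
  {L | ∃ T, IsSpanningTree (G.toGraph.induce S) T ∧ IsHalfEdgeSet S T L}

lemma finite_halfEdgeSets (hE : (G.toGraph.induce S).edgeSet.Finite) :
    (halfEdgeSets S).Finite :=
  (G.sum_edge_darts _ hE).1.finite_subsets.subset fun _ ⟨_, _, hL⟩ => hL.subset

/-- One half can be chosen freely for each of the `E - V + 1` edges outside a spanning tree, and the
tree is recovered as the set of edges with both halves present. -/
lemma two_pow_mul_numSpanningTrees_le (hS : S.Finite) (hE : (G.toGraph.induce S).edgeSet.Finite) :
    2 ^ ((G.toGraph.induce S).edgeSet.ncard + 1) * numSpanningTrees (G.toGraph.induce S) ≤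
      2 ^ S.ncard * (halfEdgeSets S).ncard := by
  classical
  set E := (G.toGraph.induce S).edgeSet
  have hTfin := finite_setOf_isSpanningTree hE
  have hLfin := G.finite_halfEdgeSets hE
  let t : Set G.Dart → Set G.Edge := fun L => {e ∈ E | ∀ d, G.edgeOf d = e → d ∈ L}
  have ht : ∀ {T L}, T ⊆ E → IsHalfEdgeSet S T L → t L = T := by
    intro T L hTE hL
    ext e
    constructor
    · rintro ⟨heE, he⟩
      obtain ⟨d, rfl⟩ := G.exists_edgeOf e
      by_contra hdT
      exact (hL.mem_iff d heE hdT).1 (he d rfl) (he _ (G.edgeOf_rev d))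
    · intro he
      exact ⟨hTE he, fun d hd => hL.mem d (by rwa [hd])⟩
  have hmaps : ∀ L ∈ hLfin.toFinset, t L ∈ hTfin.toFinset := by
    intro L hL
    obtain ⟨T, hT, hTL⟩ := hLfin.mem_toFinset.1 hL
    rw [ht hT.subset hTL]
    exact hTfin.mem_toFinset.2 hT
  have hfiber : ∀ T ∈ hTfin.toFinset,
      2 ^ (E.ncard + 1) ≤ 2 ^ S.ncard * (hLfin.toFinset.filter fun L => t L = T).card := by
    intro T hT
    have hT' : IsSpanningTree (G.toGraph.induce S) T := hTfin.mem_toFinset.1 hT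
    have hTE : T ⊆ E := hT'.subset
    have hTf := hE.subset hTE
    have hcard := ((isSpanningTree_iff hS hTf).1 hT').2.2
    rw [Graph.vertexSet_induce] at hcard
    -- `o` fixes a reference half of each edge; `A` is the set of edges outside `T` for which that
    -- half is taken.
    let o : G.Edge → G.Dart := fun e => (G.exists_edgeOf e).choose
    have ho : ∀ e, G.edgeOf (o e) = e := fun e => (G.exists_edgeOf e).choose_spec
    let Ψ : Set G.Edge → Set G.Dart := fun A =>
      {d | G.edgeOf d ∈ E ∧ (G.edgeOf d ∈ T ∨ (G.edgeOf d ∈ A ↔ d = o (G.edgeOf d)))}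
    have hΨ : ∀ A, IsHalfEdgeSet S T (Ψ A) := by
      refine fun A => ⟨fun d hd => hd.1, fun d hd => ⟨hTE hd, Or.inl hd⟩, fun d hd hdT => ?_⟩
      have h1 : ¬ (d = o (G.edgeOf d) ↔ G.rev d = o (G.edgeOf d)) := by
        rcases G.edgeOf_eq_iff.1 (ho (G.edgeOf d)).symm with h | h
        · rw [h]
          simp [G.rev_ne d]
        · rw [h]
          simp [(G.rev_ne d).symm]
      simp only [Ψ, Set.mem_ofPred_eq, G.edgeOf_rev, hdT, false_or]
      tauto
    have h1 : (𝒫 (E \ T)).ncard ≤ (hLfin.toFinset.filter fun L => t L = T).card := by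
      rw [← Set.ncard_coe_finset]
      refine Set.ncard_le_ncard_of_injOn Ψ (fun A _ => ?_) ?_
      · rw [Finset.coe_filter]
        exact ⟨hLfin.mem_toFinset.2 ⟨T, hT', hΨ A⟩, ht hTE (hΨ A)⟩
      · have key : ∀ A ⊆ E \ T, ∀ A', Ψ A = Ψ A' → A ⊆ A' := by
          intro A hA A' hAA' e he
          have h2 : o e ∈ Ψ A := by
            refine ⟨by rw [ho]; exact (hA he).1, Or.inr ?_⟩
            rw [ho]
            exact ⟨fun _ => rfl, fun _ => he⟩
          rw [hAA'] at h2
          have h3 := h2.2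
          rw [ho] at h3
          exact (h3.resolve_left (hA he).2).2 rfl
        exact fun A hA A' hA' h => (key A hA A' h).antisymm (key A' hA' A h.symm)
    rw [Set.ncard_powerset _ (hE.subset Set.sdiff_subset), Set.ncard_sdiff hTE hTf] at h1
    have h2 : T.ncard ≤ E.ncard := Set.ncard_le_ncard hTE hE
    calc 2 ^ (E.ncard + 1) = 2 ^ S.ncard * 2 ^ (E.ncard - T.ncard) := by
          rw [← pow_add]
          congr 1
          omega
      _ ≤ _ := Nat.mul_le_mul_left _ h1
  unfold numSpanningTrees
  rw [Set.ncard_eq_toFinset_card _ hTfin, Set.ncard_eq_toFinset_card _ hLfin,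
    Finset.card_eq_sum_card_fiberwise hmaps, Finset.mul_sum, mul_comm, ← smul_eq_mul]
  exact Finset.card_nsmul_le_sum _ _ _ hfiber

end EmbeddedGraph

/-! ### The star-triangle transformation to the medial graph. -/

namespace PeriodicGraph

open Function EmbeddedGraph

variable (𝒢 : PeriodicGraph.{u})

/-- The vertex of the medial graph at the midpoint of an edge. -/
def midpoint (e : 𝒢.Edge) : 𝒢.medial.Vertex :=
  Quotient.liftOn e (fun d => 𝒢.medial.vertexOf (𝒢.mdart d true)) fun d d' h => by
    rcases 𝒢.edgeOf_eq_iff.1 (Quotient.sound (s := Equiv.Perm.SameCycle.setoid 𝒢.rev) h) with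
      rfl | rfl
    · rfl
    · rw [← medial_next_false, vertexOf_next, ← medial_next_true, vertexOf_next]

lemma vertexOf_mdart (d : 𝒢.Dart) (b : Bool) :
    𝒢.medial.vertexOf (𝒢.mdart d b) = 𝒢.midpoint (𝒢.edgeOf d) := by
  cases b with
  | true => rfl
  | false => rw [← medial_next_true, vertexOf_next]; rfl

lemma midpoint_injective : Injective 𝒢.midpoint := by
  intro e e' h
  obtain ⟨d, rfl⟩ := 𝒢.exists_edgeOf e
  obtain ⟨d', rfl⟩ := 𝒢.exists_edgeOf e'
  rw [← 𝒢.vertexOf_mdart d true, ← 𝒢.vertexOf_mdart d' true, vertexOf_eq_iff] at h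
  obtain ⟨x, b, hx, hxe⟩ := h.of_invariant
    (p := fun y => ∃ x b, y = 𝒢.mdart x b ∧ 𝒢.edgeOf x = 𝒢.edgeOf d) (by
      rintro _ ⟨x, b, rfl, hx⟩
      cases b
      · exact ⟨_, _, 𝒢.medial_next_false x, (𝒢.edgeOf_rev x).trans hx⟩
      · exact ⟨_, _, 𝒢.medial_next_true x, hx⟩) (by
      rintro _ ⟨x, b, rfl, hx⟩
      cases b
      · exact ⟨_, _, 𝒢.medial_next_symm_false x, hx⟩
      · exact ⟨_, _, 𝒢.medial_next_symm_true x, (𝒢.edgeOf_rev x).trans hx⟩) ⟨d, true, rfl, rfl⟩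
  rw [← hxe, (mdart_inj.1 hx).1]

lemma shiftVertex_midpoint (a : ℤ × ℤ) (e : 𝒢.Edge) :
    𝒢.medial.shiftVertex a (𝒢.midpoint e) = 𝒢.midpoint (𝒢.shiftEdge a e) := by
  obtain ⟨d, rfl⟩ := 𝒢.exists_edgeOf e
  rw [← 𝒢.vertexOf_mdart d true, shiftVertex_vertexOf, medial_shift, vertexOf_mdart,
    shiftEdge_edgeOf]

/-- The medial edge in the corner between `next x` and `next (next x)`, which is opposite to the
dart `x` if the graph is cubic. -/
def corner (x : 𝒢.Dart) : 𝒢.medial.Edge := 𝒢.medial.edgeOf (𝒢.mdart (𝒢.next x) true)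

lemma corner_injective : Injective 𝒢.corner := by
  intro x y h
  rcases 𝒢.medial.edgeOf_eq_iff.1 h with h | h
  · exact (𝒢.next.injective (mdart_inj.1 h).1).symm
  · rw [medial_rev_true] at h
    exact absurd (mdart_inj.1 h).2 (by simp)

lemma isLink_corner (x : 𝒢.Dart) : 𝒢.medial.toGraph.IsLink (𝒢.corner x)
    (𝒢.midpoint (𝒢.edgeOf (𝒢.next x))) (𝒢.midpoint (𝒢.edgeOf (𝒢.next (𝒢.next x)))) := by
  have h := 𝒢.medial.toGraph_isLink (𝒢.mdart (𝒢.next x) true)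
  rwa [medial_rev_true, vertexOf_mdart, vertexOf_mdart] at h

/-- The vertices of the medial graph on the edges of the subgraph induced on `S`. -/
def medialVertices (S : Set 𝒢.Vertex) : Set 𝒢.medial.Vertex :=
  𝒢.midpoint '' (𝒢.toGraph.induce S).edgeSet

variable {𝒢} {S : Set 𝒢.Vertex} {T : Set 𝒢.Edge} {L U : Set 𝒢.Dart}

/-- Replacing each star of `L` by a tree on the same midpoints keeps everything connected. Since
`|U| = |L| - |S| = E - 1` and there are `E` midpoints, `U` gives a spanning tree. -/
lemma isSpanningTree_corner (h3 : 𝒢.IsRegular 3) (hS : S.Finite)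
    (hE : (𝒢.toGraph.induce S).edgeSet.Finite) (hS2 : 2 ≤ S.ncard)
    (hT : IsSpanningTree (𝒢.toGraph.induce S) T) (hL : IsHalfEdgeSet S T L)
    (hU : IsCornerSet L U) :
    IsSpanningTree (𝒢.medial.toGraph.induce (𝒢.medialVertices S)) (𝒢.corner '' U) := by
  have hTf := hE.subset hT.subset
  have hTcard := ((isSpanningTree_iff hS hTf).1 hT).2.2
  rw [Graph.vertexSet_induce] at hTcard
  obtain ⟨hLf, hLcard⟩ := hL.ncard hE hT.subset
  have hLS : ∀ x ∈ L, 𝒢.vertexOf x ∈ S := fun x hx =>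
    (EmbeddedGraph.edgeOf_mem_edgeSet_induce.1 (hL.subset x hx)).1
  have hne : ∀ v ∈ S, ∃ d ∈ L, 𝒢.vertexOf d = v := fun v hv => by
    obtain ⟨d, hd, hdT⟩ := exists_edgeOf_mem_of_isSpanningTree hS2 hT hv
    exact ⟨d, hL.mem d hdT, hd⟩
  have hUcard := hU.ncard_add h3 hS hLS hne
  have hUf : U.Finite := (sum_vertex_darts h3 S hS).1.subset fun x hx => by
    have h1 := hLS _ (hU.mem x hx).1
    rwa [vertexOf_next] at h1
  have hmS : ∀ x ∈ L, 𝒢.midpoint (𝒢.edgeOf x) ∈ 𝒢.medialVertices S := fun x hx =>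
    ⟨_, hL.subset x hx, rfl⟩
  let R : 𝒢.Dart → 𝒢.Dart → Prop := fun x y =>
    Reachable ((𝒢.medial.toGraph.induce (𝒢.medialVertices S)).restrict (𝒢.corner '' U))
      (𝒢.midpoint (𝒢.edgeOf x)) (𝒢.midpoint (𝒢.edgeOf y))
  have hR : ∀ x ∈ U, R (𝒢.next x) (𝒢.next (𝒢.next x)) := fun x hx =>
    .of_isLink (e := 𝒢.corner x) (by
      rw [Graph.restrict_isLink, Graph.induce_isLink]
      exact ⟨⟨x, hx, rfl⟩, 𝒢.isLink_corner x, hmS _ (hU.mem x hx).1, hmS _ (hU.mem x hx).2⟩)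
  have hpair : ∀ x ∈ L, 𝒢.next x ∈ L → R x (𝒢.next x) := by
    intro x hx hx'
    have e3 := h3.next_next_next x
    have hopp : 𝒢.next (𝒢.next x) ∈ U → R x (𝒢.next x) := fun h => by
      have := hR _ h
      rwa [e3] at this
    by_cases h2 : 𝒢.next (𝒢.next x) ∈ L
    · rcases hU.of_mem x hx hx' h2 with h | h | h
      · exact hopp h.2.2
      · exact hopp h.2.2
      · have h4 := hR _ h.2.1
        rw [e3] at h4
        exact h4.symm.trans (hR _ h.1).symm
    · exact hopp (hU.of_notMem _ h2 (by rwa [e3]) (by rwa [e3]))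
  have hvert : ∀ x ∈ L, ∀ y ∈ L, 𝒢.vertexOf y = 𝒢.vertexOf x → R x y := by
    intro x hx y hy hxy
    rcases h3.eq_of_vertexOf_eq hxy with rfl | rfl | rfl
    · exact .refl
    · exact hpair x hx hy
    · have h4 := hpair _ hy (by rwa [h3.next_next_next])
      rw [h3.next_next_next] at h4
      exact h4.symm
  obtain ⟨v, hv⟩ := hT.connected.1
  obtain ⟨x, hx, hxv⟩ := hne v hv
  have hall : ∀ y ∈ L, R x y := by
    intro y hy
    refine (hT.connected.2 v hv _ (hLS y hy)).of_invariant
      (p := fun w => ∀ y ∈ L, 𝒢.vertexOf y = w → R x y) ?_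
      (fun y hy hyv => hvert x hx y hy (hyv.trans hxv.symm)) y hy rfl
    rintro e _ _ he hp y hy hyv
    rw [Graph.restrict_isLink, Graph.induce_isLink] at he
    obtain ⟨heT, ⟨d, rfl, rfl, rfl⟩, -⟩ := he
    have h1 := hp d (hL.mem d heT) rfl
    have h2 := hvert _ (hL.mem (𝒢.rev d) (by rwa [𝒢.edgeOf_rev])) y hy hyv
    simp only [R, 𝒢.edgeOf_rev] at h1 h2
    exact h1.trans h2
  refine (isSpanningTree_iff (hE.image _) (hUf.image _)).2 ⟨?_, ?_, ?_⟩
  · rintro _ ⟨y, hy, rfl⟩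
    exact ⟨_, _, 𝒢.isLink_corner y, hmS _ (hU.mem y hy).1, hmS _ (hU.mem y hy).2⟩
  · refine IsConnected.of_base (r := 𝒢.midpoint (𝒢.edgeOf x)) (hmS x hx) ?_
    rintro _ ⟨e, he, rfl⟩
    obtain ⟨d, rfl⟩ := 𝒢.exists_edgeOf e
    by_cases hdT : 𝒢.edgeOf d ∈ T
    · exact hall d (hL.mem d hdT)
    · by_cases hd : d ∈ L
      · exact hall d hd
      · rw [hL.mem_iff d he hdT, not_not] at hd
        have h1 := hall _ hd
        simp only [R, 𝒢.edgeOf_rev] at h1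
        exact h1
  · rw [Set.ncard_image_of_injective _ 𝒢.corner_injective, Graph.vertexSet_induce, medialVertices,
      Set.ncard_image_of_injective _ 𝒢.midpoint_injective]
    omega

/-- Each spanning tree of a finite induced subgraph of a cubic graph gives rise to many spanning
trees of the medial graph (star-triangle transformation). -/
lemma pow_mul_numSpanningTrees_le_medial (h : 𝒢.IsPlanarLatticeGraph) (h3 : 𝒢.IsRegular 3)
    (hS : S.Finite) (hS2 : 2 ≤ S.ncard) :
    3 ^ (𝒢.toGraph.induce S).edgeSet.ncard * (2 ^ ((𝒢.toGraph.induce S).edgeSet.ncard + 1) *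
        numSpanningTrees (𝒢.toGraph.induce S)) ≤
      3 ^ (S.ncard + 1) * (2 ^ S.ncard *
        numSpanningTrees (𝒢.medial.toGraph.induce (𝒢.medialVertices S))) := by
  classical
  have hE := 𝒢.finite_edgeSet_induce h hS
  have hLfin := EmbeddedGraph.finite_halfEdgeSets (G := 𝒢.toEmbeddedGraph) hE
  have hLS : ∀ L ∈ halfEdgeSets S, ∀ x ∈ L, 𝒢.vertexOf x ∈ S := by
    rintro L ⟨T, -, hL⟩ x hx
    exact (EmbeddedGraph.edgeOf_mem_edgeSet_induce.1 (hL.subset x hx)).1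
  have hne : ∀ L ∈ halfEdgeSets S, ∀ v ∈ S, ∃ d ∈ L, 𝒢.vertexOf d = v := by
    rintro L ⟨T, hT, hL⟩ v hv
    obtain ⟨d, hd, hdT⟩ := exists_edgeOf_mem_of_isSpanningTree hS2 hT hv
    exact ⟨d, hL.mem d hdT, hd⟩
  set 𝓤 : Set (Set 𝒢.Dart) := {U | ∃ L ∈ halfEdgeSets S, IsCornerSet L U} with h𝓤
  have htree : ∀ U ∈ 𝓤, IsSpanningTree (𝒢.medial.toGraph.induce (𝒢.medialVertices S))
      (𝒢.corner '' U) := by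
    rintro U ⟨L, ⟨T, hT, hL⟩, hU⟩
    exact isSpanningTree_corner h3 hS hE hS2 hT hL hU
  have hUfin : 𝓤.Finite := (sum_vertex_darts h3 S hS).1.finite_subsets.subset (by
    rintro U ⟨L, hL, hU⟩ x hx
    have h1 := hLS L hL _ (hU.mem x hx).1
    rwa [vertexOf_next] at h1)
  have hfin' := finite_setOf_isSpanningTree (𝒢.medial.finite_edgeSet_induce
    (𝒢.isPlanarLatticeGraph_medial h) (S := 𝒢.medialVertices S) (hE.image _))
  have hUle : 𝓤.ncard ≤ numSpanningTrees (𝒢.medial.toGraph.induce (𝒢.medialVertices S)) :=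
    Set.ncard_le_ncard_of_injOn (fun U => 𝒢.corner '' U) htree
      𝒢.corner_injective.image_injective.injOn hfin'
  have h1 := two_pow_mul_numSpanningTrees_le hS hE
  -- The balance condition reads `full + (V + 1) = empty + E`, which follows from `|L| = E + V - 1`
  -- and `|L| + empty = 2 V + full`.
  have h2 := card_mul_le_card_mul_of_weights hLfin.toFinset hUfin.toFinset IsCornerSet
    (fun L => (fullVertices S L).ncard) (fun U => (emptyVertices S U).ncard) (k := 3)
    (m := (𝒢.toGraph.induce S).edgeSet.ncard) (n := S.ncard + 1) (by norm_num)
    (fun L hL => ?_) (fun U hU => ?_) (fun L hL U hU hLU => ?_)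
  · rw [← Set.ncard_eq_toFinset_card _ hLfin, ← Set.ncard_eq_toFinset_card _ hUfin] at h2
    calc _ ≤ 3 ^ (𝒢.toGraph.induce S).edgeSet.ncard * (2 ^ S.ncard *
          (halfEdgeSets S).ncard) := Nat.mul_le_mul_left _ h1
      _ = 2 ^ S.ncard * (3 ^ (𝒢.toGraph.induce S).edgeSet.ncard * (halfEdgeSets S).ncard) := by
          ring
      _ ≤ 2 ^ S.ncard * (3 ^ (S.ncard + 1) *
          numSpanningTrees (𝒢.medial.toGraph.induce (𝒢.medialVertices S))) :=
          Nat.mul_le_mul_left _ (h2.trans (Nat.mul_le_mul_left _ hUle))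
      _ = _ := by ring
  · rw [Set.Finite.mem_toFinset] at hL
    refine (three_pow_le_ncard_isCornerSet h3 hS (hLS L hL)).trans_eq ?_
    rw [← Set.ncard_coe_finset]
    refine congrArg Set.ncard (Set.ext fun U => ?_)
    simp only [Finset.coe_filter, Set.Finite.mem_toFinset, Set.mem_ofPred_eq]
    exact ⟨fun hU => ⟨⟨L, hL, hU⟩, hU⟩, fun hU => hU.2⟩
  · refine Eq.trans_le ?_ (ncard_isCornerSet_le h3 hS (halfEdgeSets S) hLS hne U)
    rw [← Set.ncard_coe_finset]
    refine congrArg Set.ncard (Set.ext fun L => ?_)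
    simp only [Finset.coe_filter, Set.Finite.mem_toFinset, Set.mem_ofPred_eq]
  · rw [Set.Finite.mem_toFinset] at hL
    have h4 := hLU.ncard_fullVertices_add h3 hS (hLS L hL) (hne L hL)
    obtain ⟨T, hT, hL⟩ := hL
    have hTcard := ((isSpanningTree_iff hS (hE.subset hT.subset)).1 hT).2.2
    rw [Graph.vertexSet_induce] at hTcard
    have h5 := (hL.ncard hE hT.subset).2
    omega

end PeriodicGraph

/-! ### The numerical bound for the octahedron. -/

section

open Real

/-- Combines `sin t ≥ t - t³/6` with `log (1 - u) ≥ -u / (1 - u)` for `u = t²/6`. The constant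
`3/16` is valid while `u ≤ 1/9`, hence up to `4/5`, which exceeds `π / 4`. -/
lemma log_two_mul_sin_ge {t : ℝ} (h0 : 0 < t) (h1 : t ≤ 4 / 5) :
    log 2 + log t - 3 / 16 * t ^ 2 ≤ log |2 * sin t| := by
  have hs := sin_ge_sub_cube h0.le
  have ht2 : t ^ 2 ≤ 16 / 25 := by nlinarith
  have hu : (0 : ℝ) < 1 - t ^ 2 / 6 := by nlinarith
  have hl : -(3 / 16 * t ^ 2) ≤ log (1 - t ^ 2 / 6) := by
    refine le_trans ?_ (one_sub_inv_le_log_of_pos hu)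
    rw [neg_le, neg_sub, sub_le_iff_le_add, inv_le_iff_one_le_mul₀ hu]
    nlinarith [mul_nonneg (sq_nonneg t) (sub_nonneg.2 ht2)]
  have hm : 2 * (t * (1 - t ^ 2 / 6)) ≤ 2 * sin t := by nlinarith
  have hp : 0 < 2 * (t * (1 - t ^ 2 / 6)) := by positivity
  have := log_le_log hp hm
  rw [log_mul two_ne_zero (by positivity), log_mul h0.ne' hu.ne'] at this
  rw [log_abs]
  linarith

lemma integral_log_two_mul_sin_ge {a : ℝ} (h0 : 0 < a) (h1 : a ≤ 4 / 5) :
    a * (log (2 * a) - 1 - a ^ 2 / 16) ≤ ∫ t in (0 : ℝ)..a, log |2 * sin t| := by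
  have hi1 : IntervalIntegrable (fun t : ℝ => log 2 + log t) MeasureTheory.volume 0 a :=
    intervalIntegrable_const.add intervalIntegral.intervalIntegrable_log'
  have hi2 : IntervalIntegrable (fun t : ℝ => 3 / 16 * t ^ 2) MeasureTheory.volume 0 a :=
    Continuous.intervalIntegrable (by fun_prop) _ _
  have hs : IntervalIntegrable (fun t : ℝ => log |2 * sin t|) MeasureTheory.volume 0 a := by
    have h : IntervalIntegrable (fun t : ℝ => log 2 + log (sin t)) MeasureTheory.volume 0 a :=
      intervalIntegrable_const.add intervalIntegrable_log_sin
    refine h.congr fun t ht => ?_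
    rw [Set.uIoc_of_le h0.le] at ht
    have : 0 < sin t := sin_pos_of_pos_of_lt_pi ht.1 (by linarith [ht.2, pi_gt_three])
    simp only [log_abs]
    rw [log_mul two_ne_zero this.ne']
  have hm := intervalIntegral.integral_mono_on_of_le_Ioo h0.le (hi1.sub hi2) hs
    fun t ht => log_two_mul_sin_ge ht.1 (ht.2.le.trans h1)
  refine le_trans (le_of_eq ?_) hm
  rw [intervalIntegral.integral_sub hi1 hi2, intervalIntegral.integral_add
    intervalIntegrable_const intervalIntegral.intervalIntegrable_log', integral_log,
    intervalIntegral.integral_const_mul, integral_pow, intervalIntegral.integral_const,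
    log_mul two_ne_zero h0.ne', smul_eq_mul, log_zero]
  norm_num
  ring

/-- By the integral bound with `a = π / 4` it suffices that `3 + 3 a²/16 < log 6 + 3 log (π/2)`; the
left side is below `3.117`, the right side above `3.12`. -/
lemma bipyramidVol_four_lt : bipyramidVol 4 < 2 * π / 3 * log 6 := by
  unfold bipyramidVol lobachevsky
  have hp := pi_gt_d2
  have hp' := pi_lt_d2
  have ha := integral_log_two_mul_sin_ge (a := π / 4) (by positivity) (by linarith)
  have hlog : 3.12 < log 6 + 3 * log (2 * (π / 4)) := by
    rw [← log_rpow (by positivity), ← log_mul (by norm_num) (by positivity),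
      lt_log_iff_exp_lt (by positivity)]
    -- This bound is below `23`, while `6 · 1.57³` is above `23`.
    have h1 : exp 3.12 ≤ 2.7182818286 ^ 3 * (1 / (1 - 0.12)) := by
      rw [show (3.12 : ℝ) = 1 + 1 + 1 + 0.12 by norm_num, exp_add, exp_add, exp_add]
      have h2 : exp 0.12 ≤ 1 / (1 - 0.12) :=
        exp_bound_div_one_sub_of_interval (by norm_num) (by norm_num)
      calc exp 1 * exp 1 * exp 1 * exp 0.12 = exp 1 ^ 3 * exp 0.12 := by ring
        _ ≤ _ := by gcongr; exact exp_one_lt_d9.le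
    have h3 : (1.57 : ℝ) ^ (3 : ℝ) ≤ (2 * (π / 4)) ^ (3 : ℝ) := by gcongr; linarith
    norm_num at h3 h1 ⊢
    linarith
  have hq : (π / 4) ^ 2 / 16 < 0.039 := by nlinarith
  have h : -(1 / 3 * log 6) < log (2 * (π / 4)) - 1 - (π / 4) ^ 2 / 16 := by linarith
  have h' := (mul_lt_mul_of_pos_left h (show 0 < π / 4 by positivity)).trans_le ha
  push_cast
  linarith

end

/-! ### Comparison of the two entropies. -/

namespace PeriodicGraph

open Function EmbeddedGraph

variable {𝒢 : PeriodicGraph.{u}}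

lemma card_quotient_vertex (h : 𝒢.IsPlanarLatticeGraph) (h3 : 𝒢.IsRegular 3) :
    (Nat.card 𝒢.quotient.Vertex : ℝ) = Nat.card 𝒢.quotient.Dart / 3 := by
  have := h.quotientFinite
  have : Fintype 𝒢.quotient.Dart := Fintype.ofFinite _
  rw [card_vertex_eq_sum, Nat.card_eq_fintype_card,
    Finset.sum_congr rfl fun x _ => by rw [minimalPeriod_quotient_next_of_isRegular 𝒢 h h3 x]]
  simp [div_eq_mul_inv]

lemma card_medial_quotient_vertex (h : 𝒢.IsPlanarLatticeGraph) :
    (Nat.card 𝒢.medial.quotient.Vertex : ℝ) = Nat.card 𝒢.quotient.Dart / 2 := by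
  have := h.quotientFinite
  have := 𝒢.finite_medial_quotient h.quotientFinite
  have : Fintype 𝒢.quotient.Dart := Fintype.ofFinite _
  have : Fintype 𝒢.medial.quotient.Dart := Fintype.ofFinite _
  rw [card_vertex_eq_sum, Nat.card_eq_fintype_card]
  simp only [minimalPeriod_medial_quotient_next, Finset.sum_const, Finset.card_univ, nsmul_eq_mul,
    card_medial_quotient]
  push_cast
  ring

/-- Only boundedly many edges per unit of boundary length leave a box. -/
lemma IsFundamental.exists_le_two_mul_ncard_edgeSet (h : 𝒢.IsPlanarLatticeGraph)
    {F : Set 𝒢.Vertex} (hF : IsFundamental F) (b : Module.Basis (Fin 2) ℤ (ℤ × ℤ)) :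
    ∃ R : ℕ, ∀ n, n ^ 2 * Nat.card 𝒢.quotient.Dart ≤
      2 * (𝒢.box b F (n + 2 * R)).edgeSet.ncard := by
  have := h.quotientFinite
  obtain ⟨R, hR⟩ := exists_repr_bound b hF.voltage (Set.finite_univ (α := 𝒢.quotient.Dart))
  refine ⟨R, fun n => ?_⟩
  have hfin := 𝒢.finite_edgeSet_induce h (finite_boxVertices (b := b) (hF.finite h) (n + 2 * R))
  obtain ⟨hX, hcard⟩ := 𝒢.sum_edge_darts _ hfin
  rw [← hF.ncard_darts_box b n, box, ← hcard]
  -- `R` bounds the coordinates of all voltages, so a dart that starts in the box of side `n`,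
  -- translated by `t`, has both ends in the box of side `n + 2 * R`.
  set t : ℤ × ℤ := (R : ℤ) • b 0 + (R : ℤ) • b 1 with ht
  have htr : ∀ i, b.repr t i = R := by
    intro i
    fin_cases i
    · exact (repr_lattice b R R).1
    · exact (repr_lattice b R R).2
  refine Set.ncard_le_ncard_of_injOn (𝒢.shift t) (fun d hd => ?_)
    (𝒢.shift_injective t).injOn hX
  change 𝒢.vertexOf d ∈ 𝒢.boxVertices b F n at hd
  change 𝒢.edgeOf _ ∈ (𝒢.toGraph.induce _).edgeSet
  rw [edgeOf_mem_edgeSet_induce, ← 𝒢.shift_rev, ← shiftVertex_vertexOf, ← shiftVertex_vertexOf,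
    hF.mem_boxVertices_iff, hF.mem_boxVertices_iff]
  rw [hF.mem_boxVertices_iff] at hd
  simp only [hF.coord_shiftVertex, map_add, Finsupp.add_apply, htr]
  push_cast
  refine ⟨fun i => ?_, fun i => ?_⟩
  · have := hd i
    omega
  · have h1 := hd i
    have h2 := abs_le.1 (hR (𝒢.proj d) trivial i)
    rw [hF.voltage_proj, map_sub, Finsupp.sub_apply] at h2
    omega

/-- Edges induced on `S` start in `S`, so a translation that takes one such edge to another takes a
vertex of `S` into `S`. Thus the packing bound applies to the medial vertices with the same `m`. -/
lemma eq_zero_of_mem_medialVertices {S : Set 𝒢.Vertex} {m : ℕ}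
    (hS : ∀ a : ℤ × ℤ, ∀ v ∈ S, 𝒢.shiftVertex ((m : ℤ) • a) v ∈ S → a = 0) (a : ℤ × ℤ) :
    ∀ v ∈ 𝒢.medialVertices S, 𝒢.medial.shiftVertex ((m : ℤ) • a) v ∈ 𝒢.medialVertices S →
      a = 0 := by
  rintro _ ⟨e, he, rfl⟩ ⟨e', he', heq⟩
  obtain ⟨d, rfl⟩ := 𝒢.exists_edgeOf e
  rw [shiftVertex_midpoint, shiftEdge_edgeOf] at heq
  rw [𝒢.midpoint_injective heq] at he'
  refine hS a _ (edgeOf_mem_edgeSet_induce.1 he).1 ?_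
  rw [shiftVertex_vertexOf]
  exact (edgeOf_mem_edgeSet_induce.1 he').1

/-- The logarithmic form of `pow_mul_numSpanningTrees_le_medial`. -/
lemma log_numSpanningTrees_le_medial (h : 𝒢.IsPlanarLatticeGraph) (h3 : 𝒢.IsRegular 3)
    {S : Set 𝒢.Vertex} (hS : S.Finite) (hS2 : 2 ≤ S.ncard)
    (hc : IsConnected (𝒢.toGraph.induce S)) :
    (((𝒢.toGraph.induce S).edgeSet.ncard : ℝ) - S.ncard) * Real.log 6 - Real.log 3 +
        Real.log (numSpanningTrees (𝒢.toGraph.induce S)) ≤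
      Real.log (numSpanningTrees (𝒢.medial.toGraph.induce (𝒢.medialVertices S))) := by
  have hpos := hc.numSpanningTrees_pos (𝒢.finite_edgeSet_induce h hS)
  have hle := pow_mul_numSpanningTrees_le_medial h h3 hS hS2
  set E := (𝒢.toGraph.induce S).edgeSet.ncard
  set τ := numSpanningTrees (𝒢.toGraph.induce S)
  set τ' := numSpanningTrees (𝒢.medial.toGraph.induce (𝒢.medialVertices S))
  have hpos' : 0 < τ' := by
    refine Nat.pos_of_ne_zero fun h0 => ?_
    rw [h0, Nat.mul_zero, Nat.mul_zero] at hle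
    exact absurd hle (not_le.2 (by positivity))
  have hτ : (τ : ℝ) ≠ 0 := by exact_mod_cast hpos.ne'
  have hτ' : (τ' : ℝ) ≠ 0 := by exact_mod_cast hpos'.ne'
  have hlog := Real.log_le_log (x := ((3 : ℝ) ^ E * (2 ^ (E + 1) * τ)))
    (y := (3 : ℝ) ^ (S.ncard + 1) * (2 ^ S.ncard * τ')) (by positivity) (by exact_mod_cast hle)
  rw [Real.log_mul (by positivity) (by positivity), Real.log_mul (by positivity) hτ,
    Real.log_mul (by positivity) (by positivity), Real.log_mul (by positivity) hτ', Real.log_pow,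
    Real.log_pow, Real.log_pow, Real.log_pow] at hlog
  have h6 : Real.log 6 = Real.log 2 + Real.log 3 := by
    rw [← Real.log_mul two_ne_zero three_ne_zero]
    norm_num
  have h2 := Real.log_nonneg one_le_two
  push_cast at hlog
  rw [h6]
  linarith

/-- A cubic planar lattice graph and its medial graph have spanning tree entropies, and the latter
is bounded below in terms of the former. -/
theorem exists_hasSpanningTreeEntropy_medial (h : 𝒢.IsPlanarLatticeGraph) (h3 : 𝒢.IsRegular 3) :
    ∃ z z' : ℝ, 𝒢.HasSpanningTreeEntropy z ∧ 𝒢.medial.HasSpanningTreeEntropy z' ∧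
      2 * z + Real.log 6 ≤ 3 * z' := by
  have h' := 𝒢.isPlanarLatticeGraph_medial h
  obtain ⟨z, hz, -⟩ := 𝒢.exists_hasSpanningTreeEntropy h (exists_isExhaustion h)
  obtain ⟨z', hz', hbound⟩ := 𝒢.medial.exists_hasSpanningTreeEntropy h' (exists_isExhaustion h')
  refine ⟨z, z', hz, hz', ?_⟩
  obtain ⟨b, F, hF⟩ := hz.1
  have hF0 : IsFundamental F := hF.fundamental
  have hK := card_quotient_vertex h h3
  have hK' := card_medial_quotient_vertex h
  have hDpos : (0 : ℝ) < Nat.card 𝒢.quotient.Dart := by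
    have := h.quotientFinite
    have : Nonempty 𝒢.quotient.Dart :=
      ⟨𝒢.proj (𝒢.isConnected_toGraph_iff.1 h.connected).1.some⟩
    exact_mod_cast Nat.card_pos
  set D : ℝ := (Nat.card 𝒢.quotient.Dart : ℝ)
  obtain ⟨R, hR⟩ := hF0.exists_le_two_mul_ncard_edgeSet h b
  have hcard : ∀ n, ((𝒢.boxVertices b F n).ncard : ℝ) = (n : ℝ) ^ 2 * (D / 3) := by
    intro n
    rw [hF0.ncard_boxVertices, ← hK]
    push_cast
    ring
  have hlim := ((hz.2 b F hF).comp (tendsto_add_atTop_nat (2 * R))).const_mul (D / 3)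
  have hinv : Tendsto (fun n : ℕ => ((n + 2 * R : ℕ) : ℝ)⁻¹) atTop (𝓝 0) :=
    (tendsto_inv_atTop_zero.comp tendsto_natCast_atTop_atTop).comp (tendsto_add_atTop_nat (2 * R))
  -- With `N = n + 2 * R`, the box of side `N` has `N² D/3` vertices and at least `(N - 2R)² D/2`
  -- edges; these terms are the resulting lower bound for `log τ' / N²`. In the limit the factor of
  -- `log 6` is `D/2 - D/3 = D/6`.
  have hlow : Tendsto (fun n : ℕ => ((D / 2 * (1 - 2 * R * ((n + 2 * R : ℕ) : ℝ)⁻¹) ^ 2 - D / 3) *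
      Real.log 6 - Real.log 3 * ((n + 2 * R : ℕ) : ℝ)⁻¹ ^ 2) +
        D / 3 * (Real.log (numSpanningTrees (𝒢.box b F (n + 2 * R))) /
          ((𝒢.box b F (n + 2 * R)).vertexSet.ncard : ℝ))) atTop
      (𝓝 (((D / 2 * (1 - 2 * R * 0) ^ 2 - D / 3) * Real.log 6 - Real.log 3 * 0 ^ 2) +
        D / 3 * z)) := by
    refine Tendsto.add ?_ hlim
    exact ((((((hinv.const_mul _).const_sub 1).pow 2).const_mul _).sub_const _).mul_const _).sub
      ((hinv.pow 2).const_mul _)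
  have hle := le_of_tendsto hlow (b := D / 2 * z') (by
    filter_upwards [eventually_ge_atTop 2] with n hn
    have hN : (0 : ℝ) < ((n + 2 * R : ℕ) : ℝ) := by positivity
    have hb := hbound (𝒢.medialVertices (𝒢.boxVertices b F (n + 2 * R))) (n + 2 * R)
      ((𝒢.finite_edgeSet_induce h (finite_boxVertices (hF0.finite h) _)).image _) (by omega)
      (eq_zero_of_mem_medialVertices (hF0.eq_zero_of_mem_boxVertices (by omega)))
    have hV2 : 2 ≤ (𝒢.boxVertices b F (n + 2 * R)).ncard := by
      rw [hF0.ncard_boxVertices]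
      have : 0 < Nat.card 𝒢.quotient.Vertex := by
        rw [← Nat.cast_pos (α := ℝ), hK]
        positivity
      exact (hn.trans (Nat.le_add_right n _)).trans ((Nat.le_self_pow two_ne_zero _).trans
        (Nat.le_mul_of_pos_right _ this))
    have hlog := log_numSpanningTrees_le_medial h h3 (finite_boxVertices (hF0.finite h) _) hV2
      (hF.connected (n + 2 * R) (by omega))
    have hE : (n : ℝ) ^ 2 * D ≤ 2 * (𝒢.box b F (n + 2 * R)).edgeSet.ncard := by
      have := (Nat.cast_le (α := ℝ)).2 (hR n)
      push_cast at this
      exact this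
    rw [show (𝒢.box b F (n + 2 * R)).vertexSet = 𝒢.boxVertices b F (n + 2 * R) from rfl]
    rw [hcard] at hlog ⊢
    rw [hK', div_le_iff₀ (by positivity)] at hb
    change (((𝒢.box b F (n + 2 * R)).edgeSet.ncard : ℝ) - _) * _ - _ +
      Real.log (numSpanningTrees (𝒢.box b F (n + 2 * R))) ≤ _ at hlog
    have hn' : (n : ℝ) = ((n + 2 * R : ℕ) : ℝ) - 2 * R := by
      push_cast
      ring
    rw [hn'] at hE
    generalize ((n + 2 * R : ℕ) : ℝ) = N at *
    have h6 := Real.log_pos (show (1 : ℝ) < 6 by norm_num)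
    have hE' := mul_le_mul_of_nonneg_right hE h6.le
    refine le_of_mul_le_mul_right ?_ (pow_pos hN 2)
    calc _ = ((N - 2 * R) ^ 2 * D / 2 - N ^ 2 * (D / 3)) * Real.log 6 - Real.log 3 +
          Real.log (numSpanningTrees (𝒢.box b F (n + 2 * R))) := by
          field_simp
      _ ≤ _ := le_trans (by linarith) hb)
  have h0 : D / 6 * (2 * z + Real.log 6) ≤ D / 6 * (3 * z') := by linarith
  exact le_of_mul_le_mul_left h0 (by positivity)

end PeriodicGraph

end PlanarLattice

theorem mainTheorem3 (𝒢 : PlanarLattice.PeriodicGraph.{u}) (hG : 𝒢.IsPlanarLatticeGraph)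
    (h3 : 𝒢.IsRegular 3) :
    𝒢.medial.IsPlanarLatticeGraph ∧ 𝒢.medial.IsRegular 4 ∧
      ∃ z z' : ℝ, 𝒢.HasSpanningTreeEntropy z ∧ 𝒢.medial.HasSpanningTreeEntropy z' ∧
        (𝒢.bipyramidVolumePerVertex ≤ 2 * Real.pi * z →
          𝒢.medial.bipyramidVolumePerVertex < 2 * Real.pi * z') := by
  obtain ⟨z, z', hz, hz', hle⟩ :=
    PlanarLattice.PeriodicGraph.exists_hasSpanningTreeEntropy_medial hG h3
  refine ⟨𝒢.isPlanarLatticeGraph_medial hG, 𝒢.isRegular_medial, z, z', hz, hz', fun hν => ?_⟩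
  rw [PlanarLattice.PeriodicGraph.bipyramidVolumePerVertex_medial 𝒢 hG h3]
  have h4 := PlanarLattice.bipyramidVol_four_lt
  have h := mul_le_mul_of_nonneg_left hle Real.pi_pos.le
  linarith

end
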